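/- **Setting.** Models of second-order set theory are two-sorted structures with individuals and a family of classes of individuals (standard or not). $\mathrm{GBC}$ consists of $\mathrm{ZFC}$ with the separation and collection schemes for first-order formulas with class parameters, first-order class comprehension with class parameters, and a class that well-orders the universe; $\mathrm{KM}$ adds class comprehension for formulas with class quantifiers. $\mathrm{GBCU}$ and $\mathrm{KMU}$ are the analogues with urelements (extensionality only for non-urelements), here in the language with $\in$ and a binary predicate $\vec{\mathbb A}$ that is a one-to-one enumeration of the urelements by pure sets. For a class $B$ of pure sets, "there are $B$ many urelements" means that $\vec{\mathbb A}$ is a bijection of $B$ with the class of urelements. The class choice principle $\mathrm{CC}$ says, for every class $I$ and every formula $\varphi(i,X)$ (class quantifiers and parameters allowed): if for each $i\in I$ there is a class $X$ with $\varphi(i,X)$, then there is a class $Y$ of pairs $\langle i,x\rangle$ with $i\in I$ such that $\varphi(i,Y_i)$ for all $i\in I$, where $Y_i=\{x\mid \langle i,x\rangle\in Y\}$. Let $\langle V,\in,\mathcal V\rangle\models\mathrm{GBC}$ and $A\in\mathcal V$. Let $V[\![A]\!]$ be the smallest class containing $\bar a=\langle 0,a\rangle$ for every $a\in A$, and containing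 $\langle 1,y\rangle$ for every set $y\subseteq V[\![A]\!]$. Put $x\mathrel{\bar\in}\langle 1,y\rangle$ iff $x\in y$, with the $\bar a$ having no $\bar\in$-elements. Recursively let $\check u=\langle 1,\{\check v\mid v\in u\}\rangle$ for $u\in V$, let $\vec{\mathbb A}$ hold exactly of the pairs $(\check a,\bar a)$ with $a\in A$, let $\hat A=\{\check a\mid a\in A\}$, and let $\mathcal V[\![A]\!]=\{B\in\mathcal V\mid B\subseteq V[\![A]\!]\}$. **Theorem.** For every model $\langle V,\in,\mathcal V\rangle$ of $\mathrm{GBC}$ and every class $A\in\mathcal V$: 1. $\langle V,\in,\mathcal V\rangle$, with $A$ as its only parameter, and $\langle V[\![A]\!],\bar\in,\vec{\mathbb A},\mathcal V[\![A]\!]\rangle$, with no parameters, are bi-interpretable: each structure is interpreted in the other by formulas of the two-sorted language (using only the indicated parameters), and each can define, with only its indicated parameters, an isomorphism of itself with the copy of itself that is interpreted inside its interpreted copy of the other. 2. $\langle V[\![A]\!],\bar\in,\vec{\mathbb A},\mathcal V[\![A]\!]\rangle$ is a model of $\mathrm{GBCU}$ together with "there are $\hat A$ many urelements", where $\hat A$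 is the copy of $A$ among the pure sets of that model. 3. If $\langle V,\in,\mathcal V\rangle\models\mathrm{KM}$, then $\langle V[\![A]\!],\bar\in,\vec{\mathbb A},\mathcal V[\![A]\!]\rangle\models\mathrm{KMU}$. 4. If $\langle V,\in,\mathcal V\rangle\models\mathrm{CC}$, then $\langle V[\![A]\!],\bar\in,\vec{\mathbb A},\mathcal V[\![A]\!]\rangle\models\mathrm{CC}$. -/

import Mathlib

universe u

/-! ## Two-sorted class structures and their language -/

/-- The two sorts of second-order set theory: individuals and classes. -/
inductive Srt : Type
  | obj
  | cls
  deriving DecidableEq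

/-- A structure `⟨M, …, 𝓜⟩` for second-order set theory: a domain `Obj` of individuals with binary
relations named by the symbols in `L`, and a family `Cls` of classes of individuals. There is no
assumption of standardness or well-foundedness. -/
structure ClassModel (L : Type) where
  /-- the individuals -/
  Obj : Type u
  /-- the basic relations on the individuals -/
  rel : L → Obj → Obj → Prop
  /-- the classes -/
  Cls : Set (Set Obj)

/-- Formulas of the two-sorted language over the binary relation symbols `L`, with variables
numbered by `ℕ` in each sort. Atomic formulas: `r(x, y)`, `x = y`, and `x ∈ X`. -/
inductive Fml (L : Type) : Type
  | rel (r : L) (x y : ℕ)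
  | eq (x y : ℕ)
  | mem (x X : ℕ)
  | neg (φ : Fml L)
  | and (φ ψ : Fml L)
  | all (σ : Srt) (n : ℕ) (φ : Fml L)

/-- A formula is first-order if it has no class quantifiers (class variables may occur free). -/
def Fml.IsFirstOrder {L : Type} : Fml L → Prop
  | .rel _ _ _ => True
  | .eq _ _ => True
  | .mem _ _ => True
  | .neg φ => φ.IsFirstOrder
  | .and φ ψ => φ.IsFirstOrder ∧ ψ.IsFirstOrder
  | .all σ _ φ => σ = .obj ∧ φ.IsFirstOrder

namespace ClassModel

section Semantics

variable {L : Type} (M : ClassModel.{u} L)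

/-- The domain of each sort. -/
def Dom : Srt → Type u
  | .obj => M.Obj
  | .cls => M.Cls

/-- Assignments of values to the variables of both sorts. -/
abbrev Val : Type u := (σ : Srt) → ℕ → M.Dom σ

/-- The assignment `e`, with the value of the `n`-th variable of sort `σ` changed to `a`. -/
def Val.set {M : ClassModel.{u} L} (e : M.Val) (σ : Srt) (n : ℕ) (a : M.Dom σ) : M.Val :=
  Function.update e σ (Function.update (e σ) n a)

/-- Tarskian satisfaction; the class quantifiers range over the classes of the model. -/
def Sat : M.Val → Fml L → Prop
  | e, .rel r x y => M.rel r (e .obj x) (e .obj y)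
  | e, .eq x y => e .obj x = e .obj y
  | e, .mem x X => (e .obj x : M.Obj) ∈ (e .cls X : M.Cls).1
  | e, .neg φ => ¬ Sat e φ
  | e, .and φ ψ => Sat e φ ∧ Sat e ψ
  | e, .all σ n φ => ∀ a : M.Dom σ, Sat (e.set σ n a) φ

/-- The relation `D` on tuples of the sorts `s` is definable in `M` by a formula of the two-sorted
language, with the class parameters `P` and no others. -/
def Definable {m : ℕ} (P : Fin m → M.Cls) {ι : Type} (s : ι → Srt)
    (D : ((i : ι) → M.Dom (s i)) → Prop) : Prop :=
  ∃ (φ : Fml L) (v : ι ⊕ Fin m ↪ ℕ), ∀ e : M.Val,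
    (∀ j, e .cls (v (.inr j)) = P j) →
      (M.Sat e φ ↔ D fun i => e (s i) (v (.inl i)))

end Semantics

/-! ## Interpretations and bi-interpretations -/

section Interpretations

variable {L L' : Type}

/-- An interpretation of `N` in `M`, with class parameters `P`. Every element of `N`, of either sort,
is represented by tuples from `M` of a fixed shape; a tuple represents at most one element, and
the pullbacks to `M` of equality (in particular the domain of representing tuples), of the basic
relations, and of the relation `x ∈ X` are definable in `M` from the parameters. In other words, `N` is
isomorphic to a quotient of a definable structure of tuples by a definable congruence. -/
structure Interpretation (M : ClassModel.{u} L) {m : ℕ} (P : Fin m → M.Cls)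
    (N : ClassModel.{u} L') where
  /-- length of the tuples that represent elements of a given sort of `N` -/
  dim : Srt → ℕ
  /-- sorts of the entries of these tuples -/
  shape : (σ : Srt) → Fin (dim σ) → Srt
  /-- `rep σ t x`: the tuple `t` represents `x` -/
  rep : (σ : Srt) → ((i : Fin (dim σ)) → M.Dom (shape σ i)) → N.Dom σ → Prop
  functional : ∀ σ t x y, rep σ t x → rep σ t y → x = y
  surjective : ∀ σ x, ∃ t, rep σ t x
  definable_eq : ∀ σ, M.Definable P (Sum.elim (shape σ) (shape σ)) fun t =>
    ∃ x, rep σ (fun i => t (.inl i)) x ∧ rep σ (fun i => t (.inr i)) x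
  definable_rel : ∀ r : L', M.Definable P (Sum.elim (shape .obj) (shape .obj)) fun t =>
    ∃ x y : N.Obj, rep .obj (fun i => t (.inl i)) x ∧ rep .obj (fun i => t (.inr i)) y ∧ N.rel r x y
  definable_mem : M.Definable P (Sum.elim (shape .obj) (shape .cls)) fun t =>
    ∃ (x : N.Obj) (X : N.Cls),
      rep .obj (fun i => t (.inl i)) x ∧ rep .cls (fun i => t (.inr i)) X ∧ x ∈ X.1

/-- Let `I` interpret `N` in `M` and `J` interpret `M` in `N`. Then tuples of tuples of `M` represent
elements of `N`-tuples, which represent elements of `M`, so `M` is isomorphic to a copy of `M` inside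
the copy of `N` inside `M`. This says that the isomorphism is definable in `M`, on each sort, from
the parameters `P`. -/
def Interpretation.DefinableReturn {M : ClassModel.{u} L} {m : ℕ} {P : Fin m → M.Cls}
    {N : ClassModel.{u} L'} {k : ℕ} {Q : Fin k → N.Cls}
    (I : Interpretation M P N) (J : Interpretation N Q M) : Prop :=
  ∀ σ : Srt, M.Definable P
    (ι := ((i : Fin (J.dim σ)) × Fin (I.dim (J.shape σ i))) ⊕ Unit)
    (Sum.elim (fun p => I.shape (J.shape σ p.1) p.2) (fun _ => σ))
    fun t => ∃ y : (i : Fin (J.dim σ)) → N.Dom (J.shape σ i),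
      (∀ i, I.rep (J.shape σ i) (fun j => t (.inl ⟨i, j⟩)) (y i)) ∧ J.rep σ y (t (.inr ()))

/-- `M` (using only the class parameters `P`) and `N` (using only the class parameters `Q`) are
bi-interpretable: each is interpreted in the other, and each can define how it is isomorphic to
the copy of itself inside the copy of the other. -/
def BiInterpretable (M : ClassModel.{u} L) {m : ℕ} (P : Fin m → M.Cls)
    (N : ClassModel.{u} L') {k : ℕ} (Q : Fin k → N.Cls) : Prop :=
  ∃ (I : Interpretation M P N) (J : Interpretation N Q M),
    I.DefinableReturn J ∧ J.DefinableReturn I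

end Interpretations

end ClassModel

/-! ## Set-theoretic vocabulary

Here `E` is a membership relation and `At` is the predicate of being an urelement. -/

section Vocabulary

variable {α : Type u} (E : α → α → Prop) (At : α → Prop)

/-- `c = {a, b}` -/
def IsUPair (a b c : α) : Prop := ¬ At c ∧ ∀ z, E z c ↔ z = a ∨ z = b

/-- `p` is the (Kuratowski) ordered pair `{{a}, {a, b}}` -/
def IsOPair (a b p : α) : Prop :=
  ¬ At p ∧ ∀ z, E z p ↔ IsUPair E At a a z ∨ IsUPair E At a b z

/-- `z = ∅` -/
def IsEmptySet (z : α) : Prop := ¬ At z ∧ ∀ w, ¬ E w z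

/-- `x` is a pure set: it belongs to a transitive set having no urelements as elements. -/
def IsPure (x : α) : Prop :=
  ∃ t, ¬ At t ∧ E x t ∧ (∀ y, E y t → ∀ z, E z y → E z t) ∧ ∀ y, E y t → ¬ At y

/-- The single axioms of `ZFCU`. With no urelements, these are the single axioms of `ZFC`. -/
structure ZFCUAxioms : Prop where
  atoms : ∀ a, At a → ∀ x, ¬ E x a
  extensionality : ∀ x y, ¬ At x → ¬ At y → (∀ z, E z x ↔ E z y) → x = y
  foundation : ∀ x, (∃ y, E y x) → ∃ y, E y x ∧ ∀ z, E z x → ¬ E z y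
  pairing : ∀ a b, ∃ c, IsUPair E At a b c
  union : ∀ x, ∃ y, ¬ At y ∧ ∀ z, E z y ↔ ∃ w, E w x ∧ E z w
  power : ∀ x, ∃ y, ¬ At y ∧ ∀ z, E z y ↔ ¬ At z ∧ ∀ w, E w z → E w x
  infinity : ∃ x, ¬ At x ∧ (∃ z, E z x ∧ IsEmptySet E At z) ∧
    ∀ y, E y x → ∃ s, E s x ∧ ¬ At s ∧ ∀ z, E z s ↔ E z y ∨ z = y
  /-- every set of disjoint nonempty sets has a transversal -/
  choice : ∀ x, (∀ y, E y x → ∃ z, E z y) →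
    (∀ y, E y x → ∀ y', E y' x → (∃ z, E z y ∧ E z y') → y = y') →
    ∃ c, ¬ At c ∧ ∀ y, E y x → ∃! z, E z y ∧ E z c

end Vocabulary

/-! ## The theories -/

namespace ClassModel

section Theories

variable {L : Type} (M : ClassModel.{u} L)

/-- Separation scheme, for first-order formulas with set and class parameters. -/
def Separation (E : M.Obj → M.Obj → Prop) (At : M.Obj → Prop) : Prop :=
  ∀ φ : Fml L, φ.IsFirstOrder → ∀ (e : M.Val) (x : M.Obj),
    ∃ y, ¬ At y ∧ ∀ z, E z y ↔ E z x ∧ M.Sat (e.set .obj 0 z) φ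

/-- Collection scheme, for first-order formulas with set and class parameters. -/
def Collection (E : M.Obj → M.Obj → Prop) (At : M.Obj → Prop) : Prop :=
  ∀ φ : Fml L, φ.IsFirstOrder → ∀ (e : M.Val) (x : M.Obj),
    (∀ a : M.Obj, E a x → ∃ b : M.Obj, M.Sat ((e.set .obj 0 a).set .obj 1 b) φ) →
    ∃ y, ¬ At y ∧ ∀ a : M.Obj, E a x → ∃ b : M.Obj, E b y ∧
      M.Sat ((e.set .obj 0 a).set .obj 1 b) φ

/-- First-order class comprehension, with set and class parameters. -/
def FirstOrderComprehension : Prop :=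
  ∀ φ : Fml L, φ.IsFirstOrder → ∀ e : M.Val, {a : M.Obj | M.Sat (e.set .obj 0 a) φ} ∈ M.Cls

/-- Second-order class comprehension, with set and class parameters. -/
def SecondOrderComprehension : Prop :=
  ∀ (φ : Fml L) (e : M.Val), {a : M.Obj | M.Sat (e.set .obj 0 a) φ} ∈ M.Cls

/-- Some class is a well-order of all individuals (not necessarily of type `Ord`). -/
def GlobalWellOrder (E : M.Obj → M.Obj → Prop) (At : M.Obj → Prop) : Prop :=
  ∃ R ∈ M.Cls, ∃ lt : M.Obj → M.Obj → Prop,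
    (∀ p, p ∈ R ↔ ∃ x y, IsOPair E At x y p ∧ lt x y) ∧
    (∀ x, ¬ lt x x) ∧ (∀ x y z, lt x y → lt y z → lt x z) ∧
    (∀ x y, lt x y ∨ x = y ∨ lt y x) ∧
    ∀ X ∈ M.Cls, X.Nonempty → ∃ x ∈ X, ∀ y ∈ X, ¬ lt y x

/-- The axioms common to `GBC` and `GBCU`, for the membership relation `E` and the predicate `At` of
being an urelement. -/
structure GBAxioms (E : M.Obj → M.Obj → Prop) (At : M.Obj → Prop) : Prop where
  zfcu : ZFCUAxioms E At
  separation : M.Separation E At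
  collection : M.Collection E At
  comprehension : M.FirstOrderComprehension
  globalWellOrder : M.GlobalWellOrder E At

/-- The class choice principle, for second-order formulas `φ(i, X)` with set and class parameters (the
class `I` may be one of them). -/
def ClassChoicePrinciple (E : M.Obj → M.Obj → Prop) (At : M.Obj → Prop) : Prop :=
  ∀ (φ : Fml L) (e : M.Val), ∀ I ∈ M.Cls,
    (∀ i ∈ I, ∃ X : M.Cls, M.Sat ((e.set .obj 0 i).set .cls 0 X) φ) →
    ∃ Y ∈ M.Cls, (∀ p ∈ Y, ∃ i ∈ I, ∃ x, IsOPair E At i x p) ∧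
      ∀ i ∈ I, ∃ X : M.Cls, X.1 = {x | ∃ p ∈ Y, IsOPair E At i x p} ∧
        M.Sat ((e.set .obj 0 i).set .cls 0 X) φ

end Theories

end ClassModel

/-- The language of pure class theory. -/
inductive SetSymb : Type
  | mem

/-- The language of urelement class theory with an enumeration predicate for the urelements. -/
inductive USymb : Type
  | mem
  | enum

/-- Structures `⟨V, ∈, 𝓥⟩` -/
abbrev SetModel := ClassModel.{u} SetSymb

/-- Structures `⟨V, ∈, 𝔸⃗, 𝓥⟩` -/
abbrev UModel := ClassModel.{u} USymb

namespace SetModel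

variable (M : SetModel.{u})

/-- Membership in a model of pure class theory. -/
def E : M.Obj → M.Obj → Prop := M.rel .mem

/-- In pure class theory there are no urelements. -/
def NoAtom : M.Obj → Prop := fun _ => False

/-- Gödel-Bernays set theory with global choice -/
def GBC : Prop := ClassModel.GBAxioms M (E M) (NoAtom M)

/-- Kelley-Morse set theory -/
def KM : Prop := GBC M ∧ ClassModel.SecondOrderComprehension M

/-- The class choice principle -/
def CC : Prop := ClassModel.ClassChoicePrinciple M (E M) (NoAtom M)

end SetModel

namespace UModel

variable (N : UModel.{u})

/-- Membership in a model of urelement class theory. -/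
def E : N.Obj → N.Obj → Prop := N.rel .mem

/-- `Enum N i a`: the urelement `a` is enumerated by `i`. -/
def Enum : N.Obj → N.Obj → Prop := N.rel .enum

/-- The urelements are the objects enumerated by the enumeration predicate. -/
def Atom (a : N.Obj) : Prop := ∃ i, Enum N i a

/-- `GBCU`, in the language with the enumeration predicate, which is a one-to-one enumeration of the
urelements by pure sets. -/
structure GBCU : Prop where
  axioms : ClassModel.GBAxioms N (E N) (Atom N)
  enum_pure : ∀ i a, Enum N i a → IsPure (E N) (Atom N) i
  enum_functional : ∀ i a b, Enum N i a → Enum N i b → a = b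
  enum_injective : ∀ i j a, Enum N i a → Enum N j a → i = j

/-- `KMU`, in the language with the enumeration predicate -/
def KMU : Prop := GBCU N ∧ ClassModel.SecondOrderComprehension N

/-- The class choice principle -/
def CC : Prop := ClassModel.ClassChoicePrinciple N (E N) (Atom N)

/-- There are `B` many urelements, for a class `B` of pure sets: the enumeration predicate is (the
graph of) a bijection of `B` with the class of all urelements. -/
def ManyAtoms (B : Set N.Obj) : Prop :=
  B ∈ N.Cls ∧ (∀ i ∈ B, IsPure (E N) (Atom N) i) ∧
    (∀ i a, Enum N i a → i ∈ B) ∧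
    (∀ i ∈ B, ∃! a, Enum N i a) ∧ (∀ a, Atom N a → ∃! i, Enum N i a)

end UModel

/-! ## The interpreted urelement model -/

namespace SetModel

variable (M : SetModel.{u})

/-- `x = ⟨0, a⟩` in the sense of `M` -/
def IsTagZero (a x : M.Obj) : Prop :=
  ∃ z, IsEmptySet (E M) (NoAtom M) z ∧ IsOPair (E M) (NoAtom M) z a x

/-- `x = ⟨1, y⟩` in the sense of `M`, where `1 = {∅}` -/
def IsTagOne (y x : M.Obj) : Prop :=
  ∃ z o, IsEmptySet (E M) (NoAtom M) z ∧ IsUPair (E M) (NoAtom M) z z o ∧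
    IsOPair (E M) (NoAtom M) o y x

/-- `C` contains `⟨0, a⟩` for all `a ∈ A`, and contains `⟨1, y⟩` for every set `y ⊆ C`. -/
def UClosed (A C : Set M.Obj) : Prop :=
  (∀ a ∈ A, ∀ x, IsTagZero M a x → x ∈ C) ∧
    ∀ y, (∀ v, E M v y → v ∈ C) → ∀ x, IsTagOne M y x → x ∈ C

/-- `V⟦A⟧`, the smallest class with the closure property above. -/
def UDomain (A : Set M.Obj) : Set M.Obj := {x | ∀ C ∈ M.Cls, UClosed M A C → x ∈ C}

/-- `f` is a class function of `M` with `f(u) = ⟨1, {f(v) | v ∈ u}⟩` for all `u`. -/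
def IsCheckMap (f : M.Obj → M.Obj) : Prop :=
  {p | ∃ u, IsOPair (E M) (NoAtom M) u (f u) p} ∈ M.Cls ∧
    ∀ u, ∃ y, (∀ w, E M w y ↔ ∃ v, E M v u ∧ w = f v) ∧ IsTagOne M y (f u)

/-- `x = ǔ`, the copy of the set `u` among the pure sets of `V⟦A⟧`; here `ǔ = ⟨1, {v̌ | v ∈ u}⟩`. -/
def IsCheck (u x : M.Obj) : Prop := ∃ f, IsCheckMap M f ∧ f u = x

/-- The structure `⟨V⟦A⟧, ∈̄, 𝔸⃗, 𝓥⟦A⟧⟩`, where `x ∈̄ ⟨1, y⟩` iff `x ∈ y`, the urelements are the `⟨0, a⟩`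
enumerated by `ǎ` for `a ∈ A`, and the classes are the classes of `M` contained in `V⟦A⟧`. -/
def uModel (A : Set M.Obj) : UModel.{u} where
  Obj := UDomain M A
  rel
    | .mem => fun x z => ∃ y, IsTagOne M y z.1 ∧ E M x.1 y
    | .enum => fun i x => ∃ a ∈ A, IsCheck M a i.1 ∧ IsTagZero M a x.1
  Cls := {B | Subtype.val '' B ∈ M.Cls}

/-- The class `{ǎ | a ∈ A}` of pure sets of `V⟦A⟧`, which is the copy of `A` there. -/
def hat (A : Set M.Obj) : Set (uModel M A).Obj := {i | ∃ a ∈ A, IsCheck M a i.1}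

end SetModel

/-! Inside `M`, the class V⟦A⟧ is first-order definable from `A`: an object lies in it iff it
belongs to a set `t` each of whose elements is ⟨0, a⟩ with a ∈ A or ⟨1, y⟩ with y ⊆ t
(`uDomain_eq`). So V⟦A⟧ is a class. Relativizing quantifiers to it turns every formula about the
urelement model into a formula about `M` (`exists_translation`). The parameters are the classes
V⟦A⟧, the graph of u ↦ ǔ and A, and first-order formulas stay first-order. Hence separation,
collection, both comprehension schemes and class choice pass from `M` to the urelement model. The
single axioms are checked directly: the sets of the model are the ⟨1, y⟩ with y a set of objects of
the model, so each axiom is the corresponding one of `M` up to tags.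

For the bi-interpretation, `M` interprets the model by letting objects and classes represent
themselves. Conversely, the pure sets of the model are exactly the ǔ (`isPure_iff`), so V is
isomorphic to a class of the model that is definable without parameters, and its classes correspond
to the classes of pure sets. The return map of `M` is u ↦ ǔ. That of the model sends x, regarded as
an object of `M`, to its copy x̌. The model computes it by recursion, because the check map
preserves ordered pairs (`check_op`): an atom with index i goes to ⟨0, i⟩, and a set goes to ⟨1, y⟩
with y the set of the codes of its elements. The enumeration predicate is what recovers the index of
an atom. Both recursions are made parameter-free by quantifying over classes that are partial
solutions (`ex_isCheck`, `ex_code`).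

Formulas are mostly not written out. `Ex` is a family of predicates closed under the logical
operations, and `Ex.supplies` turns its members into formulas. -/

namespace ClassModel

/-! ### From predicates built by logical operations to formulas -/

section Expressibility

variable {L : Type} {M : ClassModel.{u} L}

/-- A family of variables of both sorts, as projections from a type `Γ` of environments. -/
abbrev Vars (M : ClassModel.{u} L) (Γ : Type u) : Type u := (σ : Srt) → (Γ → M.Dom σ) → Prop

/-- No variables. -/
def Vars.nil (M : ClassModel.{u} L) : Vars M PUnit.{u + 1} := fun _ _ => False

/-- The variables of `W`, and a new one of sort `σ`. -/
def Vars.ext {Γ : Type u} (W : Vars M Γ) (σ : Srt) : Vars M (Γ × M.Dom σ) := fun τ y =>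
  (∃ x, W τ x ∧ y = fun p => x p.1) ∨ ∃ h : σ = τ, y = fun p => h ▸ p.2

/-- Terms: variables and, if `par` is true, constants. -/
inductive Tm (par : Bool) : {Γ : Type u} → Vars M Γ → (σ : Srt) → (Γ → M.Dom σ) → Prop
  | const {Γ : Type u} {W : Vars M Γ} {σ : Srt} (b : M.Dom σ) (h : par = true) :
      Tm par W σ (fun _ => b)
  -- The digit in `v0`, ..., `v5` counts the variables added after the one named; the digit in `l1`,
  -- ..., `l7` counts the new variables past which a term is lifted.
  | v0 {Γ : Type u} {W : Vars M Γ} {σ : Srt} : Tm par (W.ext σ) σ (fun p => p.2)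
  | v1 {Γ : Type u} {W : Vars M Γ} {σ σ₁ : Srt} :
      Tm par ((W.ext σ).ext σ₁) σ (fun p => p.1.2)
  | v2 {Γ : Type u} {W : Vars M Γ} {σ σ₁ σ₂ : Srt} :
      Tm par (((W.ext σ).ext σ₁).ext σ₂) σ (fun p => p.1.1.2)
  | v3 {Γ : Type u} {W : Vars M Γ} {σ σ₁ σ₂ σ₃ : Srt} :
      Tm par ((((W.ext σ).ext σ₁).ext σ₂).ext σ₃) σ (fun p => p.1.1.1.2)
  | v4 {Γ : Type u} {W : Vars M Γ} {σ σ₁ σ₂ σ₃ σ₄ : Srt} :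
      Tm par (((((W.ext σ).ext σ₁).ext σ₂).ext σ₃).ext σ₄) σ (fun p => p.1.1.1.1.2)
  | v5 {Γ : Type u} {W : Vars M Γ} {σ σ₁ σ₂ σ₃ σ₄ σ₅ : Srt} :
      Tm par ((((((W.ext σ).ext σ₁).ext σ₂).ext σ₃).ext σ₄).ext σ₅) σ (fun p => p.1.1.1.1.1.2)
  | l1 {Γ : Type u} {W : Vars M Γ} {σ τ : Srt} {x : Γ → M.Dom τ} (h : Tm par W τ x) :
      Tm par (W.ext σ) τ (fun p => x p.1)
  | l2 {Γ : Type u} {W : Vars M Γ} {σ σ₁ τ : Srt} {x : Γ → M.Dom τ} (h : Tm par W τ x) :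
      Tm par ((W.ext σ).ext σ₁) τ (fun p => x p.1.1)
  | l3 {Γ : Type u} {W : Vars M Γ} {σ σ₁ σ₂ τ : Srt} {x : Γ → M.Dom τ} (h : Tm par W τ x) :
      Tm par (((W.ext σ).ext σ₁).ext σ₂) τ (fun p => x p.1.1.1)
  | l4 {Γ : Type u} {W : Vars M Γ} {σ σ₁ σ₂ σ₃ τ : Srt} {x : Γ → M.Dom τ} (h : Tm par W τ x) :
      Tm par ((((W.ext σ).ext σ₁).ext σ₂).ext σ₃) τ (fun p => x p.1.1.1.1)
  | l5 {Γ : Type u} {W : Vars M Γ} {σ σ₁ σ₂ σ₃ σ₄ τ : Srt} {x : Γ → M.Dom τ}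
      (h : Tm par W τ x) :
      Tm par (((((W.ext σ).ext σ₁).ext σ₂).ext σ₃).ext σ₄) τ (fun p => x p.1.1.1.1.1)
  | l6 {Γ : Type u} {W : Vars M Γ} {σ σ₁ σ₂ σ₃ σ₄ σ₅ τ : Srt} {x : Γ → M.Dom τ}
      (h : Tm par W τ x) :
      Tm par ((((((W.ext σ).ext σ₁).ext σ₂).ext σ₃).ext σ₄).ext σ₅) τ (fun p => x p.1.1.1.1.1.1)
  | l7 {Γ : Type u} {W : Vars M Γ} {σ σ₁ σ₂ σ₃ σ₄ σ₅ σ₆ τ : Srt} {x : Γ → M.Dom τ}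
      (h : Tm par W τ x) :
      Tm par (((((((W.ext σ).ext σ₁).ext σ₂).ext σ₃).ext σ₄).ext σ₅).ext σ₆) τ
        (fun p => x p.1.1.1.1.1.1.1)

/-- Predicates of environments expressible by a formula, with parameters if `par` is true, and
without class quantifiers if `fo` is true. -/
inductive Ex (fo par : Bool) : {Γ : Type u} → Vars M Γ → (Γ → Prop) → Prop
  | rel {Γ : Type u} {W : Vars M Γ} {r : L} {x y : Γ → M.Dom .obj} (hx : Tm par W .obj x)
      (hy : Tm par W .obj y) : Ex fo par W (fun g => M.rel r (x g) (y g))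
  | eq {Γ : Type u} {W : Vars M Γ} {x y : Γ → M.Obj} (hx : Tm par W .obj x)
      (hy : Tm par W .obj y) : Ex fo par W (fun g => x g = y g)
  | memC {Γ : Type u} {W : Vars M Γ} {x : Γ → M.Obj} {X : Γ → M.Cls}
      (hx : Tm par W .obj x) (hX : Tm par W .cls X) :
      Ex fo par W (fun g => x g ∈ (X g).1)
  | memS {Γ : Type u} {W : Vars M Γ} {x : Γ → M.Obj} {X : Set M.Obj} (hX : X ∈ M.Cls)
      (hx : Tm par W .obj x) (h : par = true) :
      Ex fo par W (fun g => x g ∈ X)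
  | false {Γ : Type u} {W : Vars M Γ} : Ex fo par W (fun _ => False)
  | neg {Γ : Type u} {W : Vars M Γ} {D : Γ → Prop} (h : Ex fo par W D) :
      Ex fo par W (fun g => ¬ D g)
  | and {Γ : Type u} {W : Vars M Γ} {D D' : Γ → Prop} (h : Ex fo par W D) (h' : Ex fo par W D') :
      Ex fo par W (fun g => D g ∧ D' g)
  | or {Γ : Type u} {W : Vars M Γ} {D D' : Γ → Prop} (h : Ex fo par W D) (h' : Ex fo par W D') :
      Ex fo par W (fun g => D g ∨ D' g)
  | imp {Γ : Type u} {W : Vars M Γ} {D D' : Γ → Prop} (h : Ex fo par W D) (h' : Ex fo par W D') :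
      Ex fo par W (fun g => D g → D' g)
  | iff {Γ : Type u} {W : Vars M Γ} {D D' : Γ → Prop} (h : Ex fo par W D) (h' : Ex fo par W D') :
      Ex fo par W (fun g => D g ↔ D' g)
  | exO {Γ : Type u} {W : Vars M Γ} {D : Γ → M.Obj → Prop}
      (h : Ex fo par (W.ext .obj) (fun p => D p.1 p.2)) : Ex fo par W (fun g => ∃ a, D g a)
  | allO {Γ : Type u} {W : Vars M Γ} {D : Γ → M.Obj → Prop}
      (h : Ex fo par (W.ext .obj) (fun p => D p.1 p.2)) : Ex fo par W (fun g => ∀ a, D g a)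
  | exC {Γ : Type u} {W : Vars M Γ} {D : Γ → M.Cls → Prop} (hf : fo = Bool.false)
      (h : Ex fo par (W.ext .cls) (fun p => D p.1 p.2)) : Ex fo par W (fun g => ∃ a, D g a)
  | allC {Γ : Type u} {W : Vars M Γ} {D : Γ → M.Cls → Prop} (hf : fo = Bool.false)
      (h : Ex fo par (W.ext .cls) (fun p => D p.1 p.2)) : Ex fo par W (fun g => ∀ a, D g a)

/-- `Cod σ i x` says that the variable `x` is named by the number `i`; all names are below `K`. -/
structure IsCoding {Γ : Type u} (W : Vars M Γ) (cs : (σ : Srt) → Set (M.Dom σ)) (K : ℕ)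
    (Cod : (σ : Srt) → ℕ → (Γ → M.Dom σ) → Prop) : Prop where
  var : ∀ σ x, W σ x → ∃ i, Cod σ i x
  const : ∀ σ, ∀ b ∈ cs σ, ∃ i, Cod σ i fun _ => b
  lt : ∀ σ i x, Cod σ i x → i < K

/-- The coding in which the new variable of sort `σ` is named by `K`. -/
def extCod {Γ : Type u} (K : ℕ) (Cod : (σ : Srt) → ℕ → (Γ → M.Dom σ) → Prop) (σ : Srt) :
    (τ : Srt) → ℕ → (Γ × M.Dom σ → M.Dom τ) → Prop := fun τ i y =>
  (∃ x, Cod τ i x ∧ y = fun p => x p.1) ∨ (i = K ∧ ∃ h : σ = τ, y = fun p => h ▸ p.2)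

theorem IsCoding.ext {Γ : Type u} {W : Vars M Γ} {cs : (σ : Srt) → Set (M.Dom σ)} {K : ℕ}
    {Cod : (σ : Srt) → ℕ → (Γ → M.Dom σ) → Prop} (h : IsCoding W cs K Cod) (σ : Srt) :
    IsCoding (W.ext σ) cs (K + 1) (extCod K Cod σ) where
  var := by
    rintro τ y (⟨x, hx, rfl⟩ | ⟨rfl, rfl⟩)
    · obtain ⟨i, hi⟩ := h.var τ x hx
      exact ⟨i, .inl ⟨x, hi, rfl⟩⟩
    · exact ⟨K, .inr ⟨rfl, rfl, rfl⟩⟩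
  const := by
    intro τ b hb
    obtain ⟨i, hi⟩ := h.const τ b hb
    exact ⟨i, .inl ⟨_, hi, rfl⟩⟩
  lt := by
    rintro τ i y (⟨x, hx, rfl⟩ | ⟨rfl, -⟩)
    · exact (h.lt _ _ _ hx).trans (Nat.lt_succ_self _)
    · exact Nat.lt_succ_self _

theorem IsCoding.mono {Γ : Type u} {W : Vars M Γ} {cs cs' : (σ : Srt) → Set (M.Dom σ)} {K : ℕ}
    {Cod : (σ : Srt) → ℕ → (Γ → M.Dom σ) → Prop} (h : IsCoding W cs K Cod)
    (hs : ∀ σ, cs' σ ⊆ cs σ) : IsCoding W cs' K Cod :=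
  ⟨h.var, fun σ b hb => h.const σ b (hs σ hb), h.lt⟩

/-- The valuation `e` agrees with the environment `g` on all named variables. -/
def Agree {Γ : Type u} (Cod : (σ : Srt) → ℕ → (Γ → M.Dom σ) → Prop) (e : M.Val) (g : Γ) : Prop :=
  ∀ σ i x, Cod σ i x → e σ i = x g

@[simp] theorem Val.set_same (e : M.Val) (σ : Srt) (n : ℕ) (a : M.Dom σ) :
    e.set σ n a σ n = a := by
  simp [Val.set]

theorem Val.set_of_ne_index (e : M.Val) (σ τ : Srt) {n i : ℕ} (a : M.Dom σ) (h : i ≠ n) :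
    e.set σ n a τ i = e τ i := by
  unfold Val.set
  by_cases hσ : τ = σ
  · subst hσ
    simp [Function.update_of_ne h]
  · rw [Function.update_of_ne hσ]

theorem Val.set_of_ne_sort (e : M.Val) {σ τ : Srt} (n i : ℕ) (a : M.Dom σ) (h : τ ≠ σ) :
    e.set σ n a τ i = e τ i := by
  unfold Val.set
  rw [Function.update_of_ne h]

theorem Agree.ext {Γ : Type u} {W : Vars M Γ} {cs : (σ : Srt) → Set (M.Dom σ)} {K : ℕ}
    {Cod : (σ : Srt) → ℕ → (Γ → M.Dom σ) → Prop} (h : IsCoding W cs K Cod) {e : M.Val} {g : Γ}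
    (he : Agree Cod e g) (σ : Srt) (a : M.Dom σ) :
    Agree (extCod K Cod σ) (e.set σ K a) (g, a) := by
  rintro τ i y (⟨x, hx, rfl⟩ | ⟨rfl, rfl, rfl⟩)
  · rw [Val.set_of_ne_index _ _ _ _ (h.lt _ _ _ hx).ne]
    exact he _ _ _ hx
  · simp

theorem Tm.exists_name {par : Bool} {Γ : Type u} {W : Vars M Γ} {σ : Srt} {x : Γ → M.Dom σ}
    (h : Tm par W σ x) :
    W σ x ∨ par = true ∧ ∃ b, x = fun _ => b := by
  induction h with
  | const b h => exact .inr ⟨h, b, rfl⟩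
  | v0 => exact .inl (.inr ⟨rfl, rfl⟩)
  | v1 => exact .inl (.inl ⟨_, .inr ⟨rfl, rfl⟩, rfl⟩)
  | v2 => exact .inl (.inl ⟨_, .inl ⟨_, .inr ⟨rfl, rfl⟩, rfl⟩, rfl⟩)
  | v3 => exact .inl (.inl ⟨_, .inl ⟨_, .inl ⟨_, .inr ⟨rfl, rfl⟩, rfl⟩, rfl⟩, rfl⟩)
  | v4 => exact .inl (.inl ⟨_, .inl ⟨_, .inl ⟨_, .inl ⟨_, .inr ⟨rfl, rfl⟩, rfl⟩, rfl⟩, rfl⟩, rfl⟩)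
  | v5 => exact .inl (.inl ⟨_, .inl ⟨_, .inl ⟨_, .inl ⟨_, .inl ⟨_, .inr ⟨rfl, rfl⟩, rfl⟩, rfl⟩,
      rfl⟩, rfl⟩, rfl⟩)
  | l1 _ ih =>
    rcases ih with h | ⟨h, b, rfl⟩
    · exact .inl (.inl ⟨_, h, rfl⟩)
    · exact .inr ⟨h, b, rfl⟩
  | l2 _ ih =>
    rcases ih with h | ⟨h, b, rfl⟩
    · exact .inl (.inl ⟨_, (.inl ⟨_, h, rfl⟩), rfl⟩)
    · exact .inr ⟨h, b, rfl⟩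
  | l3 _ ih =>
    rcases ih with h | ⟨h, b, rfl⟩
    · exact .inl (.inl ⟨_, (.inl ⟨_, (.inl ⟨_, h, rfl⟩), rfl⟩), rfl⟩)
    · exact .inr ⟨h, b, rfl⟩
  | l4 _ ih =>
    rcases ih with h | ⟨h, b, rfl⟩
    · exact .inl (.inl ⟨_, (.inl ⟨_, (.inl ⟨_, (.inl ⟨_, h, rfl⟩), rfl⟩), rfl⟩), rfl⟩)
    · exact .inr ⟨h, b, rfl⟩
  | l5 _ ih =>
    rcases ih with h | ⟨h, b, rfl⟩
    · exact .inl (.inl ⟨_, (.inl ⟨_, (.inl ⟨_, (.inl ⟨_, (.inl ⟨_, h, rfl⟩), rfl⟩), rfl⟩), rfl⟩), rfl⟩)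
    · exact .inr ⟨h, b, rfl⟩
  | l6 _ ih =>
    rcases ih with h | ⟨h, b, rfl⟩
    · exact .inl (.inl ⟨_, (.inl ⟨_, (.inl ⟨_, (.inl ⟨_, (.inl ⟨_, (.inl ⟨_, h, rfl⟩), rfl⟩), rfl⟩), rfl⟩), rfl⟩), rfl⟩)
    · exact .inr ⟨h, b, rfl⟩
  | l7 _ ih =>
    rcases ih with h | ⟨h, b, rfl⟩
    · exact .inl (.inl ⟨_, (.inl ⟨_, (.inl ⟨_, (.inl ⟨_, (.inl ⟨_, (.inl ⟨_, (.inl ⟨_, h, rfl⟩), rfl⟩), rfl⟩), rfl⟩), rfl⟩), rfl⟩), rfl⟩)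
    · exact .inr ⟨h, b, rfl⟩

/-- A finite supply of constants from which a predicate can be expressed in every coding. -/
def Supplies (fo par : Bool) {Γ : Type u} (W : Vars M Γ) (D : Γ → Prop)
    (cs : (σ : Srt) → Set (M.Dom σ)) : Prop :=
  (∀ σ, (cs σ).Finite) ∧ (par = false → ∀ σ, cs σ = ∅) ∧
    ∀ K Cod, IsCoding W cs K Cod → ∃ φ : Fml L, (fo = true → φ.IsFirstOrder) ∧
      ∀ e g, Agree Cod e g → (M.Sat e φ ↔ D g)

theorem Tm.supplies {par : Bool} {Γ : Type u} {W : Vars M Γ} {σ : Srt} {x : Γ → M.Dom σ}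
    (h : Tm par W σ x) :
    ∃ cs : (σ : Srt) → Set (M.Dom σ), (∀ σ, (cs σ).Finite) ∧ (par = false → ∀ σ, cs σ = ∅) ∧
      ∀ K Cod, IsCoding W cs K Cod → ∃ i, Cod σ i x := by
  rcases h.exists_name with h | ⟨hp, b, rfl⟩
  · exact ⟨fun _ => ∅, by simp, by simp, fun K Cod hc => hc.var _ _ h⟩
  · refine ⟨fun τ => {c | ∃ hτ : σ = τ, c = hτ ▸ b}, ?_, fun h' => absurd (hp.symm.trans h') (by decide), fun K Cod hc =>
      hc.const _ _ ⟨rfl, rfl⟩⟩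
    intro τ
    by_cases hτ : σ = τ
    · subst hτ
      simp
    · simp [hτ]

theorem supplies_union {fo par : Bool} {Γ : Type u} {W : Vars M Γ} {D : Γ → Prop}
    {cs cs' : (σ : Srt) → Set (M.Dom σ)}
    (h : (∀ σ, (cs σ).Finite) ∧ (par = false → ∀ σ, cs σ = ∅))
    (h' : (∀ σ, (cs' σ).Finite) ∧ (par = false → ∀ σ, cs' σ = ∅))
    (H : ∀ K Cod, IsCoding W cs K Cod → IsCoding W cs' K Cod →
      ∃ φ : Fml L, (fo = true → φ.IsFirstOrder) ∧ ∀ e g, Agree Cod e g → (M.Sat e φ ↔ D g)) :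
    ∃ cs, Supplies fo par W D cs := by
  refine ⟨fun σ => cs σ ∪ cs' σ, fun σ => (h.1 σ).union (h'.1 σ), fun hp σ => ?_, ?_⟩
  · simp [h.2 hp, h'.2 hp]
  · intro K Cod hc
    exact H K Cod (hc.mono fun σ => Set.subset_union_left) (hc.mono fun σ => Set.subset_union_right)

/-- The claim is made for all codings at once, since callers prescribe the variable numbers and
since a quantifier extends the coding: its bound variable is named `K`, which exceeds every name in
use and so captures nothing. Constants become free variables that the coding must name; only
finitely many occur. -/
theorem Ex.supplies {fo par : Bool} {Γ : Type u} {W : Vars M Γ} {D : Γ → Prop}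
    (h : Ex fo par W D) : ∃ cs, Supplies fo par W D cs := by
  have bin : ∀ {Γ : Type u} {W : Vars M Γ} {D D' : Γ → Prop} (f : Fml L → Fml L → Fml L)
      (B : Prop → Prop → Prop),
      (∀ φ ψ, φ.IsFirstOrder → ψ.IsFirstOrder → (f φ ψ).IsFirstOrder) →
      (∀ e φ ψ, M.Sat e (f φ ψ) ↔ B (M.Sat e φ) (M.Sat e ψ)) →
      (∃ cs, Supplies fo par W D cs) → (∃ cs, Supplies fo par W D' cs) →
      ∃ cs, Supplies fo par W (fun g => B (D g) (D' g)) cs := by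
    rintro Γ W D D' f B hf hB ⟨cs, h1, h2, h3⟩ ⟨cs', h1', h2', h3'⟩
    refine supplies_union ⟨h1, h2⟩ ⟨h1', h2'⟩ fun K Cod hc hc' => ?_
    obtain ⟨φ, hφ, H⟩ := h3 K Cod hc
    obtain ⟨ψ, hψ, H'⟩ := h3' K Cod hc'
    exact ⟨f φ ψ, fun h => hf _ _ (hφ h) (hψ h), fun e g he => by rw [hB, H e g he, H' e g he]⟩
  have quant : ∀ {Γ : Type u} {W : Vars M Γ} (σ : Srt) {D : Γ → M.Dom σ → Prop}
      (f : ℕ → Fml L → Fml L) (B : (M.Dom σ → Prop) → Prop),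
      (fo = true → ∀ n φ, φ.IsFirstOrder → (f n φ).IsFirstOrder) →
      (∀ e n φ, M.Sat e (f n φ) ↔ B fun a => M.Sat (e.set σ n a) φ) →
      (∃ cs, Supplies fo par (W.ext σ) (fun p => D p.1 p.2) cs) →
      ∃ cs, Supplies fo par W (fun g => B (D g)) cs := by
    rintro Γ W σ D f B hf hB ⟨cs, h1, h2, h3⟩
    refine ⟨cs, h1, h2, fun K Cod hc => ?_⟩
    obtain ⟨φ, hφ, H⟩ := h3 _ _ (hc.ext σ)
    refine ⟨f K φ, fun h => hf h _ _ (hφ h), fun e g he => ?_⟩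
    rw [hB]
    exact iff_of_eq (congrArg B (funext fun a => propext (H _ _ (he.ext hc σ a))))
  induction h with
  | @rel Γ W r x y hx hy =>
    obtain ⟨cs, h1, h2, h3⟩ := hx.supplies
    obtain ⟨cs', h1', h2', h3'⟩ := hy.supplies
    refine supplies_union ⟨h1, h2⟩ ⟨h1', h2'⟩ fun K Cod hc hc' => ?_
    obtain ⟨i, hi⟩ := h3 K Cod hc
    obtain ⟨j, hj⟩ := h3' K Cod hc'
    exact ⟨.rel r i j, fun _ => trivial, fun e g he => by simp [Sat, he _ _ _ hi, he _ _ _ hj]⟩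
  | @eq Γ W x y hx hy =>
    obtain ⟨cs, h1, h2, h3⟩ := hx.supplies
    obtain ⟨cs', h1', h2', h3'⟩ := hy.supplies
    refine supplies_union ⟨h1, h2⟩ ⟨h1', h2'⟩ fun K Cod hc hc' => ?_
    obtain ⟨i, hi⟩ := h3 K Cod hc
    obtain ⟨j, hj⟩ := h3' K Cod hc'
    exact ⟨.eq i j, fun _ => trivial, fun e g he => by
      rw [Sat, he _ _ _ hi, he _ _ _ hj]; rfl⟩
  | @memC Γ W x y hx hy =>
    obtain ⟨cs, h1, h2, h3⟩ := hx.supplies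
    obtain ⟨cs', h1', h2', h3'⟩ := hy.supplies
    refine supplies_union ⟨h1, h2⟩ ⟨h1', h2'⟩ fun K Cod hc hc' => ?_
    obtain ⟨i, hi⟩ := h3 K Cod hc
    obtain ⟨j, hj⟩ := h3' K Cod hc'
    exact ⟨.mem i j, fun _ => trivial, fun e g he => by
      rw [Sat, he _ _ _ hi, he _ _ _ hj]; rfl⟩
  | @memS Γ W x X hX hx h =>
    obtain ⟨cs, h1, h2, h3⟩ := hx.supplies
    obtain ⟨cs', h1', h2', h3'⟩ := (Tm.const (W := W) (σ := .cls) (⟨X, hX⟩ : M.Cls) h).supplies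
    refine supplies_union ⟨h1, h2⟩ ⟨h1', h2'⟩ fun K Cod hc hc' => ?_
    obtain ⟨i, hi⟩ := h3 K Cod hc
    obtain ⟨j, hj⟩ := h3' K Cod hc'
    exact ⟨.mem i j, fun _ => trivial, fun e g he => by
      rw [Sat, he _ _ _ hi, he _ _ _ hj]; rfl⟩
  | false =>
    refine ⟨fun _ => ∅, by simp, by simp, fun K Cod _ =>
      ⟨.and (.eq 0 0) (.neg (.eq 0 0)), fun _ => ⟨trivial, trivial⟩, fun e g _ => by simp [Sat]⟩⟩
  | neg _ ih =>
    exact bin (fun φ _ => .neg φ) (fun p _ => ¬ p) (fun _ _ h _ => h) (fun _ _ _ => Iff.rfl) ih ih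
  | and _ _ ih ih' =>
    exact bin (fun φ ψ => .and φ ψ) And (fun _ _ h h' => ⟨h, h'⟩) (fun _ _ _ => Iff.rfl) ih ih'
  | or _ _ ih ih' =>
    exact bin (fun φ ψ => .neg (.and (.neg φ) (.neg ψ))) Or (fun _ _ h h' => ⟨h, h'⟩)
      (fun _ _ _ => by simp only [Sat]; tauto) ih ih'
  | imp _ _ ih ih' =>
    exact bin (fun φ ψ => .neg (.and φ (.neg ψ))) (fun p q => p → q) (fun _ _ h h' => ⟨h, h'⟩)
      (fun _ _ _ => by simp only [Sat]; tauto) ih ih'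
  | iff _ _ ih ih' =>
    exact bin (fun φ ψ => .and (.neg (.and φ (.neg ψ))) (.neg (.and ψ (.neg φ)))) Iff
      (fun _ _ h h' => ⟨⟨h, h'⟩, ⟨h', h⟩⟩) (fun _ _ _ => by simp only [Sat]; tauto) ih ih'
  | exO _ ih =>
    exact quant .obj (fun n φ => .neg (.all .obj n (.neg φ))) (fun P => ∃ a, P a)
      (fun _ _ _ h => ⟨rfl, h⟩) (fun _ _ _ => by simp only [Sat, not_forall, not_not]) ih
  | allO _ ih =>
    exact quant .obj (fun n φ => .all .obj n φ) (fun P => ∀ a, P a)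
      (fun _ _ _ h => ⟨rfl, h⟩) (fun _ _ _ => Iff.rfl) ih
  | exC hf _ ih =>
    exact quant .cls (fun n φ => .neg (.all .cls n (.neg φ))) (fun P => ∃ a, P a)
      (fun h => by simp [hf] at h) (fun _ _ _ => by simp only [Sat, not_forall, not_not]) ih
  | allC hf _ ih =>
    exact quant .cls (fun n φ => .all .cls n φ) (fun P => ∀ a, P a)
      (fun h => by simp [hf] at h) (fun _ _ _ => Iff.rfl) ih

/-- Replaces a predicate that does not have the shape of a formula by an equivalent one that has. -/
theorem Ex.congr {fo par : Bool} {Γ : Type u} {W : Vars M Γ} {D D' : Γ → Prop}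
    (h : Ex fo par W D) (H : ∀ g, D' g ↔ D g) : Ex fo par W D' := by
  rwa [show D' = D from funext fun g => propext (H g)]

/-- One object variable. -/
abbrev Vars.one (M : ClassModel.{u} L) : Vars M (PUnit.{u + 1} × M.Dom .obj) := (Vars.nil M).ext .obj

/-- Two object variables. -/
abbrev Vars.two (M : ClassModel.{u} L) : Vars M ((PUnit.{u + 1} × M.Dom .obj) × M.Dom .obj) :=
  (Vars.one M).ext .obj

/-- A predicate that is expressible without parameters is expressed by a formula in any given
variables. -/
theorem Ex.exists_formula_at {fo : Bool} {σ₁ σ₂ σ₃ σ₄ : Srt}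
    {D : M.Dom σ₁ → M.Dom σ₂ → M.Dom σ₃ → M.Dom σ₄ → Prop}
    (h : Ex fo Bool.false (((((Vars.nil M).ext σ₁).ext σ₂).ext σ₃).ext σ₄)
      fun p => D p.1.1.1.2 p.1.1.2 p.1.2 p.2) (i₁ i₂ i₃ i₄ : ℕ) :
    ∃ φ : Fml L, (fo = true → φ.IsFirstOrder) ∧ ∀ e : M.Val,
      (M.Sat e φ ↔ D (e σ₁ i₁) (e σ₂ i₂) (e σ₃ i₃) (e σ₄ i₄)) := by
  -- The prescribed names may coincide: a coding need not be injective, and the environment takes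
  -- its values from `e`. The bound only has to exceed all names, to keep bound variables fresh.
  have step : ∀ {Γ : Type u} {W : Vars M Γ} {K : ℕ}
      {Cod : (σ : Srt) → ℕ → (Γ → M.Dom σ) → Prop},
      IsCoding W (fun _ => ∅) K Cod → ∀ σ n,
        IsCoding (W.ext σ) (fun _ => ∅) (max K (n + 1)) (extCod n Cod σ) := by
    intro Γ W K Cod h σ n
    refine ⟨?_, by simp, ?_⟩
    · rintro τ y (⟨x, hx, rfl⟩ | ⟨rfl, rfl⟩)
      · obtain ⟨i, hi⟩ := h.var τ x hx
        exact ⟨i, .inl ⟨x, hi, rfl⟩⟩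
      · exact ⟨n, .inr ⟨rfl, rfl, rfl⟩⟩
    · rintro τ i y (⟨x, hx, rfl⟩ | ⟨rfl, -⟩)
      · exact lt_max_of_lt_left (h.lt _ _ _ hx)
      · exact lt_max_of_lt_right (Nat.lt_succ_self _)
  have agree : ∀ {Γ : Type u} {Cod : (σ : Srt) → ℕ → (Γ → M.Dom σ) → Prop} {e : M.Val} {g : Γ},
      Agree Cod e g → ∀ σ n, Agree (extCod n Cod σ) e (g, e σ n) := by
    rintro Γ Cod e g h σ n τ i y (⟨x, hx, rfl⟩ | ⟨rfl, rfl, rfl⟩)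
    · exact h _ _ _ hx
    · rfl
  obtain ⟨cs, -, hcs, H⟩ := h.supplies
  obtain rfl : cs = fun _ => ∅ := funext (hcs rfl)
  have h0 : IsCoding (Vars.nil M) (fun _ => ∅) 0 fun _ _ _ => False :=
    ⟨fun _ _ h => h.elim, by simp, fun _ _ _ h => h.elim⟩
  obtain ⟨φ, hφ, hS⟩ := H _ _ (step (step (step (step h0 σ₁ i₁) σ₂ i₂) σ₃ i₃) σ₄ i₄)
  exact ⟨φ, hφ, fun e => hS e ((((⟨⟩, _), _), _), _)
    (agree (agree (agree (agree (fun _ _ _ h => h.elim) σ₁ i₁) σ₂ i₂) σ₃ i₃) σ₄ i₄)⟩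

theorem exists_enumeration [Nonempty M.Obj] [Nonempty M.Cls] {cs : (σ : Srt) → Set (M.Dom σ)}
    (hfin : ∀ σ, (cs σ).Finite) :
    ∃ (n : Srt → ℕ) (e : M.Val), ∀ σ, ∀ b ∈ cs σ, ∃ i < n σ, e σ i = b := by
  have : ∀ σ, Nonempty (M.Dom σ) := fun σ => by cases σ <;> (unfold Dom; infer_instance)
  have hl : ∀ σ, ∃ (n : ℕ) (f : ℕ → M.Dom σ), ∀ b ∈ cs σ, ∃ i < n, f i = b := by
    intro σ
    obtain ⟨s, hs⟩ := (hfin σ).exists_finset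
    refine ⟨s.toList.length, fun i => s.toList.getD i (Classical.arbitrary _), fun b hb => ?_⟩
    obtain ⟨i, hi, rfl⟩ := List.mem_iff_getElem.1 (Finset.mem_toList.2 ((hs b).2 hb))
    exact ⟨i, hi, List.getD_eq_getElem _ _ hi⟩
  choose n f hf using hl
  exact ⟨n, f, hf⟩

/-- A predicate of two objects that is expressible with parameters is expressed by a formula in the
variables `0` and `1`, under an assignment of parameters to the other variables. -/
theorem Ex.exists_formula₂ [Nonempty M.Obj] [Nonempty M.Cls] {D : M.Obj → M.Obj → Prop}
    (h : Ex true true (Vars.two M) fun p => D p.1.2 p.2) :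
    ∃ φ : Fml L, φ.IsFirstOrder ∧ ∃ e : M.Val, ∀ a b : M.Obj,
      (M.Sat ((e.set .obj 0 a).set .obj 1 b) φ ↔ D a b) := by
  obtain ⟨cs, hfin, -, H⟩ := h.supplies
  obtain ⟨n, f, hf⟩ := exists_enumeration hfin
  -- Constants are shifted by two, which leaves the object variables `0` and `1` to the arguments;
  -- the truncated values at `0` and `1` are irrelevant.
  let e : M.Val := fun σ i => f σ (i - 2)
  let Cod : (σ : Srt) → ℕ → ((PUnit.{u + 1} × M.Dom .obj) × M.Dom .obj → M.Dom σ) → Prop :=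
    fun σ i x => (2 ≤ i ∧ i < n σ + 2 ∧ x = fun _ => e σ i) ∨
      (i = 0 ∧ ∃ h : Srt.obj = σ, x = fun p => h ▸ p.1.2) ∨
      (i = 1 ∧ ∃ h : Srt.obj = σ, x = fun p => h ▸ p.2)
  obtain ⟨φ, hφ, hS⟩ := H (n .obj + n .cls + 2) Cod
    { var := by
        rintro σ x (⟨y, (⟨z, hz, -⟩ | ⟨rfl, rfl⟩), rfl⟩ | ⟨rfl, rfl⟩)
        · exact hz.elim
        · exact ⟨0, .inr (.inl ⟨rfl, rfl, rfl⟩)⟩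
        · exact ⟨1, .inr (.inr ⟨rfl, rfl, rfl⟩)⟩
      const := by
        intro σ b hb
        obtain ⟨i, hi, rfl⟩ := hf σ b hb
        exact ⟨i + 2, .inl ⟨by omega, by omega, by simp [e]⟩⟩
      lt := by
        rintro σ i x (⟨-, h, -⟩ | ⟨rfl, -⟩ | ⟨rfl, -⟩)
        · cases σ <;> omega
        · omega
        · omega }
  refine ⟨φ, hφ rfl, e, fun a b => hS _ ((⟨⟩, a), b) ?_⟩
  rintro σ i x (⟨h2, h, rfl⟩ | ⟨rfl, rfl, rfl⟩ | ⟨rfl, rfl, rfl⟩)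
  · exact (Val.set_of_ne_index _ _ _ _ (by omega)).trans
      (Val.set_of_ne_index _ _ _ _ (by omega))
  · exact (Val.set_of_ne_index _ _ _ _ (by omega)).trans (Val.set_same _ _ _ _)
  · exact Val.set_same _ _ _ _

theorem Ex.exists_formula₁ [Nonempty M.Obj] [Nonempty M.Cls] {D : M.Obj → Prop}
    (h : Ex true true (Vars.one M) fun p => D p.2) :
    ∃ φ : Fml L, φ.IsFirstOrder ∧ ∃ e : M.Val, ∀ a : M.Obj, (M.Sat (e.set .obj 0 a) φ ↔ D a) := by
  obtain ⟨cs, hfin, -, H⟩ := h.supplies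
  obtain ⟨n, f, hf⟩ := exists_enumeration hfin
  let e : M.Val := fun σ i => f σ (i - 1)
  let Cod : (σ : Srt) → ℕ → (PUnit.{u + 1} × M.Dom .obj → M.Dom σ) → Prop :=
    fun σ i x => (1 ≤ i ∧ i < n σ + 1 ∧ x = fun _ => e σ i) ∨
      (i = 0 ∧ ∃ h : Srt.obj = σ, x = fun p => h ▸ p.2)
  obtain ⟨φ, hφ, hS⟩ := H (n .obj + n .cls + 1) Cod
    { var := by
        rintro σ x (⟨z, hz, -⟩ | ⟨rfl, rfl⟩)
        · exact hz.elim
        · exact ⟨0, .inr ⟨rfl, rfl, rfl⟩⟩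
      const := by
        intro σ b hb
        obtain ⟨i, hi, rfl⟩ := hf σ b hb
        exact ⟨i + 1, .inl ⟨by omega, by omega, by simp [e]⟩⟩
      lt := by
        rintro σ i x (⟨-, h, -⟩ | ⟨rfl, -⟩)
        · cases σ <;> omega
        · omega }
  refine ⟨φ, hφ rfl, e, fun a => hS _ (⟨⟩, a) ?_⟩
  rintro σ i x (⟨h2, h, rfl⟩ | ⟨rfl, rfl, rfl⟩)
  · exact Val.set_of_ne_index _ _ _ _ (by omega)
  · exact Val.set_same _ _ _ _

/-- Predicates expressible without class quantifiers, with parameters. -/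
def Ex₁ (D : M.Obj → Prop) : Prop :=
  ∀ ⦃Γ : Type u⦄ ⦃W : Vars M Γ⦄ ⦃x : Γ → M.Obj⦄, Tm true W .obj x →
    Ex true true W fun g => D (x g)

/-- Binary relations expressible without class quantifiers, with parameters. -/
def Ex₂ (D : M.Obj → M.Obj → Prop) : Prop :=
  ∀ ⦃Γ : Type u⦄ ⦃W : Vars M Γ⦄ ⦃x y : Γ → M.Obj⦄, Tm true W .obj x → Tm true W .obj y →
    Ex true true W fun g => D (x g) (y g)

/-- The separation scheme, for expressible predicates. -/
theorem Separation.exists_sep [Nonempty M.Obj] [Nonempty M.Cls] {E : M.Obj → M.Obj → Prop}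
    {At : M.Obj → Prop} (hS : M.Separation E At) {D : M.Obj → Prop} (h : Ex₁ D) (x : M.Obj) :
    ∃ y, ¬ At y ∧ ∀ z, E z y ↔ E z x ∧ D z := by
  obtain ⟨φ, hφ, e, H⟩ := Ex.exists_formula₁ (h .v0)
  obtain ⟨y, hy, hz⟩ := hS φ hφ e x
  exact ⟨y, hy, fun z => (hz z).trans (and_congr_right' (H z))⟩

/-- The comprehension scheme, for expressible predicates. -/
theorem FirstOrderComprehension.mem_cls [Nonempty M.Obj] [Nonempty M.Cls]
    (hC : M.FirstOrderComprehension) {D : M.Obj → Prop} (h : Ex₁ D) : {x | D x} ∈ M.Cls := by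
  obtain ⟨φ, hφ, e, H⟩ := Ex.exists_formula₁ (h .v0)
  simpa only [H] using hC φ hφ e

/-- The collection scheme, for expressible predicates. -/
theorem Collection.exists_bound [Nonempty M.Obj] [Nonempty M.Cls] {E : M.Obj → M.Obj → Prop}
    {At : M.Obj → Prop} (hC : M.Collection E At) {D : M.Obj → M.Obj → Prop} (h : Ex₂ D)
    (x : M.Obj) (hx : ∀ a, E a x → ∃ b, D a b) : ∃ y, ∀ a, E a x → ∃ b, E b y ∧ D a b := by
  obtain ⟨φ, hφ, e, H⟩ := Ex.exists_formula₂ (h .v1 .v0)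
  simp only [← H] at hx ⊢
  obtain ⟨y, -, hy⟩ := hC φ hφ e x hx
  exact ⟨y, hy⟩

end Expressibility

end ClassModel

open ClassModel

/-! ## Definability of the vocabulary -/

section Vocabulary

variable {L : Type} {M : ClassModel.{u} L} {r : L} {At : M.Obj → Prop} {fo par : Bool}
  {Γ : Type u} {W : Vars M Γ}

/-- A predicate of objects expressible without parameters. -/
def ClassModel.ExAt (fo par : Bool) (At : M.Obj → Prop) : Prop :=
  ∀ ⦃Γ : Type u⦄ ⦃W : Vars M Γ⦄ ⦃x : Γ → M.Obj⦄, Tm par W .obj x → Ex fo par W fun g => At (x g)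

theorem ClassModel.Ex.isUPair (hAt : ExAt fo par At) {a b c : Γ → M.Obj} (ha : Tm par W .obj a)
    (hb : Tm par W .obj b) (hc : Tm par W .obj c) :
    Ex fo par W fun g => IsUPair (M.rel r) At (a g) (b g) (c g) :=
  .and (.neg (hAt hc)) (.allO (.iff (.rel .v0 (.l1 hc))
    (.or (.eq .v0 (.l1 ha)) (.eq .v0 (.l1 hb)))))

theorem ClassModel.Ex.isOPair (hAt : ExAt fo par At) {a b c : Γ → M.Obj} (ha : Tm par W .obj a)
    (hb : Tm par W .obj b) (hc : Tm par W .obj c) :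
    Ex fo par W fun g => IsOPair (M.rel r) At (a g) (b g) (c g) :=
  .and (.neg (hAt hc)) (.allO (.iff (.rel .v0 (.l1 hc))
    (.or (.isUPair hAt (.l1 ha) (.l1 ha) .v0) (.isUPair hAt (.l1 ha) (.l1 hb) .v0))))

theorem ClassModel.Ex.isEmptySet (hAt : ExAt fo par At) {a : Γ → M.Obj} (ha : Tm par W .obj a) :
    Ex fo par W fun g => IsEmptySet (M.rel r) At (a g) :=
  .and (.neg (hAt ha)) (.allO (.neg (.rel .v0 (.l1 ha))))

theorem ClassModel.Ex.isPure (hAt : ExAt fo par At) {a : Γ → M.Obj} (ha : Tm par W .obj a) :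
    Ex fo par W fun g => IsPure (M.rel r) At (a g) :=
  .exO (.and (.neg (hAt .v0)) (.and (.rel (.l1 ha) .v0) (.and
    (.allO (.imp (.rel .v0 .v1) (.allO (.imp (.rel .v0 .v1) (.rel .v0 .v2)))))
    (.allO (.imp (.rel .v0 .v1) (.neg (hAt .v0)))))))

end Vocabulary

namespace SetModel

variable {M : SetModel.{u}} {fo par : Bool} {Γ : Type u} {W : Vars M Γ}

theorem exAt_noAtom : ExAt fo par (NoAtom M) := fun _ _ _ _ => .false

theorem ex_isOPair {a b c : Γ → M.Obj} (ha : Tm par W .obj a)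
    (hb : Tm par W .obj b) (hc : Tm par W .obj c) :
    Ex fo par W fun g => IsOPair (E M) (NoAtom M) (a g) (b g) (c g) :=
  .isOPair exAt_noAtom ha hb hc

theorem ex_isUPair {a b c : Γ → M.Obj} (ha : Tm par W .obj a)
    (hb : Tm par W .obj b) (hc : Tm par W .obj c) :
    Ex fo par W fun g => IsUPair (E M) (NoAtom M) (a g) (b g) (c g) :=
  .isUPair exAt_noAtom ha hb hc

theorem ex_isTagZero {a x : Γ → M.Obj} (ha : Tm par W .obj a) (hx : Tm par W .obj x) :
    Ex fo par W fun g => IsTagZero M (a g) (x g) :=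
  .exO (.and (.isEmptySet exAt_noAtom .v0) (ex_isOPair .v0 (.l1 ha) (.l1 hx)))

theorem ex_isTagOne {a x : Γ → M.Obj} (ha : Tm par W .obj a) (hx : Tm par W .obj x) :
    Ex fo par W fun g => IsTagOne M (a g) (x g) :=
  .exO (.exO (.and (.isEmptySet exAt_noAtom .v1)
    (.and (ex_isUPair .v1 .v1 .v0) (ex_isOPair .v0 (.l2 ha) (.l2 hx)))))

/-! ## Elementary set theory -/

namespace GBC

theorem nonempty_obj (hM : GBC M) : Nonempty M.Obj :=
  let ⟨x, _⟩ := hM.zfcu.infinity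
  ⟨x⟩

theorem nonempty_cls (hM : GBC M) : Nonempty M.Cls :=
  let ⟨R, hR, _⟩ := hM.globalWellOrder
  ⟨⟨R, hR⟩⟩

theorem comp (hM : GBC M) {D : M.Obj → Prop} (h : Ex₁ D) : {x | D x} ∈ M.Cls :=
  have := hM.nonempty_obj
  have := hM.nonempty_cls
  hM.comprehension.mem_cls h

theorem sep (hM : GBC M) {D : M.Obj → Prop} (h : Ex₁ D) (x : M.Obj) :
    ∃ y, ∀ z, E M z y ↔ E M z x ∧ D z :=
  have := hM.nonempty_obj
  have := hM.nonempty_cls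
  let ⟨y, _, hy⟩ := hM.separation.exists_sep h x
  ⟨y, hy⟩

theorem coll (hM : GBC M) {D : M.Obj → M.Obj → Prop} (h : Ex₂ D) (x : M.Obj)
    (hx : ∀ a, E M a x → ∃ b, D a b) : ∃ y, ∀ a, E M a x → ∃ b, E M b y ∧ D a b :=
  have := hM.nonempty_obj
  have := hM.nonempty_cls
  hM.collection.exists_bound h x hx

/-- Replacement for partial functions. -/
theorem repl (hM : GBC M) {D : M.Obj → M.Obj → Prop} (h : Ex₂ D) (x : M.Obj)
    (hx : ∀ a, E M a x → ∀ b b', D a b → D a b' → b = b') :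
    ∃ y, ∀ b, E M b y ↔ ∃ a, E M a x ∧ D a b := by
  obtain ⟨x', hx'⟩ := hM.sep (D := fun a => ∃ b, D a b)
    (fun Γ W x hx => .exO (h (.l1 hx) .v0)) x
  obtain ⟨y, hy⟩ := hM.coll h x' fun a ha => ((hx' a).1 ha).2
  obtain ⟨z, hz⟩ := hM.sep (D := fun b => ∃ a, E M a x ∧ D a b)
    (fun Γ W x hx => .exO (.and (.rel .v0 (.const _ rfl)) (h .v0 (.l1 hx)))) y
  refine ⟨z, fun b => (hz b).trans (and_iff_right_of_imp ?_)⟩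
  rintro ⟨a, ha, hb⟩
  obtain ⟨b', hb', hD⟩ := hy a ((hx' a).2 ⟨ha, b, hb⟩)
  rwa [hx a ha b b' hb hD]

theorem ext (hM : GBC M) {x y : M.Obj} (h : ∀ z, E M z x ↔ E M z y) : x = y :=
  hM.zfcu.extensionality x y id id h

theorem exists_emp (hM : GBC M) : ∃ z, ∀ w, ¬ E M w z :=
  let ⟨_, _, ⟨z, _, hz⟩, _⟩ := hM.zfcu.infinity
  ⟨z, hz.2⟩

/-- the empty set -/
noncomputable def emp (hM : GBC M) : M.Obj := hM.exists_emp.choose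

theorem not_mem_emp (hM : GBC M) (w : M.Obj) : ¬ E M w hM.emp := hM.exists_emp.choose_spec w

theorem isEmptySet_iff (hM : GBC M) {z : M.Obj} :
    IsEmptySet (E M) (NoAtom M) z ↔ z = hM.emp := by
  refine ⟨fun h => hM.ext fun w => ?_, ?_⟩
  · simp [h.2 w, hM.not_mem_emp w]
  · rintro rfl
    exact ⟨id, hM.not_mem_emp⟩

/-- the unordered pair -/
noncomputable def pair (hM : GBC M) (a b : M.Obj) : M.Obj := (hM.zfcu.pairing a b).choose

theorem mem_pair (hM : GBC M) {a b z : M.Obj} : E M z (hM.pair a b) ↔ z = a ∨ z = b :=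
  (hM.zfcu.pairing a b).choose_spec.2 z

theorem isUPair_iff (hM : GBC M) {a b c : M.Obj} :
    IsUPair (E M) (NoAtom M) a b c ↔ c = hM.pair a b := by
  refine ⟨fun h => hM.ext fun w => (h.2 w).trans hM.mem_pair.symm, ?_⟩
  rintro rfl
  exact ⟨id, fun z => hM.mem_pair⟩

theorem pair_eq_pair (hM : GBC M) {a b c d : M.Obj} (h : hM.pair a b = hM.pair c d) :
    a = c ∧ b = d ∨ a = d ∧ b = c := by
  have h1 : ∀ z, z = a ∨ z = b ↔ z = c ∨ z = d := fun z => by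
    rw [← hM.mem_pair, ← hM.mem_pair, h]
  have ha := (h1 a).1 (.inl rfl)
  have hb := (h1 b).1 (.inr rfl)
  have hc := (h1 c).2 (.inl rfl)
  have hd := (h1 d).2 (.inr rfl)
  grind

/-- the Kuratowski pair -/
noncomputable def op (hM : GBC M) (a b : M.Obj) : M.Obj := hM.pair (hM.pair a a) (hM.pair a b)

theorem isOPair_iff (hM : GBC M) {a b p : M.Obj} :
    IsOPair (E M) (NoAtom M) a b p ↔ p = hM.op a b := by
  unfold IsOPair
  simp only [hM.isUPair_iff]
  exact hM.isUPair_iff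

theorem op_inj (hM : GBC M) {a b c d : M.Obj} : hM.op a b = hM.op c d ↔ a = c ∧ b = d := by
  refine ⟨fun h => ?_, fun ⟨h, h'⟩ => by rw [h, h']⟩
  rcases hM.pair_eq_pair h with ⟨h1, h2⟩ | ⟨h1, h2⟩
  · have := hM.pair_eq_pair h1
    have := hM.pair_eq_pair h2
    grind
  · have := hM.pair_eq_pair h1
    have := hM.pair_eq_pair h2
    grind

/-- the pair `⟨0, a⟩` -/
noncomputable def tag0 (hM : GBC M) (a : M.Obj) : M.Obj := hM.op hM.emp a

/-- the pair `⟨1, a⟩` -/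
noncomputable def tag1 (hM : GBC M) (a : M.Obj) : M.Obj := hM.op (hM.pair hM.emp hM.emp) a

theorem isTagZero_iff (hM : GBC M) {a x : M.Obj} : IsTagZero M a x ↔ x = hM.tag0 a := by
  simp [IsTagZero, hM.isEmptySet_iff, hM.isOPair_iff, tag0]

theorem isTagOne_iff (hM : GBC M) {a x : M.Obj} : IsTagOne M a x ↔ x = hM.tag1 a := by
  simp [IsTagOne, hM.isEmptySet_iff, hM.isOPair_iff, hM.isUPair_iff, tag1]

theorem tag0_inj (hM : GBC M) {a b : M.Obj} : hM.tag0 a = hM.tag0 b ↔ a = b := by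
  simp [tag0, hM.op_inj]

theorem tag1_inj (hM : GBC M) {a b : M.Obj} : hM.tag1 a = hM.tag1 b ↔ a = b := by
  simp [tag1, hM.op_inj]

theorem tag0_ne_tag1 (hM : GBC M) {a b : M.Obj} : hM.tag0 a ≠ hM.tag1 b := by
  intro h
  have h1 := (hM.op_inj.1 h).1
  exact hM.not_mem_emp hM.emp (by rw [h1]; exact hM.mem_pair.2 (.inl (by rw [← h1])))

/-- the union of a set -/
noncomputable def sUnion (hM : GBC M) (x : M.Obj) : M.Obj := (hM.zfcu.union x).choose

theorem mem_sUnion (hM : GBC M) {x z : M.Obj} :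
    E M z (hM.sUnion x) ↔ ∃ w, E M w x ∧ E M z w :=
  (hM.zfcu.union x).choose_spec.2 z

/-- the set `x ∪ {a}` -/
noncomputable def insert (hM : GBC M) (a x : M.Obj) : M.Obj :=
  hM.sUnion (hM.pair x (hM.pair a a))

theorem mem_insert (hM : GBC M) {a x z : M.Obj} :
    E M z (hM.insert a x) ↔ E M z x ∨ z = a := by
  simp only [insert, hM.mem_sUnion, hM.mem_pair]
  constructor
  · rintro ⟨w, rfl | rfl, h⟩
    · exact .inl h
    · exact .inr (by simpa [hM.mem_pair] using h)
  · rintro (h | rfl)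
    · exact ⟨x, .inl rfl, h⟩
    · exact ⟨_, .inr rfl, hM.mem_pair.2 (.inl rfl)⟩

/-- Foundation for classes restricted to a set -/
theorem exists_minimal (hM : GBC M) {X : Set M.Obj} (hX : X ∈ M.Cls) {t x : M.Obj}
    (hx : E M x t) (hxX : x ∈ X) :
    ∃ y, E M y t ∧ y ∈ X ∧ ∀ z, E M z y → E M z t → z ∉ X := by
  obtain ⟨s, hs⟩ := hM.sep (D := fun a => a ∈ X) (fun Γ W x hx => .memS hX hx rfl) t
  obtain ⟨y, hy, hmin⟩ := hM.zfcu.foundation s ⟨x, (hs x).2 ⟨hx, hxX⟩⟩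
  exact ⟨y, ((hs y).1 hy).1, ((hs y).1 hy).2, fun z hz hzt hzX => hmin z ((hs z).2 ⟨hzt, hzX⟩) hz⟩

end GBC

end SetModel

namespace SetModel

variable {M : SetModel.{u}}

/-! ## Recursion along the membership relation -/

/-- The set `g` of pairs `⟨u, w⟩` is a partial solution, on a subset of `T`, of the recursion
`f(u) = H({f(v) | v ∈ u})`. -/
def IsAttempt (T : Set M.Obj) (H : M.Obj → M.Obj → Prop) (g : M.Obj) : Prop :=
  ∀ p, E M p g → ∃ u w y, u ∈ T ∧ IsOPair (E M) (NoAtom M) u w p ∧ H y w ∧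
    (∀ v, E M v u → ∃ w', E M w' y ∧ ∃ q, E M q g ∧ IsOPair (E M) (NoAtom M) v w' q) ∧
    ∀ w', E M w' y → ∃ v, E M v u ∧ ∃ q, E M q g ∧ IsOPair (E M) (NoAtom M) v w' q

/-- The pair `⟨u, w⟩` belongs to some partial solution. -/
def RecRel (T : Set M.Obj) (H : M.Obj → M.Obj → Prop) (u w : M.Obj) : Prop :=
  ∃ g, IsAttempt T H g ∧ ∃ p, E M p g ∧ IsOPair (E M) (NoAtom M) u w p

theorem ex_isAttempt {T : Set M.Obj} (hT : T ∈ M.Cls) {H : M.Obj → M.Obj → Prop} (hH : Ex₂ H) :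
    Ex₁ (IsAttempt T H) := by
  intro Γ W x hx
  unfold IsAttempt
  -- Proofs of expressibility follow the syntax: `constructor` finds the clause of `Ex` or `Tm` by
  -- unification, and the listed lemmas handle the defined notions.
  repeat' first | assumption | apply ex_isOPair | apply hH | constructor

theorem ex_recRel {T : Set M.Obj} (hT : T ∈ M.Cls) {H : M.Obj → M.Obj → Prop} (hH : Ex₂ H) :
    Ex₂ (RecRel T H) := by
  intro Γ W x y hx hy
  unfold RecRel
  repeat' first | assumption | apply ex_isOPair | apply ex_isAttempt hT hH | constructor

namespace GBC

/-- Attempts in terms of pairs. -/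
theorem isAttempt_iff (hM : GBC M) {T : Set M.Obj} {H : M.Obj → M.Obj → Prop} {g : M.Obj} :
    IsAttempt T H g ↔ ∀ p, E M p g → ∃ u w y, u ∈ T ∧ p = hM.op u w ∧ H y w ∧
      (∀ v, E M v u → ∃ w', E M w' y ∧ E M (hM.op v w') g) ∧
      ∀ w', E M w' y → ∃ v, E M v u ∧ E M (hM.op v w') g := by
  simp only [IsAttempt, hM.isOPair_iff, exists_eq_right]

theorem recRel_iff (hM : GBC M) {T : Set M.Obj} {H : M.Obj → M.Obj → Prop} {u w : M.Obj} :
    RecRel T H u w ↔ ∃ g, IsAttempt T H g ∧ E M (hM.op u w) g := by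
  simp only [RecRel, hM.isOPair_iff, exists_eq_right]

theorem exists_step_of_recRel (hM : GBC M) {T : Set M.Obj} {H : M.Obj → M.Obj → Prop} {u w : M.Obj}
    (h : RecRel T H u w) : u ∈ T ∧ ∃ y, H y w ∧
      (∀ v, E M v u → ∃ w', E M w' y ∧ RecRel T H v w') ∧
      ∀ w', E M w' y → ∃ v, E M v u ∧ RecRel T H v w' := by
  obtain ⟨g, hg, hp⟩ := hM.recRel_iff.1 h
  obtain ⟨u', w', y, hu, hp', hy, h1, h2⟩ := hM.isAttempt_iff.1 hg _ hp
  obtain ⟨rfl, rfl⟩ := hM.op_inj.1 hp'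
  refine ⟨hu, y, hy, fun v hv => ?_, fun w' hw => ?_⟩
  · obtain ⟨w', hw', hq⟩ := h1 v hv
    exact ⟨w', hw', hM.recRel_iff.2 ⟨g, hg, hq⟩⟩
  · obtain ⟨v, hv, hq⟩ := h2 w' hw
    exact ⟨v, hv, hM.recRel_iff.2 ⟨g, hg, hq⟩⟩

/-- Recursion along membership on a class that satisfies induction. -/
theorem exists_rec (hM : GBC M) {T : Set M.Obj} (hT : T ∈ M.Cls)
    (htr : ∀ u ∈ T, ∀ v, E M v u → v ∈ T)
    (hind : ∀ X ∈ M.Cls, (∀ u ∈ T, (∀ v, E M v u → v ∈ X) → u ∈ X) → T ⊆ X)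
    {H : M.Obj → M.Obj → Prop} (hH : Ex₂ H) (htot : ∀ y, ∃ w, H y w)
    (hfun : ∀ y w w', H y w → H y w' → w = w') :
    ∃ f : M.Obj → M.Obj, {p | ∃ u ∈ T, p = hM.op u (f u)} ∈ M.Cls ∧
      ∀ u ∈ T, ∃ y, (∀ w, E M w y ↔ ∃ v, E M v u ∧ w = f v) ∧ H y (f u) := by
  have hR := ex_recRel hT hH
  have huniq : ∀ u ∈ T, ∀ w w', RecRel T H u w → RecRel T H u w' → w = w' := by
    refine fun u hu => hind {u | ∀ w w', RecRel T H u w → RecRel T H u w' → w = w'}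
      (hM.comp ?_) ?_ hu
    · intro Γ W x hx
      repeat' first | assumption | apply hR | constructor
    · intro u hu ih w w' hw hw'
      obtain ⟨-, y, hy, h1, h2⟩ := hM.exists_step_of_recRel hw
      obtain ⟨-, y', hy', h1', h2'⟩ := hM.exists_step_of_recRel hw'
      -- By the inductive hypothesis the elements of `u` have unique values, and `y` and `y'` both
      -- consist of these.
      have : y = y' := by
        refine hM.ext fun z => ⟨fun hz => ?_, fun hz => ?_⟩
        · obtain ⟨v, hv, hvz⟩ := h2 z hz
          obtain ⟨z', hz', hvz'⟩ := h1' v hv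
          rwa [ih v hv z z' hvz hvz']
        · obtain ⟨v, hv, hvz⟩ := h2' z hz
          obtain ⟨z', hz', hvz'⟩ := h1 v hv
          rwa [ih v hv z z' hvz hvz']
      exact hfun y w w' hy (this ▸ hy')
  have hex : ∀ u ∈ T, ∃ w, RecRel T H u w := by
    refine fun u hu => hind {u | ∃ w, RecRel T H u w} (hM.comp ?_) ?_ hu
    · intro Γ W x hx
      repeat' first | assumption | apply hR | constructor
    · intro u hu ih
      have hA := ex_isAttempt hT hH
      -- Collection bounds attempts that have a value at each `v` in `u`; separation then removes
      -- the non-attempts. Attempts need not be single-valued, so their union `G` is trivially an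
      -- attempt; single-valuedness is left to `huniq`.
      obtain ⟨b, hb⟩ := hM.coll (D := fun v g => IsAttempt T H g ∧
          ∃ w, ∃ p, E M p g ∧ IsOPair (E M) (NoAtom M) v w p) (by
        intro Γ W x y hx hy
        repeat' first | assumption | apply hA | apply ex_isOPair | constructor) u (by
        intro v hv
        obtain ⟨w, g, hg, hp⟩ := ih v hv
        exact ⟨g, hg, w, hp⟩)
      simp only [hM.isOPair_iff, exists_eq_right] at hb
      obtain ⟨b', hb'⟩ := hM.sep hA b
      set G := hM.sUnion b' with hG
      have hGA : IsAttempt T H G := by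
        rw [hM.isAttempt_iff]
        intro p hp
        obtain ⟨g, hg, hpg⟩ := hM.mem_sUnion.1 hp
        have sub : ∀ q, E M q g → E M q G := fun q hq => hM.mem_sUnion.2 ⟨g, hg, hq⟩
        obtain ⟨u, w, y, hu, hp, hy, h1, h2⟩ := hM.isAttempt_iff.1 ((hb' g).1 hg).2 p hpg
        refine ⟨u, w, y, hu, hp, hy, fun v hv => ?_, fun w' hw => ?_⟩
        · obtain ⟨w', hw', hq⟩ := h1 v hv
          exact ⟨w', hw', sub _ hq⟩
        · obtain ⟨v, hv, hq⟩ := h2 w' hw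
          exact ⟨v, hv, sub _ hq⟩
      obtain ⟨y, hy⟩ := hM.repl (D := fun v w => ∃ p, E M p G ∧ IsOPair (E M) (NoAtom M) v w p) (by
        intro Γ W x y hx hy
        repeat' first | assumption | apply ex_isOPair | constructor) u (by
        intro v hv w w' hw hw'
        exact huniq v (htr u hu v hv) w w' ⟨G, hGA, hw⟩ ⟨G, hGA, hw'⟩)
      simp only [hM.isOPair_iff, exists_eq_right] at hy
      obtain ⟨w, hw⟩ := htot y
      -- `y` is the image of `u` under `G` and `w` its value under `H`, so `G` can be prolonged by
      -- ⟨u, w⟩.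
      refine ⟨w, hM.recRel_iff.2 ⟨hM.insert (hM.op u w) G, ?_, hM.mem_insert.2 (.inr rfl)⟩⟩
      have sub : ∀ q, E M q G → E M q (hM.insert (hM.op u w) G) :=
        fun q hq => hM.mem_insert.2 (.inl hq)
      rw [hM.isAttempt_iff]
      intro p hp
      rcases hM.mem_insert.1 hp with hp | rfl
      · obtain ⟨u, w, y, hu, hp, hy, h1, h2⟩ := hM.isAttempt_iff.1 hGA p hp
        refine ⟨u, w, y, hu, hp, hy, fun v hv => ?_, fun w' hw => ?_⟩
        · obtain ⟨w', hw', hq⟩ := h1 v hv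
          exact ⟨w', hw', sub _ hq⟩
        · obtain ⟨v, hv, hq⟩ := h2 w' hw
          exact ⟨v, hv, sub _ hq⟩
      · refine ⟨u, w, y, hu, rfl, hw, fun v hv => ?_, fun w' hw => ?_⟩
        · obtain ⟨g, hg, hgA, w', hp⟩ := hb v hv
          have hq := hM.mem_sUnion.2 ⟨g, (hb' g).2 ⟨hg, hgA⟩, hp⟩
          exact ⟨w', (hy w').2 ⟨v, hv, hq⟩, sub _ hq⟩
        · obtain ⟨v, hv, hq⟩ := (hy w').1 hw
          exact ⟨v, hv, sub _ hq⟩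
  choose! f hf using hex
  refine ⟨f, ?_, fun u hu => ?_⟩
  · have : {p | ∃ u ∈ T, p = hM.op u (f u)} =
        {p | ∃ u w, u ∈ T ∧ IsOPair (E M) (NoAtom M) u w p ∧ RecRel T H u w} := by
      ext p
      simp only [hM.isOPair_iff, Set.mem_ofPred_eq]
      constructor
      · rintro ⟨u, hu, rfl⟩
        exact ⟨u, f u, hu, rfl, hf u hu⟩
      · rintro ⟨u, w, hu, rfl, hw⟩
        exact ⟨u, hu, by rw [huniq u hu _ _ hw (hf u hu)]⟩
    rw [this]
    refine hM.comp ?_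
    intro Γ W x hx
    repeat' first | assumption | apply hR | apply ex_isOPair | constructor
  · obtain ⟨-, y, hy, h1, h2⟩ := hM.exists_step_of_recRel (hf u hu)
    refine ⟨y, fun w => ⟨fun hw => ?_, ?_⟩, hy⟩
    · obtain ⟨v, hv, hvw⟩ := h2 w hw
      exact ⟨v, hv, huniq v (htr u hu v hv) _ _ hvw (hf v (htr u hu v hv))⟩
    · rintro ⟨v, hv, rfl⟩
      obtain ⟨w', hw', hvw⟩ := h1 v hv
      rwa [huniq v (htr u hu v hv) _ _ (hf v (htr u hu v hv)) hvw]

/-! ## Transitive sets and induction for classes -/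

/-- There is a nonempty transitive set closed under successors. -/
theorem exists_omega (hM : GBC M) : ∃ W, (∃ n, E M n W) ∧
    (∀ n, E M n W → ∀ m, E M m n → E M m W) ∧ ∀ n, E M n W → E M (hM.insert n n) W := by
  obtain ⟨x, -, ⟨z, hz, hz0⟩, hs⟩ := hM.zfcu.infinity
  obtain rfl := hM.isEmptySet_iff.1 hz0
  have hs' : ∀ y, E M y x → E M (hM.insert y y) x := by
    intro y hy
    obtain ⟨s, hs, -, h⟩ := hs y hy
    rwa [hM.ext fun z => hM.mem_insert.trans (h z).symm]
  -- `W` is the least inductive set, cut out of `x` as the intersection of all inductive sets.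
  obtain ⟨W, hW⟩ := hM.sep (D := fun n => ∀ s, (∀ z, (∀ w, ¬ E M w z) → E M z s) →
      (∀ y, E M y s → ∀ y', (∀ z, E M z y' ↔ E M z y ∨ z = y) → E M y' s) → E M n s) (by
    intro Γ W x hx
    repeat' first | assumption | constructor) x
  have succ : ∀ {s y y'}, (∀ z, E M z y' ↔ E M z y ∨ z = y) → E M (hM.insert y y) s →
      E M y' s := by
    intro s y y' h h'
    rwa [hM.ext fun z => (h z).trans hM.mem_insert.symm]
  have hW0 : E M hM.emp W :=
    (hW _).2 ⟨hz, fun s hs _ => hs _ hM.not_mem_emp⟩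
  have hWs : ∀ n, E M n W → E M (hM.insert n n) W := fun n hn =>
    (hW _).2 ⟨hs' n ((hW n).1 hn).1, fun s h0 h1 =>
      h1 n (((hW n).1 hn).2 s h0 h1) _ fun z => hM.mem_insert⟩
  -- The members of `W` that are subsets of `W` form an inductive set, which therefore contains `W`;
  -- so `W` is transitive.
  obtain ⟨W', hW'⟩ := hM.sep (D := fun n => ∀ m, E M m n → E M m W) (by
    intro Γ W x hx
    repeat' first | assumption | constructor) W
  refine ⟨W, ⟨_, hW0⟩, fun n hn => ((hW' n).1 (((hW n).1 hn).2 W' ?_ ?_)).2, hWs⟩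
  · intro z hz
    obtain rfl := hM.isEmptySet_iff.1 ⟨id, hz⟩
    exact (hW' _).2 ⟨hW0, fun m hm => (hM.not_mem_emp m hm).elim⟩
  · intro y hy y' hy'
    refine succ hy' ((hW' _).2 ⟨hWs y ((hW' y).1 hy).1, fun m hm => ?_⟩)
    rcases hM.mem_insert.1 hm with hm | rfl
    · exact ((hW' y).1 hy).2 m hm
    · exact ((hW' _).1 hy).1

/-- Every set belongs to a transitive set. -/
theorem exists_transitive (hM : GBC M) (x : M.Obj) :
    ∃ t, E M x t ∧ ∀ y, E M y t → ∀ z, E M z y → E M z t := by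
  obtain ⟨W, ⟨n₀, hn₀⟩, htr, hsucc⟩ := hM.exists_omega
  have hT : {n | E M n W} ∈ M.Cls := hM.comp (by
    intro Γ W x hx
    repeat' first | assumption | constructor)
  -- Induction for arbitrary classes is not yet available, as it rests on transitive sets. On the
  -- transitive set `W`, foundation suffices.
  obtain ⟨f, hf, H⟩ := hM.exists_rec hT htr (by
      intro X hX hind n hn
      by_contra hnX
      have hXc : Xᶜ ∈ M.Cls := hM.comp (D := fun n => ¬ n ∈ X) (by
        intro Γ W x hx
        repeat' first | assumption | constructor)
      obtain ⟨m, hm, hmX, hmin⟩ := hM.exists_minimal hXc hn hnX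
      exact hmX (hind m hm fun v hv => not_not.1 (hmin v hv (htr m hm v hv))))
    -- The recursion puts into `f n` the set `x` and all elements of elements of `f m` for `m ∈ n`.
    -- Since `n ∈ n ∪ {n}`, the next stage contains the elements of the elements of `f n`, and the
    -- union of all stages is transitive.
    (H := fun y w => ∀ z, E M z w ↔ z = x ∨ ∃ u, E M u y ∧ ∃ v, E M v u ∧ E M z v) (by
      intro Γ W x y hx hy
      repeat' first | assumption | constructor)
    (fun y => ⟨hM.insert x (hM.sUnion (hM.sUnion y)), fun z => by
      simp only [hM.mem_insert, hM.mem_sUnion]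
      grind⟩)
    (fun y w w' h h' => hM.ext fun z => (h z).trans (h' z).symm)
  have hf' : ∀ n, E M n W → ∀ z, E M z (f n) ↔
      z = x ∨ ∃ m, E M m n ∧ ∃ v, E M v (f m) ∧ E M z v := by
    intro n hn z
    obtain ⟨y, hy, h⟩ := H n hn
    rw [h z]
    simp only [hy]
    grind
  obtain ⟨b, hb⟩ := hM.repl (D := fun n w => ∃ p, p ∈ {p | ∃ u ∈ {n | E M n W}, p = hM.op u (f u)} ∧
      IsOPair (E M) (NoAtom M) n w p) (by
    intro Γ W x y hx hy
    repeat' first | exact .memS hf .v0 rfl | assumption | apply ex_isOPair | constructor) W (by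
    simp only [hM.isOPair_iff, exists_eq_right, Set.mem_ofPred_eq, hM.op_inj]
    grind)
  simp only [hM.isOPair_iff, exists_eq_right, Set.mem_ofPred_eq, hM.op_inj] at hb
  have hb' : ∀ n, E M n W → E M (f n) b := fun n hn => (hb _).2 ⟨n, hn, n, hn, rfl, rfl⟩
  refine ⟨hM.sUnion b, hM.mem_sUnion.2 ⟨f n₀, hb' _ hn₀, (hf' n₀ hn₀ x).2 (.inl rfl)⟩, ?_⟩
  intro y hy z hz
  obtain ⟨w, hw, hyw⟩ := hM.mem_sUnion.1 hy
  obtain ⟨_, -, n, hn, rfl, rfl⟩ := (hb w).1 hw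
  exact hM.mem_sUnion.2 ⟨_, hb' _ (hsucc _ hn), (hf' _ (hsucc _ hn) z).2
    (.inr ⟨_, hM.mem_insert.2 (.inr rfl), y, hyw, hz⟩)⟩

/-- Induction along membership, for classes. -/
theorem induction (hM : GBC M) {X : Set M.Obj} (hX : X ∈ M.Cls)
    (h : ∀ u, (∀ v, E M v u → v ∈ X) → u ∈ X) (u : M.Obj) : u ∈ X := by
  by_contra hu
  have hXc : Xᶜ ∈ M.Cls := hM.comp (D := fun n => ¬ n ∈ X) (by
    intro Γ W x hx
    repeat' first | assumption | constructor)
  -- Foundation concerns sets, so the counterexamples are restricted to a transitive set;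
  -- transitivity makes a minimal one there minimal outright.
  obtain ⟨t, hut, htr⟩ := hM.exists_transitive u
  obtain ⟨m, hm, hmX, hmin⟩ := hM.exists_minimal hXc hut hu
  exact hmX (h m fun v hv => not_not.1 (hmin v hv (htr m hm v hv)))

/-- Induction along membership, for classes, three steps at a time. -/
theorem induction₃ (hM : GBC M) {X : Set M.Obj} (hX : X ∈ M.Cls)
    (h : ∀ u, (∀ v, E M v u → ∀ w, E M w v → ∀ z, E M z w → z ∈ X) → u ∈ X) (u : M.Obj) :
    u ∈ X := by
  have := hM.induction (X := {u | u ∈ X ∧ ∀ v, E M v u → v ∈ X ∧ ∀ w, E M w v → w ∈ X})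
    (hM.comp (by
      intro Γ W x hx
      repeat' first | assumption | constructor)) (fun u ih => ?_) u
  · exact this.1
  · exact ⟨h u fun v hv w hw => ((ih v hv).2 w hw).2, fun v hv =>
      ⟨(ih v hv).1, fun w hw => ((ih v hv).2 w hw).1⟩⟩

end GBC

end SetModel

namespace SetModel

variable {M : SetModel.{u}}

/-! ## The map `u ↦ ǔ` -/

theorem ex_tagOne₂ : Ex₂ (IsTagOne M) := fun _ _ _ _ hx hy => ex_isTagOne hx hy

namespace GBC

theorem exists_isCheckMap (hM : GBC M) : ∃ f, IsCheckMap M f := by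
  obtain ⟨f, hf, H⟩ := hM.exists_rec (T := {x | x = x})
    (hM.comp fun Γ W x hx => .eq hx hx) (fun _ _ _ _ => rfl)
    (fun X hX h u _ => hM.induction hX (fun u => h u rfl) u) ex_tagOne₂
    (fun y => ⟨_, hM.isTagOne_iff.2 rfl⟩)
    (fun y w w' h h' => (hM.isTagOne_iff.1 h).trans (hM.isTagOne_iff.1 h').symm)
  refine ⟨f, ?_, fun u => H u rfl⟩
  simpa [hM.isOPair_iff] using hf

/-- the copy of the set `u` -/
noncomputable def check (hM : GBC M) : M.Obj → M.Obj := hM.exists_isCheckMap.choose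

theorem isCheckMap_check (hM : GBC M) : IsCheckMap M hM.check :=
  hM.exists_isCheckMap.choose_spec

/-- The graph of the check map -/
def checkGraph (hM : GBC M) : Set M.Obj := {p | ∃ u, p = hM.op u (hM.check u)}

theorem checkGraph_mem (hM : GBC M) : hM.checkGraph ∈ M.Cls := by
  have := hM.isCheckMap_check.1
  simp only [hM.isOPair_iff] at this
  exact this

theorem op_mem_checkGraph (hM : GBC M) {u x : M.Obj} :
    hM.op u x ∈ hM.checkGraph ↔ x = hM.check u := by
  constructor
  · rintro ⟨v, hv⟩
    obtain ⟨rfl, rfl⟩ := hM.op_inj.1 hv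
    rfl
  · rintro rfl
    exact ⟨u, rfl⟩

/-- With the graph as a class constant this is first-order, as separation and comprehension require.
The parameter-free form is `GBC.ex_isCheck`. -/
theorem ex_check (hM : GBC M) : Ex₂ fun u x => x = hM.check u := by
  intro Γ W x y hx hy
  refine Ex.congr (D := fun g => ∃ p, p ∈ hM.checkGraph ∧ IsOPair (E M) (NoAtom M) (x g) (y g) p)
    ?_ fun g => ?_
  · have := hM.checkGraph_mem
    repeat' first | assumption | apply ex_isOPair | constructor
  · simp [hM.isOPair_iff, hM.op_mem_checkGraph]

theorem exists_check_eq (hM : GBC M) (u : M.Obj) :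
    ∃ y, (∀ w, E M w y ↔ ∃ v, E M v u ∧ w = hM.check v) ∧ hM.check u = hM.tag1 y := by
  obtain ⟨y, hy, h⟩ := hM.isCheckMap_check.2 u
  exact ⟨y, hy, hM.isTagOne_iff.1 h⟩

/-- `IsCheck` allows any function whose graph is a class. Expressibility of `f` through its graph is
what makes the induction possible. -/
theorem check_unique (hM : GBC M) {f : M.Obj → M.Obj} (hf : IsCheckMap M f) (u : M.Obj) :
    f u = hM.check u := by
  obtain ⟨hf, H⟩ := hf
  simp only [hM.isOPair_iff] at hf
  have e : Ex₂ fun u x => x = f u := by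
    intro Γ W x y hx hy
    refine Ex.congr (D := fun g => ∃ p, p ∈ {p | ∃ u, p = hM.op u (f u)} ∧
      IsOPair (E M) (NoAtom M) (x g) (y g) p) ?_ fun g => ?_
    · refine .exO (.and (.memS hf .v0 rfl) (ex_isOPair ?_ ?_ ?_)) <;> constructor <;> assumption
    · simp only [hM.isOPair_iff, exists_eq_right, Set.mem_ofPred_eq, hM.op_inj]
      exact ⟨fun h => ⟨_, rfl, h⟩, by rintro ⟨u, rfl, h⟩; exact h⟩
  refine hM.induction (X := {u | ∃ x, x = f u ∧ x = hM.check u}) (hM.comp ?_) ?_ u |>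
    fun ⟨x, h, h'⟩ => h ▸ h'
  · intro Γ W x hx
    exact .exO (.and (e (.l1 hx) .v0) (hM.ex_check (.l1 hx) .v0))
  · intro u ih
    obtain ⟨y, hy, h⟩ := H u
    obtain ⟨y', hy', h'⟩ := hM.exists_check_eq u
    refine ⟨_, rfl, ?_⟩
    rw [h', hM.isTagOne_iff.1 h, hM.tag1_inj]
    refine hM.ext fun w => ?_
    rw [hy, hy']
    refine exists_congr fun v => and_congr_right fun hv => ?_
    obtain ⟨x, hx, hx'⟩ := ih v hv
    rw [← hx, hx']

theorem isCheck_iff (hM : GBC M) {u x : M.Obj} : IsCheck M u x ↔ x = hM.check u := by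
  constructor
  · rintro ⟨f, hf, rfl⟩
    exact hM.check_unique hf u
  · rintro rfl
    exact ⟨_, hM.isCheckMap_check, rfl⟩

theorem check_inj (hM : GBC M) {u v : M.Obj} : hM.check u = hM.check v ↔ u = v := by
  refine ⟨fun h => ?_, congrArg _⟩
  -- The common value `x` is quantified because only the graph relation is expressible, not the
  -- equation between two values.
  refine hM.induction (X := {u | ∀ v x, x = hM.check u → x = hM.check v → u = v}) (hM.comp ?_)
    ?_ u v _ rfl h
  · intro Γ W x hx
    refine .allO (.allO (.imp (hM.ex_check ?_ ?_) (.imp (hM.ex_check ?_ ?_) (.eq ?_ ?_)))) <;>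
      constructor <;> assumption
  · rintro u ih v _ rfl hv
    obtain ⟨y, hy, h⟩ := hM.exists_check_eq u
    obtain ⟨y', hy', h'⟩ := hM.exists_check_eq v
    obtain rfl : y = y' := hM.tag1_inj.1 (h.symm.trans (hv.trans h'))
    refine hM.ext fun w => ⟨fun hw => ?_, fun hw => ?_⟩
    · obtain ⟨w', hw', e⟩ := (hy' _).1 ((hy _).2 ⟨w, hw, rfl⟩)
      rwa [ih w hw w' _ rfl e]
    · obtain ⟨w', hw', e⟩ := (hy _).1 ((hy' _).2 ⟨w, hw, rfl⟩)
      rwa [← ih w' hw' w _ e rfl]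

end GBC

/-! ## The domain of the urelement model -/

/-- Every element of `t` is `⟨0, a⟩` for some `a ∈ A`, or `⟨1, y⟩` for some `y ⊆ t`. -/
def IsGood (A : Set M.Obj) (t : M.Obj) : Prop :=
  ∀ w, E M w t → (∃ a, a ∈ A ∧ IsTagZero M a w) ∨
    ∃ y, IsTagOne M y w ∧ ∀ v, E M v y → E M v t

theorem ex_isGood {A : Set M.Obj} (hA : A ∈ M.Cls) : Ex₁ (IsGood A) := by
  intro Γ W x hx
  unfold IsGood
  repeat' first | assumption | apply ex_isTagZero | apply ex_isTagOne | constructor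

namespace GBC

/-- A singleton {⟨0, a⟩} is good, and good sets are closed under unions. For ⟨1, y⟩, good sets
covering `y` are collected, united and enlarged by ⟨1, y⟩ itself. -/
theorem uClosed_good (hM : GBC M) {A : Set M.Obj} (hA : A ∈ M.Cls) :
    UClosed M A {x | ∃ t, IsGood A t ∧ E M x t} := by
  constructor
  · rintro a ha x hx
    refine ⟨hM.pair x x, fun w hw => .inl ⟨a, ha, ?_⟩, hM.mem_pair.2 (.inl rfl)⟩
    obtain rfl : w = x := by simpa [hM.mem_pair] using hw
    exact hx
  · intro y hy x hx
    have hG := ex_isGood hA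
    obtain ⟨b, hb⟩ := hM.coll (D := fun v t => IsGood A t ∧ E M v t) (by
      intro Γ W x y hx hy
      repeat' first | assumption | apply hG | constructor) y hy
    obtain ⟨b', hb'⟩ := hM.sep hG b
    refine ⟨hM.insert x (hM.sUnion b'), fun w hw => ?_, hM.mem_insert.2 (.inr rfl)⟩
    rcases hM.mem_insert.1 hw with hw | rfl
    · obtain ⟨t, ht, hwt⟩ := hM.mem_sUnion.1 hw
      refine (((hb' t).1 ht).2 w hwt).imp_right fun ⟨y, hy, h⟩ => ⟨y, hy, fun v hv => ?_⟩
      exact hM.mem_insert.2 (.inl (hM.mem_sUnion.2 ⟨t, ht, h v hv⟩))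
    · refine .inr ⟨y, hx, fun v hv => ?_⟩
      obtain ⟨t, ht, htg, hvt⟩ := hb v hv
      exact hM.mem_insert.2 (.inl (hM.mem_sUnion.2 ⟨t, (hb' t).2 ⟨ht, htg⟩, hvt⟩))

theorem good_mem_cls (hM : GBC M) {A : Set M.Obj} (hA : A ∈ M.Cls) :
    {x | ∃ t, IsGood A t ∧ E M x t} ∈ M.Cls := by
  have hG := ex_isGood hA
  refine hM.comp ?_
  intro Γ W x hx
  repeat' first | assumption | apply hG | constructor

/-- Trades the class quantifier of `UDomain` for a set quantifier; without this, first-order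
comprehension would not make the domain a class. -/
theorem uDomain_eq (hM : GBC M) {A : Set M.Obj} (hA : A ∈ M.Cls) :
    UDomain M A = {x | ∃ t, IsGood A t ∧ E M x t} := by
  apply Set.Subset.antisymm
  · intro x hx
    exact hx _ (hM.good_mem_cls hA) (hM.uClosed_good hA)
  · rintro x ⟨t, ht, hxt⟩ C hC ⟨h0, h1⟩
    refine hM.induction₃ (X := {x | E M x t → x ∈ C}) (hM.comp ?_) (fun u ih hut => ?_) x hxt
    · intro Γ W x hx
      repeat' first | assumption | constructor
    · rcases ht u hut with ⟨a, ha, hu⟩ | ⟨y, hu, hy⟩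
      · exact h0 a ha u hu
      · refine h1 y (fun v hv => ?_) u hu
        -- Three membership steps lead from `v` to the tagged pair: v ∈ y ∈ {1, y} ∈ ⟨1, y⟩.
        obtain rfl := hM.isTagOne_iff.1 hu
        exact ih _ (hM.mem_pair.2 (.inr rfl)) _ (hM.mem_pair.2 (.inr rfl)) v hv (hy v hv)

theorem uDomain_mem_cls (hM : GBC M) {A : Set M.Obj} (hA : A ∈ M.Cls) :
    UDomain M A ∈ M.Cls := by
  rw [hM.uDomain_eq hA]
  exact hM.good_mem_cls hA

theorem tag0_mem_uDomain (hM : GBC M) {A : Set M.Obj} {a : M.Obj} (ha : a ∈ A) :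
    hM.tag0 a ∈ UDomain M A :=
  fun _ _ h => h.1 a ha _ (hM.isTagZero_iff.2 rfl)

theorem tag1_mem_uDomain (hM : GBC M) {A : Set M.Obj} {y : M.Obj}
    (hy : ∀ v, E M v y → v ∈ UDomain M A) : hM.tag1 y ∈ UDomain M A :=
  fun C hC h => h.2 y (fun v hv => hy v hv C hC h) _ (hM.isTagOne_iff.2 rfl)

theorem uDomain_cases (hM : GBC M) {A : Set M.Obj} (hA : A ∈ M.Cls) {x : M.Obj}
    (hx : x ∈ UDomain M A) :
    (∃ a ∈ A, x = hM.tag0 a) ∨ ∃ y, (∀ v, E M v y → v ∈ UDomain M A) ∧ x = hM.tag1 y := by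
  rw [hM.uDomain_eq hA] at hx ⊢
  obtain ⟨t, ht, hxt⟩ := hx
  rcases ht x hxt with ⟨a, ha, hx⟩ | ⟨y, hx, hy⟩
  · exact .inl ⟨a, ha, hM.isTagZero_iff.1 hx⟩
  · exact .inr ⟨y, fun v hv => ⟨t, ht, hy v hv⟩, hM.isTagOne_iff.1 hx⟩

theorem mem_of_tag1_mem_uDomain (hM : GBC M) {A : Set M.Obj} (hA : A ∈ M.Cls) {y v : M.Obj}
    (h : hM.tag1 y ∈ UDomain M A) (hv : E M v y) : v ∈ UDomain M A := by
  rcases hM.uDomain_cases hA h with ⟨a, _, e⟩ | ⟨y', hy', e⟩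
  · exact (hM.tag0_ne_tag1 e.symm).elim
  · rw [hM.tag1_inj.1 e] at hv
    exact hy' v hv

/-- Induction on the domain of the urelement model. -/
theorem uDomain_induction (hM : GBC M) {A : Set M.Obj} (hA : A ∈ M.Cls) {X : Set M.Obj}
    (hX : X ∈ M.Cls) (h0 : ∀ a ∈ A, hM.tag0 a ∈ X)
    (h1 : ∀ y, (∀ v, E M v y → v ∈ UDomain M A ∧ v ∈ X) → hM.tag1 y ∈ X) {x : M.Obj}
    (hx : x ∈ UDomain M A) : x ∈ X := by
  have hD := hM.uDomain_mem_cls hA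
  refine (hx {x | x ∈ UDomain M A ∧ x ∈ X} (hM.comp ?_) ⟨fun a ha x hx => ?_, fun y hy x hx => ?_⟩).2
  · intro Γ W x hx
    exact .and (.memS hD hx rfl) (.memS hX hx rfl)
  · rw [hM.isTagZero_iff.1 hx]
    exact ⟨hM.tag0_mem_uDomain ha, h0 a ha⟩
  · rw [hM.isTagOne_iff.1 hx]
    exact ⟨hM.tag1_mem_uDomain fun v hv => (hy v hv).1, h1 y hy⟩

theorem check_mem_uDomain (hM : GBC M) {A : Set M.Obj} (hA : A ∈ M.Cls) (u : M.Obj) :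
    hM.check u ∈ UDomain M A := by
  have hD := hM.uDomain_mem_cls hA
  refine hM.induction (X := {u | ∀ x, x = hM.check u → x ∈ UDomain M A}) (hM.comp ?_) ?_ u _ rfl
  · intro Γ W x hx
    exact .allO (.imp (hM.ex_check (.l1 hx) .v0) (.memS hD .v0 rfl))
  · rintro u ih _ rfl
    obtain ⟨y, hy, h⟩ := hM.exists_check_eq u
    rw [h]
    refine hM.tag1_mem_uDomain fun w hw => ?_
    obtain ⟨v, hv, rfl⟩ := (hy w).1 hw
    exact ih v hv _ rfl

end GBC

end SetModel

namespace SetModel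

variable {M : SetModel.{u}} {A : Set M.Obj}

/-! ## The basic relations of the urelement model -/

theorem ex_uMem {fo par : Bool} {Γ : Type u} {W : Vars M Γ} {x z : Γ → M.Obj}
    (hx : Tm par W .obj x) (hz : Tm par W .obj z) :
    Ex fo par W fun g => ∃ y, IsTagOne M y (z g) ∧ E M (x g) y :=
  .exO (.and (ex_isTagOne .v0 (.l1 hz)) (.rel (.l1 hx) .v0))

/-- The ordered pair of the urelement model, in the sense of `M`: the atoms play no role. -/
def IsUModelPair (M : SetModel.{u}) (x y p : M.Obj) : Prop :=
  ∃ a, IsUPair (E M) (NoAtom M) x x a ∧ ∃ b, IsUPair (E M) (NoAtom M) x y b ∧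
    ∃ a', IsTagOne M a a' ∧ ∃ b', IsTagOne M b b' ∧
      ∃ c, IsUPair (E M) (NoAtom M) a' b' c ∧ IsTagOne M c p

theorem ex_isUModelPair {fo par : Bool} {Γ : Type u} {W : Vars M Γ} {x y p : Γ → M.Obj}
    (hx : Tm par W .obj x) (hy : Tm par W .obj y) (hp : Tm par W .obj p) :
    Ex fo par W fun g => IsUModelPair M (x g) (y g) (p g) := by
  unfold IsUModelPair
  repeat' first | assumption | apply ex_isUPair | apply ex_isTagOne | constructor

/-- An object of the urelement model, as an object of `M`. -/
def uval (x : (uModel M A).Obj) : M.Obj := x.1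

/-- An element of the domain, as an object of the urelement model. -/
def umk (x : M.Obj) (hx : x ∈ UDomain M A) : (uModel M A).Obj := ⟨x, hx⟩

@[simp] theorem uval_umk (x : M.Obj) (hx : x ∈ UDomain M A) : uval (umk x hx) = x := rfl

theorem uval_mem (x : (uModel M A).Obj) : uval x ∈ UDomain M A := x.2

theorem uval_inj {x y : (uModel M A).Obj} : uval x = uval y ↔ x = y := Subtype.ext_iff.symm

namespace GBC

theorem uE_iff (hM : GBC M) {x z : (uModel M A).Obj} :
    UModel.E (uModel M A) x z ↔ ∃ y, uval z = hM.tag1 y ∧ E M (uval x) y := by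
  change (∃ y, IsTagOne M y (uval z) ∧ E M (uval x) y) ↔ _
  simp only [hM.isTagOne_iff]

theorem enum_iff (hM : GBC M) {i x : (uModel M A).Obj} :
    UModel.Enum (uModel M A) i x ↔ ∃ a ∈ A, uval i = hM.check a ∧ uval x = hM.tag0 a := by
  change (∃ a ∈ A, IsCheck M a (uval i) ∧ IsTagZero M a (uval x)) ↔ _
  simp only [hM.isCheck_iff, hM.isTagZero_iff]

theorem atom_iff (hM : GBC M) (hA : A ∈ M.Cls) {x : (uModel M A).Obj} :
    UModel.Atom (uModel M A) x ↔ ∃ a ∈ A, uval x = hM.tag0 a := by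
  simp only [UModel.Atom, hM.enum_iff]
  constructor
  · rintro ⟨i, a, ha, -, h⟩
    exact ⟨a, ha, h⟩
  · rintro ⟨a, ha, h⟩
    exact ⟨umk _ (hM.check_mem_uDomain hA a), a, ha, rfl, h⟩

/-- the element of the urelement model with the elements of `y` that belong to its domain -/
theorem exists_uset (hM : GBC M) (hA : A ∈ M.Cls) (y : M.Obj) :
    ∃ s : (uModel M A).Obj, ¬ UModel.Atom (uModel M A) s ∧
      ∀ z, UModel.E (uModel M A) z s ↔ E M (uval z) y := by
  obtain ⟨y', hy'⟩ := hM.sep (D := fun x => x ∈ UDomain M A)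
    (fun Γ W x hx => .memS (hM.uDomain_mem_cls hA) hx rfl) y
  refine ⟨umk (hM.tag1 y') (hM.tag1_mem_uDomain fun v hv => ((hy' v).1 hv).2), ?_, fun z => ?_⟩
  · rw [hM.atom_iff hA]
    rintro ⟨a, -, h⟩
    exact hM.tag0_ne_tag1 h.symm
  · rw [hM.uE_iff]
    constructor
    · rintro ⟨w, hw, hz⟩
      rw [uval_umk, hM.tag1_inj] at hw
      rw [← hw] at hz
      exact ((hy' _).1 hz).1
    · exact fun h => ⟨y', rfl, (hy' _).2 ⟨h, uval_mem z⟩⟩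

theorem uModel_cases (hM : GBC M) (hA : A ∈ M.Cls) (x : (uModel M A).Obj) :
    UModel.Atom (uModel M A) x ∧ (∀ z, ¬ UModel.E (uModel M A) z x) ∨
      ¬ UModel.Atom (uModel M A) x ∧ ∃ y, uval x = hM.tag1 y ∧ (∀ v, E M v y → v ∈ UDomain M A) ∧
        ∀ z, UModel.E (uModel M A) z x ↔ E M (uval z) y := by
  rw [hM.atom_iff hA]
  rcases hM.uDomain_cases hA (uval_mem x) with ⟨a, ha, h⟩ | ⟨y, hy, h⟩
  · refine .inl ⟨⟨a, ha, h⟩, fun z hz => ?_⟩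
    obtain ⟨y, hy, -⟩ := hM.uE_iff.1 hz
    exact hM.tag0_ne_tag1 (h.symm.trans hy)
  · refine .inr ⟨?_, y, h, hy, fun z => ?_⟩
    · rintro ⟨a, -, h'⟩
      exact hM.tag0_ne_tag1 (h'.symm.trans h)
    · simp [hM.uE_iff, h, hM.tag1_inj]

theorem uModel_set (hM : GBC M) (hA : A ∈ M.Cls) {x : (uModel M A).Obj}
    (h : ¬ UModel.Atom (uModel M A) x) :
    ∃ y, uval x = hM.tag1 y ∧ (∀ v, E M v y → v ∈ UDomain M A) ∧
        ∀ z, UModel.E (uModel M A) z x ↔ E M (uval z) y :=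
  (hM.uModel_cases hA x).elim (fun h' => (h h'.1).elim) And.right

theorem uModel_ext (hM : GBC M) (hA : A ∈ M.Cls) {x y : (uModel M A).Obj}
    (hx : ¬ UModel.Atom (uModel M A) x) (hy : ¬ UModel.Atom (uModel M A) y)
    (h : ∀ z, UModel.E (uModel M A) z x ↔ UModel.E (uModel M A) z y) : x = y := by
  obtain ⟨x', ex, hx', Hx⟩ := hM.uModel_set hA hx
  obtain ⟨y', ey, hy', Hy⟩ := hM.uModel_set hA hy
  rw [← uval_inj, ex, ey, hM.tag1_inj]
  refine hM.ext fun z => ⟨fun hz => ?_, fun hz => ?_⟩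
  · exact (Hy (umk z (hx' z hz))).1 ((h _).1 ((Hx _).2 hz))
  · exact (Hx (umk z (hy' z hz))).1 ((h _).2 ((Hy _).2 hz))

/-- Induction in the urelement model. -/
theorem uModel_induction (hM : GBC M) (hA : A ∈ M.Cls) {X : Set M.Obj} (hX : X ∈ M.Cls)
    (h : ∀ x : (uModel M A).Obj, (∀ z, UModel.E (uModel M A) z x → uval z ∈ X) → uval x ∈ X)
    (x : (uModel M A).Obj) : uval x ∈ X := by
  refine hM.uDomain_induction hA hX (fun a ha => ?_) (fun y hy => ?_) (uval_mem x)
  · refine h (umk _ (hM.tag0_mem_uDomain ha)) fun z hz => ?_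
    obtain ⟨y, e, -⟩ := hM.uE_iff.1 hz
    exact (hM.tag0_ne_tag1 e).elim
  · refine h (umk _ (hM.tag1_mem_uDomain fun v hv => (hy v hv).1)) fun z hz => ?_
    obtain ⟨y', e, hz⟩ := hM.uE_iff.1 hz
    rw [← hM.tag1_inj.1 e] at hz
    exact (hy _ hz).2

/-- A set of sets of the urelement model consists of tagged pairs ⟨1, y⟩. Stripping the tags yields
a family to which union and choice of `M` apply. -/
theorem exists_untag (hM : GBC M) (x : M.Obj) : ∃ s, ∀ y, E M y s ↔ E M (hM.tag1 y) x := by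
  obtain ⟨s, hs⟩ := hM.repl (D := fun w y => IsTagOne M y w)
    (fun Γ W x y hx hy => ex_isTagOne hy hx) x (by
      intro w _ y y' h h'
      exact hM.tag1_inj.1 ((hM.isTagOne_iff.1 h).symm.trans (hM.isTagOne_iff.1 h')))
  refine ⟨s, fun y => (hs y).trans ?_⟩
  simp [hM.isTagOne_iff]

/-- The check map, into the urelement model. -/
noncomputable def ucheck (hM : GBC M) (hA : A ∈ M.Cls) (u : M.Obj) : (uModel M A).Obj :=
  umk (hM.check u) (hM.check_mem_uDomain hA u)

theorem ucheck_inj (hM : GBC M) (hA : A ∈ M.Cls) {u v : M.Obj} :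
    hM.ucheck hA u = hM.ucheck hA v ↔ u = v :=
  uval_inj.symm.trans hM.check_inj

theorem not_atom_ucheck (hM : GBC M) (hA : A ∈ M.Cls) (u : M.Obj) :
    ¬ UModel.Atom (uModel M A) (hM.ucheck hA u) := by
  rw [hM.atom_iff hA]
  rintro ⟨a, -, h⟩
  obtain ⟨y, -, h'⟩ := hM.exists_check_eq u
  exact hM.tag0_ne_tag1 (h.symm.trans h')

theorem uE_ucheck_iff (hM : GBC M) (hA : A ∈ M.Cls) {z : (uModel M A).Obj} {u : M.Obj} :
    UModel.E (uModel M A) z (hM.ucheck hA u) ↔ ∃ v, E M v u ∧ z = hM.ucheck hA v := by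
  obtain ⟨y, hy, h⟩ := hM.exists_check_eq u
  simp [hM.uE_iff, ucheck, h, hM.tag1_inj, hy, ← uval_inj]

theorem ucheck_uE_ucheck_iff (hM : GBC M) (hA : A ∈ M.Cls) {u v : M.Obj} :
    UModel.E (uModel M A) (hM.ucheck hA v) (hM.ucheck hA u) ↔ E M v u := by
  simp [hM.uE_ucheck_iff, hM.ucheck_inj]

/-- Each axiom is applied in `M` to the untagged sets and its witness is brought back by
`exists_uset`; for infinity the copy of an infinite set of `M` serves. -/
theorem zfcuAxioms_uModel (hM : GBC M) (hA : A ∈ M.Cls) :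
    ZFCUAxioms (UModel.E (uModel M A)) (UModel.Atom (uModel M A)) where
  atoms a ha x := (hM.uModel_cases hA a).elim (fun h => h.2 x) (fun h => (h.1 ha).elim)
  extensionality _ _ hx hy h := hM.uModel_ext hA hx hy h
  foundation := by
    rintro x ⟨y, hy⟩
    -- If no element of `x` is minimal, non-membership in `x` propagates from the elements of any
    -- object to that object, so by induction `x` is empty.
    by_contra! hcon
    obtain ⟨x', ex, hx', Hx⟩ := (hM.uModel_cases hA x).elim (fun h => (h.2 y hy).elim) And.right
    refine hM.uModel_induction hA (X := {z | ¬ E M z x'}) (hM.comp ?_) (fun u ih hu => ?_) y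
      ((Hx y).1 hy)
    · intro Γ W x hx
      repeat' first | assumption | constructor
    · obtain ⟨z, hz, hzu⟩ := hcon u ((Hx u).2 hu)
      exact ih z hzu ((Hx z).1 hz)
  pairing a b := by
    obtain ⟨s, hs, H⟩ := hM.exists_uset hA (hM.pair (uval a) (uval b))
    refine ⟨s, hs, fun z => (H z).trans ?_⟩
    rw [hM.mem_pair, uval_inj, uval_inj]
  union x := by
    rcases hM.uModel_cases hA x with ⟨-, hx⟩ | ⟨-, x', ex, hx', Hx⟩
    · obtain ⟨s, hs, H⟩ := hM.exists_uset hA hM.emp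
      exact ⟨s, hs, fun z => by simp [H, hx, hM.not_mem_emp]⟩
    · obtain ⟨y, hy⟩ := hM.exists_untag x'
      obtain ⟨s, hs, H⟩ := hM.exists_uset hA (hM.sUnion y)
      refine ⟨s, hs, fun z => ?_⟩
      rw [H, hM.mem_sUnion]
      constructor
      · rintro ⟨w, hw, hz⟩
        have hw' := (hy w).1 hw
        exact ⟨umk (hM.tag1 w) (hx' _ hw'), (Hx _).2 hw', hM.uE_iff.2 ⟨w, rfl, hz⟩⟩
      · rintro ⟨w, hw, hz⟩
        obtain ⟨w', e, hz⟩ := hM.uE_iff.1 hz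
        exact ⟨w', (hy w').2 (e ▸ (Hx w).1 hw), hz⟩
  power x := by
    rcases hM.uModel_cases hA x with ⟨-, hx⟩ | ⟨-, x', ex, hx', Hx⟩
    · obtain ⟨o, ho, Ho⟩ := hM.exists_uset hA hM.emp
      obtain ⟨s, hs, H⟩ := hM.exists_uset hA (hM.pair (uval o) (uval o))
      refine ⟨s, hs, fun z => ?_⟩
      rw [H, hM.mem_pair, or_self, uval_inj]
      constructor
      · rintro rfl
        exact ⟨ho, fun w hw => (hM.not_mem_emp _ ((Ho w).1 hw)).elim⟩
      · rintro ⟨hz, h⟩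
        exact hM.uModel_ext hA hz ho fun w =>
          ⟨fun hw => (hx w (h w hw)).elim, fun hw => (hM.not_mem_emp _ ((Ho w).1 hw)).elim⟩
    · obtain ⟨p, -, hp⟩ := hM.zfcu.power x'
      -- The subsets of `x` in the model are the ⟨1, y⟩ with `y ⊆ x'`.
      obtain ⟨q, hq⟩ := hM.repl (D := IsTagOne M) ex_tagOne₂ p (fun y _ w w' h h' =>
        (hM.isTagOne_iff.1 h).trans (hM.isTagOne_iff.1 h').symm)
      simp only [hM.isTagOne_iff] at hq
      obtain ⟨s, hs, H⟩ := hM.exists_uset hA q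
      refine ⟨s, hs, fun z => ?_⟩
      rw [H, hq]
      constructor
      · rintro ⟨y, hy, e⟩
        refine ⟨?_, fun w hw => ?_⟩
        · rw [hM.atom_iff hA]
          rintro ⟨a, -, h⟩
          exact hM.tag0_ne_tag1 (h.symm.trans e)
        · obtain ⟨y', e', hw⟩ := hM.uE_iff.1 hw
          rw [e, hM.tag1_inj] at e'
          rw [← e'] at hw
          exact (Hx w).2 (((hp y).1 hy).2 _ hw)
      · rintro ⟨hz, h⟩
        obtain ⟨y, e, hy, Hy⟩ := hM.uModel_set hA hz
        exact ⟨y, (hp y).2 ⟨id, fun w hw =>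
          (Hx (umk w (hy w hw))).1 (h _ ((Hy (umk w (hy w hw))).2 hw))⟩, e⟩
  infinity := by
    obtain ⟨x, -, ⟨z, hz, hz0⟩, hs⟩ := hM.zfcu.infinity
    refine ⟨hM.ucheck hA x, hM.not_atom_ucheck hA x, ⟨hM.ucheck hA z,
      (hM.ucheck_uE_ucheck_iff hA).2 hz, hM.not_atom_ucheck hA z, fun w hw => ?_⟩, fun y hy => ?_⟩
    · obtain ⟨v, hv, -⟩ := (hM.uE_ucheck_iff hA).1 hw
      exact hz0.2 v hv
    · obtain ⟨v, hv, rfl⟩ := (hM.uE_ucheck_iff hA).1 hy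
      obtain ⟨s, hs, -, H⟩ := hs v hv
      refine ⟨hM.ucheck hA s, (hM.ucheck_uE_ucheck_iff hA).2 hs, hM.not_atom_ucheck hA s,
        fun z => ?_⟩
      simp only [hM.uE_ucheck_iff]
      constructor
      · rintro ⟨w, hw, rfl⟩
        rcases (H w).1 hw with hw | rfl
        · exact .inl ⟨w, hw, rfl⟩
        · exact .inr rfl
      · rintro (⟨w, hw, rfl⟩ | rfl)
        · exact ⟨w, (H w).2 (.inl hw), rfl⟩
        · exact ⟨v, (H v).2 (.inr rfl), rfl⟩
  choice x hne hdis := by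
    rcases hM.uModel_cases hA x with ⟨-, hx⟩ | ⟨-, x', ex, hx', Hx⟩
    · obtain ⟨s, hs, H⟩ := hM.exists_uset hA hM.emp
      exact ⟨s, hs, fun y hy => (hx y hy).elim⟩
    · obtain ⟨y, hy⟩ := hM.exists_untag x'
      have key : ∀ v, E M v y → ∃ w : (uModel M A).Obj, UModel.E (uModel M A) w x ∧
          uval w = hM.tag1 v ∧ (∀ z, E M z v → z ∈ UDomain M A) ∧
          ∀ z, UModel.E (uModel M A) z w ↔ E M (uval z) v := by
        intro v hv
        have hv' := (hy v).1 hv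
        refine ⟨umk _ (hx' _ hv'), (Hx _).2 hv', rfl,
          fun z hz => hM.mem_of_tag1_mem_uDomain hA (hx' _ hv') hz, fun z => ?_⟩
        simp [hM.uE_iff, hM.tag1_inj]
      obtain ⟨c, -, hc⟩ := hM.zfcu.choice y (by
        intro v hv
        obtain ⟨w, hw, -, -, H⟩ := key v hv
        obtain ⟨z, hz⟩ := hne w hw
        exact ⟨uval z, (H z).1 hz⟩) (by
        rintro v hv v' hv' ⟨z, hz, hz'⟩
        obtain ⟨w, hw, e, hd, H⟩ := key v hv
        obtain ⟨w', hw', e', hd', H'⟩ := key v' hv'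
        have := hdis w hw w' hw' ⟨umk z (hd z hz), (H _).2 hz, (H' _).2 hz'⟩
        rw [← hM.tag1_inj, ← e, ← e', this])
      obtain ⟨s, hs, H⟩ := hM.exists_uset hA c
      refine ⟨s, hs, fun w hw => ?_⟩
      obtain ⟨z₀, hz₀⟩ := hne w hw
      obtain ⟨v, e, hd, Hw⟩ :=
        (hM.uModel_cases hA w).elim (fun h => (h.2 z₀ hz₀).elim) And.right
      obtain ⟨z, ⟨hz, hzc⟩, huniq⟩ := hc v ((hy v).2 (e ▸ (Hx w).1 hw))
      refine ⟨umk z (hd z hz), ⟨(Hw _).2 hz, (H _).2 hzc⟩, fun z' hz' => ?_⟩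
      exact uval_inj.1 (huniq (uval z') ⟨(Hw _).1 hz'.1, (H _).1 hz'.2⟩)

theorem isUPair_uModel (hM : GBC M) (hA : A ∈ M.Cls) {x y c : (uModel M A).Obj} :
    IsUPair (UModel.E (uModel M A)) (UModel.Atom (uModel M A)) x y c ↔
      uval c = hM.tag1 (hM.pair (uval x) (uval y)) := by
  constructor
  · rintro ⟨hc, h⟩
    obtain ⟨y', e, hy', H⟩ := hM.uModel_set hA hc
    rw [e, hM.tag1_inj]
    refine hM.ext fun z => ?_
    rw [hM.mem_pair]
    constructor
    · intro hz
      have := (h (umk z (hy' z hz))).1 ((H _).2 hz)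
      simpa [← uval_inj] using this
    · rintro (rfl | rfl)
      · exact (H x).1 ((h x).2 (.inl rfl))
      · exact (H y).1 ((h y).2 (.inr rfl))
  · intro e
    refine ⟨?_, fun z => ?_⟩
    · rw [hM.atom_iff hA]
      rintro ⟨a, -, h⟩
      exact hM.tag0_ne_tag1 (h.symm.trans e)
    · rw [hM.uE_iff, ← uval_inj, ← uval_inj, ← hM.mem_pair]
      simp [e, hM.tag1_inj]

/-- the ordered pair of the urelement model -/
noncomputable def uop (hM : GBC M) (x y : M.Obj) : M.Obj :=
  hM.tag1 (hM.pair (hM.tag1 (hM.pair x x)) (hM.tag1 (hM.pair x y)))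

theorem isUModelPair_iff (hM : GBC M) {x y p : M.Obj} :
    IsUModelPair M x y p ↔ p = hM.uop x y := by
  simp [IsUModelPair, hM.isUPair_iff, hM.isTagOne_iff, uop]

theorem tag1_pair_mem (hM : GBC M) {x y : M.Obj} (hx : x ∈ UDomain M A) (hy : y ∈ UDomain M A) :
    hM.tag1 (hM.pair x y) ∈ UDomain M A := by
  refine hM.tag1_mem_uDomain fun v hv => ?_
  rcases hM.mem_pair.1 hv with rfl | rfl <;> assumption

theorem uop_mem (hM : GBC M) {x y : M.Obj} (hx : x ∈ UDomain M A) (hy : y ∈ UDomain M A) :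
    hM.uop x y ∈ UDomain M A :=
  hM.tag1_pair_mem (hM.tag1_pair_mem hx hx) (hM.tag1_pair_mem hx hy)

/-- The inner pairs {x} and {x, y} of the model are the objects ⟨1, {x}⟩ and ⟨1, {x, y}⟩, so the
condition becomes that of an unordered pair of these two. -/
theorem isOPair_uModel (hM : GBC M) (hA : A ∈ M.Cls) {x y p : (uModel M A).Obj} :
    IsOPair (UModel.E (uModel M A)) (UModel.Atom (uModel M A)) x y p ↔ uval p = hM.uop (uval x) (uval y) := by
  have h := hM.isUPair_uModel hA (x := umk _ (hM.tag1_pair_mem (uval_mem x) (uval_mem x)))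
    (y := umk _ (hM.tag1_pair_mem (uval_mem x) (uval_mem y))) (c := p)
  exact Iff.trans (and_congr_right' (forall_congr' fun z => iff_congr Iff.rfl (or_congr
    ((hM.isUPair_uModel hA).trans (uval_inj (y := umk _ _)))
    ((hM.isUPair_uModel hA).trans (uval_inj (y := umk _ _)))))) h

theorem uop_inj (hM : GBC M) {a b c d : M.Obj} :
    hM.uop a b = hM.uop c d ↔ a = c ∧ b = d := by
  refine ⟨fun h => ?_, fun ⟨h, h'⟩ => by rw [h, h']⟩
  rw [uop, uop, hM.tag1_inj] at h
  rw [← hM.op_inj]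
  rcases hM.pair_eq_pair h with ⟨h1, h2⟩ | ⟨h1, h2⟩
  · rw [op, op, hM.tag1_inj.1 h1, hM.tag1_inj.1 h2]
  · have h1 := hM.pair_eq_pair (hM.tag1_inj.1 h1)
    have h2 := hM.pair_eq_pair (hM.tag1_inj.1 h2)
    rw [hM.op_inj]
    grind

end GBC

end SetModel

/-- The formula `X ⊆ Y`. -/
def Fml.sub {L : Type} (X Y : ℕ) : Fml L := .all .obj 0 (.neg (.and (.mem 0 X) (.neg (.mem 0 Y))))

theorem ClassModel.sat_sub {L : Type} {M : ClassModel.{u} L} {e : M.Val} {X Y : ℕ} :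
    M.Sat e (.sub X Y) ↔ (e .cls X : M.Cls).1 ⊆ (e .cls Y : M.Cls).1 := by
  have h : ∀ (a : M.Dom .obj) i, e.set .obj 0 a .cls i = e .cls i := fun a i =>
    Val.set_of_ne_sort _ _ _ _ (by decide)
  simp only [Fml.sub, Sat, h, Val.set_same, not_and, not_not]
  exact Iff.rfl

namespace SetModel

variable {M : SetModel.{u}} {A : Set M.Obj}

/-! ## Translation of formulas -/

theorem mem_image_uval {x : (uModel M A).Obj} {B : Set (uModel M A).Obj} :
    uval x ∈ uval '' B ↔ x ∈ B :=
  Function.Injective.mem_set_image fun _ _ => uval_inj.1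

theorem uCls_iff {B : Set (uModel M A).Obj} : B ∈ (uModel M A).Cls ↔ uval '' B ∈ M.Cls := Iff.rfl

theorem image_uval_preimage (C : Set M.Obj) :
    uval '' {x : (uModel M A).Obj | uval x ∈ C} = {x | x ∈ UDomain M A ∧ x ∈ C} := by
  ext x
  constructor
  · rintro ⟨x, hx, rfl⟩
    exact ⟨uval_mem x, hx⟩
  · rintro ⟨hD, hx⟩
    exact ⟨umk x hD, hx, rfl⟩

theorem GBC.preimage_mem_uCls (hM : GBC M) (hA : A ∈ M.Cls) {C : Set M.Obj} (hC : C ∈ M.Cls) :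
    {x : (uModel M A).Obj | uval x ∈ C} ∈ (uModel M A).Cls := by
  rw [uCls_iff, image_uval_preimage]
  exact hM.comp fun Γ W x hx => .and (.memS (hM.uDomain_mem_cls hA) hx rfl) (.memS hC hx rfl)

/-- The valuation `e'` of `M` codes the valuation `e` of the urelement model; its odd class variables
hold the parameters of the translation. -/
structure Codes (hM : GBC M) (e : (uModel M A).Val) (e' : M.Val) : Prop where
  obj : ∀ i, e' .obj i = uval (e .obj i)
  cls : ∀ i, (e' .cls (2 * i) : M.Cls).1 = uval '' (e .cls i : (uModel M A).Cls).1
  dom : (e' .cls 1 : M.Cls).1 = UDomain M A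
  graph : (e' .cls 3 : M.Cls).1 = hM.checkGraph
  par : (e' .cls 5 : M.Cls).1 = A

namespace Codes

theorem set_obj {hM : GBC M} {e : (uModel M A).Val} {e' : M.Val} (h : Codes hM e e') (n : ℕ)
    (a : (uModel M A).Obj) : Codes hM (e.set .obj n a) (e'.set .obj n (uval a)) := by
  have h' : ∀ i, e'.set .obj n (uval a) .cls i = e' .cls i := fun i =>
    Val.set_of_ne_sort _ _ _ _ (by decide)
  have h'' : ∀ i, e.set .obj n a .cls i = e .cls i := fun i =>
    Val.set_of_ne_sort _ _ _ _ (by decide)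
  refine ⟨fun i => ?_, fun i => ?_, ?_, ?_, ?_⟩
  · by_cases hi : i = n
    · subst hi
      exact (Val.set_same _ _ _ _).trans (congrArg uval (Val.set_same _ _ _ _)).symm
    · exact (Val.set_of_ne_index _ _ _ _ hi).trans ((h.obj i).trans
        (congrArg uval (Val.set_of_ne_index _ _ _ _ hi)).symm)
  · rw [h', h'', h.cls]
  · rw [h', h.dom]
  · rw [h', h.graph]
  · rw [h', h.par]

theorem set_cls {hM : GBC M} {e : (uModel M A).Val} {e' : M.Val} (h : Codes hM e e') (n : ℕ)
    {X : (uModel M A).Dom .cls} {X' : M.Dom .cls}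
    (hX : (X' : M.Cls).1 = uval '' (X : (uModel M A).Cls).1) :
    Codes hM (e.set .cls n X) (e'.set .cls (2 * n) X') := by
  refine ⟨fun i => ?_, fun i => ?_, ?_, ?_, ?_⟩
  · exact (Val.set_of_ne_sort _ _ _ _ (by decide)).trans ((h.obj i).trans
      (congrArg uval (Val.set_of_ne_sort _ _ _ _ (by decide))).symm)
  · by_cases hi : i = n
    · subst hi
      rw [Val.set_same, Val.set_same, hX]
    · rw [Val.set_of_ne_index _ _ _ _ (by omega), Val.set_of_ne_index _ _ _ _ hi, h.cls]
  · rw [Val.set_of_ne_index _ _ _ _ (by omega), h.dom]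
  · rw [Val.set_of_ne_index _ _ _ _ (by omega), h.graph]
  · rw [Val.set_of_ne_index _ _ _ _ (by omega), h.par]

end Codes

namespace GBC

theorem exists_codes (hM : GBC M) (hA : A ∈ M.Cls) (e : (uModel M A).Val) :
    ∃ e', Codes hM e e' := by
  refine ⟨fun σ => match σ with
    | .obj => fun i => uval (e .obj i)
    -- The final default `A` serves variable `5` and, harmlessly, the unused odd variables.
    | .cls => fun i => if i % 2 = 0 then
        (⟨uval '' (e .cls (i / 2) : (uModel M A).Cls).1, (e .cls (i / 2) : (uModel M A).Cls).2⟩ : M.Cls)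
        else if i = 1 then (⟨_, hM.uDomain_mem_cls hA⟩ : M.Cls)
        else if i = 3 then (⟨_, hM.checkGraph_mem⟩ : M.Cls) else (⟨A, hA⟩ : M.Cls),
    fun _ => rfl, fun i => ?_, rfl, rfl, rfl⟩
  simp

/-- Every formula about the urelement model has a translation, first-order if the formula is. -/
theorem exists_translation (hM : GBC M) (φ : Fml USymb) :
    ∃ ψ : Fml SetSymb, (φ.IsFirstOrder → ψ.IsFirstOrder) ∧
      ∀ (e : (uModel M A).Val) (e' : M.Val), Codes hM e e' →
        (M.Sat e' ψ ↔ (uModel M A).Sat e φ) := by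
  induction φ with
  | rel r x z =>
    cases r with
    | mem =>
      -- The two class slots are dummies that fill up the four variables of `Ex.exists_formula_at`.
      obtain ⟨ψ, hψ, H⟩ := Ex.exists_formula_at (M := M) (fo := true) (σ₁ := .obj) (σ₂ := .obj)
        (σ₃ := .cls) (σ₄ := .cls)
        (D := fun x z _ _ => ∃ y, IsTagOne M y z ∧ E M x y) (ex_uMem .v3 .v2) x z 0 0
      refine ⟨ψ, fun _ => hψ rfl, fun e e' h => ?_⟩
      rw [H, h.obj, h.obj]
      rfl
    | enum =>
      obtain ⟨ψ, hψ, H⟩ := Ex.exists_formula_at (M := M) (fo := true) (σ₁ := .obj) (σ₂ := .obj)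
        (σ₃ := .cls) (σ₄ := .cls)
        (D := fun i x (F A : M.Cls) => ∃ a, a ∈ A.1 ∧
          (∃ p, p ∈ F.1 ∧ IsOPair (E M) (NoAtom M) a i p) ∧ IsTagZero M a x)
        (.exO (.and (.memC .v0 .v1) (.and
          (.exO (.and (.memC .v0 .v3) (ex_isOPair .v1 .v5 .v0))) (ex_isTagZero .v0 .v3)))) x z 3 5
      refine ⟨ψ, fun _ => hψ rfl, fun e e' h => ?_⟩
      rw [H, h.obj, h.obj, h.graph, h.par]
      refine Iff.trans ?_ (hM.enum_iff (i := e .obj x) (x := e .obj z)).symm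
      simp only [hM.isOPair_iff, hM.isTagZero_iff, exists_eq_right, hM.op_mem_checkGraph]
  | eq x y =>
    refine ⟨.eq x y, id, fun e e' h => ?_⟩
    rw [Sat, Sat, h.obj, h.obj]
    exact uval_inj
  | mem x X =>
    refine ⟨.mem x (2 * X), id, fun e e' h => ?_⟩
    rw [Sat, Sat, h.obj, h.cls]
    exact mem_image_uval
  | neg φ ih =>
    obtain ⟨ψ, hψ, H⟩ := ih
    exact ⟨.neg ψ, hψ, fun e e' h => not_congr (H e e' h)⟩
  | and φ φ' ih ih' =>
    obtain ⟨ψ, hψ, H⟩ := ih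
    obtain ⟨ψ', hψ', H'⟩ := ih'
    exact ⟨.and ψ ψ', And.imp hψ hψ', fun e e' h => and_congr (H e e' h) (H' e e' h)⟩
  | all σ n φ ih =>
    obtain ⟨ψ, hψ, H⟩ := ih
    cases σ with
    | obj =>
      -- Object quantifiers are relativized to the domain, which class variable `1` holds.
      refine ⟨.all .obj n (.neg (.and (.mem n 1) (.neg ψ))),
        fun h => ⟨rfl, trivial, hψ h.2⟩, fun e e' h => ?_⟩
      have h' : ∀ (a : M.Dom .obj) i, e'.set .obj n a .cls i = e' .cls i := fun a i =>
        Val.set_of_ne_sort _ _ _ _ (by decide)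
      simp only [Sat, not_and, not_not, h', h.dom, Val.set_same]
      exact ⟨fun hS a => (H _ _ (h.set_obj n a)).1 (hS _ (uval_mem a)),
        fun hS a ha => (H _ _ (h.set_obj n (umk a ha))).2 (hS _)⟩
    | cls =>
      -- Class quantifiers are relativized to subclasses of the domain, which are exactly the images
      -- of the classes of the model. `.sub` has only an object quantifier.
      refine ⟨.all .cls (2 * n) (.neg (.and (.sub (2 * n) 1) (.neg ψ))),
        fun h => absurd h.1 (by decide), fun e e' h => ?_⟩
      have h' : ∀ X : M.Dom .cls, e'.set .cls (2 * n) X .cls 1 = e' .cls 1 := fun X =>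
        Val.set_of_ne_index _ _ _ _ (by omega)
      simp only [Sat, not_and, not_not, sat_sub, h', h.dom, Val.set_same]
      refine ⟨fun hS X => (H _ _ (h.set_cls n (X' := ⟨_, X.2⟩) rfl)).1 (hS _ ?_),
        fun hS X hX => ?_⟩
      · rintro _ ⟨x, -, rfl⟩
        exact uval_mem x
      · have hX' : X.1 = uval '' {x : (uModel M A).Obj | uval x ∈ X.1} := by
          rw [image_uval_preimage]
          ext x
          exact ⟨fun hx => ⟨hX hx, hx⟩, And.right⟩
        exact (H _ _ (h.set_cls n (X := ⟨_, uCls_iff.2 (hX' ▸ X.2)⟩) hX')).2 (hS _)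

/-! ## The axioms of the urelement model -/

theorem separation_uModel (hM : GBC M) (hA : A ∈ M.Cls) :
    ClassModel.Separation (uModel M A) (UModel.E (uModel M A)) (UModel.Atom (uModel M A)) := by
  intro φ hφ e x
  rcases hM.uModel_cases hA x with ⟨-, hx⟩ | ⟨-, x', -, hx', Hx⟩
  · obtain ⟨s, hs, H⟩ := hM.exists_uset hA hM.emp
    exact ⟨s, hs, fun z => by simp [H, hx, hM.not_mem_emp]⟩
  · obtain ⟨ψ, hψ, hS⟩ := hM.exists_translation (A := A) φ
    obtain ⟨e', he⟩ := hM.exists_codes hA e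
    obtain ⟨y, -, hy⟩ := hM.separation ψ (hψ hφ) e' x'
    obtain ⟨s, hs, H⟩ := hM.exists_uset hA y
    refine ⟨s, hs, fun z => ?_⟩
    rw [H, Hx, ← hS _ _ (he.set_obj 0 z)]
    exact hy (uval z)

theorem collection_uModel (hM : GBC M) (hA : A ∈ M.Cls) :
    ClassModel.Collection (uModel M A) (UModel.E (uModel M A)) (UModel.Atom (uModel M A)) := by
  intro φ hφ e x hx
  rcases hM.uModel_cases hA x with ⟨-, hx⟩ | ⟨-, x', -, hx', Hx⟩
  · obtain ⟨s, hs, H⟩ := hM.exists_uset hA hM.emp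
    exact ⟨s, hs, fun a ha => (hx a ha).elim⟩
  · obtain ⟨ψ, hψ, hS⟩ := hM.exists_translation (A := A) φ
    obtain ⟨e', he⟩ := hM.exists_codes hA e
    -- Collection in `M` could supply witnesses outside the domain. In `.mem 1 1`, the object
    -- variable `1` is the witness and the class variable `1` the domain.
    have hb : ∀ a b : M.Dom .obj, M.Sat ((e'.set .obj 0 a).set .obj 1 b) (.and ψ (.mem 1 1)) ↔
        M.Sat ((e'.set .obj 0 a).set .obj 1 b) ψ ∧ (b : M.Obj) ∈ UDomain M A :=
      fun a b => by
      rw [← he.dom, Sat, Sat, Val.set_same, Val.set_of_ne_sort _ _ _ _ (by decide),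
        Val.set_of_ne_sort _ _ _ _ (by decide)]
    obtain ⟨y, -, hy⟩ := hM.collection (.and ψ (.mem 1 1)) ⟨hψ hφ, trivial⟩ e' x' (by
      intro a ha
      obtain ⟨b, hb'⟩ := hx (umk a (hx' a ha)) ((Hx _).2 ha)
      exact ⟨uval b, (hb _ _).2 ⟨(hS _ _ ((he.set_obj 0 (umk a (hx' a ha))).set_obj 1 b)).2 hb',
        uval_mem b⟩⟩)
    obtain ⟨s, hs, H⟩ := hM.exists_uset hA y
    refine ⟨s, hs, fun a ha => ?_⟩
    obtain ⟨b, hby, hbS⟩ := hy (uval a) ((Hx a).1 ha)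
    obtain ⟨hb1, hb2⟩ := (hb _ _).1 hbS
    exact ⟨umk b hb2, (H _).2 hby, (hS _ _ ((he.set_obj 0 a).set_obj 1 (umk b hb2))).1 hb1⟩

/-- Serves both comprehension schemes, since the translation keeps first-order formulas first-order.
-/
theorem exists_image_sat (hM : GBC M) (hA : A ∈ M.Cls) (φ : Fml USymb) (e : (uModel M A).Val) :
    ∃ (ψ : Fml SetSymb) (e' : M.Val), (φ.IsFirstOrder → ψ.IsFirstOrder) ∧
      uval '' {a : (uModel M A).Obj | (uModel M A).Sat (e.set .obj 0 a) φ} =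
        {a : M.Obj | M.Sat (e'.set .obj 0 a) ψ} := by
  obtain ⟨ψ, hψ, hS⟩ := hM.exists_translation (A := A) φ
  obtain ⟨e', he⟩ := hM.exists_codes hA e
  refine ⟨.and ψ (.mem 0 1), e', fun h => ⟨hψ h, trivial⟩, ?_⟩
  ext a
  have hb : ∀ a : M.Dom .obj, M.Sat (e'.set .obj 0 a) (.and ψ (.mem 0 1)) ↔
      M.Sat (e'.set .obj 0 a) ψ ∧ (a : M.Obj) ∈ UDomain M A := fun a => by
    rw [← he.dom, Sat, Sat, Val.set_same, Val.set_of_ne_sort _ _ _ _ (by decide)]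
  refine Iff.trans ?_ (hb a).symm
  constructor
  · rintro ⟨a, ha, rfl⟩
    exact ⟨(hS _ _ (he.set_obj 0 a)).2 ha, uval_mem a⟩
  · rintro ⟨ha, haD⟩
    exact ⟨umk a haD, (hS _ _ (he.set_obj 0 (umk a haD))).1 ha, rfl⟩

theorem comprehension_uModel (hM : GBC M) (hA : A ∈ M.Cls) :
    ClassModel.FirstOrderComprehension (uModel M A) := by
  intro φ hφ e
  obtain ⟨ψ, e', hψ, h⟩ := hM.exists_image_sat hA φ e
  rw [uCls_iff, h]
  exact hM.comprehension ψ (hψ hφ) e'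

theorem secondOrderComprehension_uModel (hM : GBC M) (hA : A ∈ M.Cls)
    (hK : ClassModel.SecondOrderComprehension M) :
    ClassModel.SecondOrderComprehension (uModel M A) := by
  intro φ e
  obtain ⟨ψ, e', -, h⟩ := hM.exists_image_sat hA φ e
  rw [uCls_iff, h]
  exact hK ψ e'

/-- The well-order of `M` restricts to the domain; only its pairs have to be recoded as pairs of the
model. -/
theorem globalWellOrder_uModel (hM : GBC M) (hA : A ∈ M.Cls) :
    ClassModel.GlobalWellOrder (uModel M A) (UModel.E (uModel M A))
      (UModel.Atom (uModel M A)) := by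
  obtain ⟨R, hR, lt, hlt, hirr, htrans, htot, hwf⟩ := hM.globalWellOrder
  have hD := hM.uDomain_mem_cls hA
  refine ⟨{p | ∃ x y, IsOPair (UModel.E (uModel M A)) (UModel.Atom (uModel M A)) x y p ∧
    lt (uval x) (uval y)}, ?_, fun x y => lt (uval x) (uval y), fun p => Iff.rfl,
    fun x => hirr _, fun x y z => htrans _ _ _, fun x y => ?_, fun X hX hne => ?_⟩
  · rw [uCls_iff]
    have : uval '' {p : (uModel M A).Obj | ∃ x y, IsOPair (UModel.E (uModel M A))
        (UModel.Atom (uModel M A)) x y p ∧ lt (uval x) (uval y)} =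
        {p | ∃ x, x ∈ UDomain M A ∧ ∃ y, y ∈ UDomain M A ∧ IsUModelPair M x y p ∧
          ∃ q, q ∈ R ∧ IsOPair (E M) (NoAtom M) x y q} := by
      ext p
      have hlt' : ∀ x y, (∃ q, q ∈ R ∧ IsOPair (E M) (NoAtom M) x y q) ↔ lt x y := by
        intro x y
        constructor
        · rintro ⟨q, hq, hxy⟩
          obtain ⟨x', y', hq', h⟩ := (hlt q).1 hq
          obtain ⟨rfl, rfl⟩ := hM.op_inj.1 ((hM.isOPair_iff.1 hxy).symm.trans (hM.isOPair_iff.1 hq'))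
          exact h
        · exact fun h => ⟨_, (hlt _).2 ⟨x, y, hM.isOPair_iff.2 rfl, h⟩, hM.isOPair_iff.2 rfl⟩
      simp only [hlt', hM.isUModelPair_iff, hM.isOPair_uModel hA]
      constructor
      · rintro ⟨p, ⟨x, y, hp, h⟩, rfl⟩
        exact ⟨_, uval_mem x, _, uval_mem y, hp, h⟩
      · rintro ⟨x, hx, y, hy, rfl, h⟩
        exact ⟨umk _ (hM.uop_mem hx hy), ⟨umk x hx, umk y hy, rfl, h⟩, rfl⟩
    rw [this]
    refine hM.comp ?_
    intro Γ W x hx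
    repeat' first | assumption | apply ex_isOPair | apply ex_isUModelPair | constructor
  · rw [← uval_inj]
    exact htot _ _
  · obtain ⟨_, ⟨x, hx, rfl⟩, hmin⟩ := hwf _ (uCls_iff.1 hX) (hne.image _)
    exact ⟨x, hx, fun y hy => hmin _ ⟨y, hy, rfl⟩⟩

theorem gbAxioms_uModel (hM : GBC M) (hA : A ∈ M.Cls) :
    ClassModel.GBAxioms (uModel M A) (UModel.E (uModel M A)) (UModel.Atom (uModel M A)) :=
  ⟨hM.zfcuAxioms_uModel hA, hM.separation_uModel hA, hM.collection_uModel hA,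
    hM.comprehension_uModel hA, hM.globalWellOrder_uModel hA⟩

/-- From left to right this is a collapse, by induction inside a transitive set without atoms.
Conversely, a transitive set around `u` has a copy that witnesses purity. -/
theorem isPure_iff (hM : GBC M) (hA : A ∈ M.Cls) {x : (uModel M A).Obj} :
    IsPure (UModel.E (uModel M A)) (UModel.Atom (uModel M A)) x ↔ ∃ u, x = hM.ucheck hA u := by
  constructor
  · rintro ⟨t, -, hxt, htr, hat⟩
    obtain ⟨t', et, ht', Ht⟩ := (hM.uModel_cases hA t).elim (fun h => (h.2 x hxt).elim) And.right
    have hc := hM.ex_check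
    have key := hM.uModel_induction hA (X := {z | E M z t' → ∃ u, z = hM.check u}) (hM.comp (by
      intro Γ W x hx
      repeat' first | assumption | apply hc | constructor)) (fun z ih hz => ?_) x ((Ht x).1 hxt)
    · obtain ⟨u, hu⟩ := key
      exact ⟨u, uval_inj.1 hu⟩
    · have hz := (Ht z).2 hz
      obtain ⟨z', ez, hz', Hz⟩ := hM.uModel_set hA (hat z hz)
      -- `u` consists of the preimages of the elements of `z`, all of which are copies by the
      -- inductive hypothesis.
      obtain ⟨u, hu⟩ := hM.repl (D := fun w v => w = hM.check v) (fun Γ W x y hx hy => hc hy hx) z'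
        (fun w _ v v' h h' => hM.check_inj.1 (h.symm.trans h'))
      obtain ⟨y, hy, e⟩ := hM.exists_check_eq u
      refine ⟨u, ?_⟩
      rw [ez, e, hM.tag1_inj]
      refine hM.ext fun w => ?_
      simp only [hy, hu]
      constructor
      · intro hw
        have hw' := (Hz (umk w (hz' w hw))).2 hw
        obtain ⟨v, hv⟩ := ih _ hw' ((Ht _).1 (htr z hz _ hw'))
        exact ⟨v, ⟨w, hw, hv⟩, hv⟩
      · rintro ⟨v, ⟨w', hw, rfl⟩, rfl⟩
        exact hw
  · rintro ⟨u, rfl⟩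
    obtain ⟨t, hut, htr⟩ := hM.exists_transitive u
    refine ⟨hM.ucheck hA t, hM.not_atom_ucheck hA t, (hM.ucheck_uE_ucheck_iff hA).2 hut, ?_, ?_⟩
    · intro y hy z hz
      obtain ⟨v, hv, rfl⟩ := (hM.uE_ucheck_iff hA).1 hy
      obtain ⟨w, hw, rfl⟩ := (hM.uE_ucheck_iff hA).1 hz
      exact (hM.ucheck_uE_ucheck_iff hA).2 (htr v hv w hw)
    · intro y hy
      obtain ⟨v, hv, rfl⟩ := (hM.uE_ucheck_iff hA).1 hy
      exact hM.not_atom_ucheck hA v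

theorem gbcu_uModel (hM : GBC M) (hA : A ∈ M.Cls) : UModel.GBCU (uModel M A) where
  axioms := hM.gbAxioms_uModel hA
  enum_pure i a h := by
    obtain ⟨b, -, hi, -⟩ := hM.enum_iff.1 h
    exact (hM.isPure_iff hA).2 ⟨b, uval_inj.1 hi⟩
  enum_functional i a b ha hb := by
    obtain ⟨c, -, hc, hca⟩ := hM.enum_iff.1 ha
    obtain ⟨d, -, hd, hdb⟩ := hM.enum_iff.1 hb
    rw [← uval_inj, hca, hdb, hM.check_inj.1 (hc.symm.trans hd)]
  enum_injective i j a hi hj := by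
    obtain ⟨c, -, hc, hca⟩ := hM.enum_iff.1 hi
    obtain ⟨d, -, hd, hdb⟩ := hM.enum_iff.1 hj
    rw [← uval_inj, hc, hd, hM.tag0_inj.1 (hca.symm.trans hdb)]

theorem mem_hat_iff (hM : GBC M) {i : (uModel M A).Obj} :
    i ∈ hat M A ↔ ∃ a ∈ A, uval i = hM.check a := by
  simp only [← hM.isCheck_iff]
  exact Iff.rfl

theorem manyAtoms_uModel (hM : GBC M) (hA : A ∈ M.Cls) :
    UModel.ManyAtoms (uModel M A) (hat M A) := by
  have hU := hM.gbcu_uModel hA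
  have hc := hM.ex_check
  refine ⟨?_, fun i hi => ?_, fun i a h => ?_, fun i hi => ?_, fun a ha => ?_⟩
  · have : hat M A = {i : (uModel M A).Obj | uval i ∈ {x | ∃ a, a ∈ A ∧ x = hM.check a}} := by
      ext i
      exact hM.mem_hat_iff
    rw [this]
    refine hM.preimage_mem_uCls hA (hM.comp ?_)
    intro Γ W x hx
    repeat' first | assumption | apply hc | constructor
  · obtain ⟨a, -, h⟩ := hM.mem_hat_iff.1 hi
    exact (hM.isPure_iff hA).2 ⟨a, uval_inj.1 h⟩
  · obtain ⟨b, hb, hi, -⟩ := hM.enum_iff.1 h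
    exact hM.mem_hat_iff.2 ⟨b, hb, hi⟩
  · obtain ⟨a, ha, h⟩ := hM.mem_hat_iff.1 hi
    have : UModel.Enum (uModel M A) i (umk _ (hM.tag0_mem_uDomain ha)) :=
      hM.enum_iff.2 ⟨a, ha, h, rfl⟩
    exact ⟨_, this, fun b hb => hU.enum_functional i b _ hb this⟩
  · obtain ⟨i, hi⟩ := ha
    exact ⟨i, hi, fun j hj => hU.enum_injective j i a hj hi⟩

/-- Class choice of `M` is applied to the translation together with the demand that the chosen class
lie in the domain. Class variable `0` stands for itself, being `2 * 0`. -/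
theorem cc_uModel (hM : GBC M) (hA : A ∈ M.Cls) (hC : CC M) : UModel.CC (uModel M A) := by
  intro φ e I hI hex
  obtain ⟨ψ, -, hS⟩ := hM.exists_translation (A := A) φ
  obtain ⟨e', he⟩ := hM.exists_codes hA e
  have hD := hM.uDomain_mem_cls hA
  have hsub : ∀ (i : M.Dom .obj) (X : M.Dom .cls),
      M.Sat ((e'.set .obj 0 i).set .cls 0 X) (.and (.sub 0 1) ψ) ↔
        (X : M.Cls).1 ⊆ UDomain M A ∧ M.Sat ((e'.set .obj 0 i).set .cls 0 X) ψ := fun i X => by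
    rw [← he.dom, Sat, sat_sub, Val.set_same, Val.set_of_ne_index _ _ _ _ (by decide),
      Val.set_of_ne_sort _ _ _ _ (by decide)]
  obtain ⟨Y, hY, hYI, H⟩ := hC (.and (.sub 0 1) ψ) e' _ (uCls_iff.1 hI) (by
    rintro _ ⟨i, hi, rfl⟩
    obtain ⟨X, hX⟩ := hex i hi
    refine ⟨⟨_, uCls_iff.1 X.2⟩, (hsub _ _).2 ⟨?_,
      (hS _ _ ((he.set_obj 0 i).set_cls 0 rfl)).2 hX⟩⟩
    rintro _ ⟨x, -, rfl⟩
    exact uval_mem x)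
  simp only [hM.isOPair_iff, exists_eq_right] at hYI H
  -- The pairs in `Y` are Kuratowski pairs of `M`, generally outside V⟦A⟧; they are replaced by
  -- pairs of the urelement model.
  have hYN : {p : M.Obj | ∃ i x, (∃ q, q ∈ Y ∧ IsOPair (E M) (NoAtom M) i x q) ∧
      x ∈ UDomain M A ∧ IsUModelPair M i x p} ∈ M.Cls := by
    refine hM.comp ?_
    intro Γ W x hx
    repeat' first | assumption | apply ex_isOPair | apply ex_isUModelPair | constructor
  refine ⟨_, hM.preimage_mem_uCls hA hYN, fun p hp => ?_, fun i hi => ?_⟩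
  · simp only [hM.isOPair_iff, exists_eq_right, hM.isUModelPair_iff] at hp
    obtain ⟨i, x, hY, hx, hp⟩ := hp
    obtain ⟨j, ⟨j, hj, rfl⟩, x', h⟩ := hYI _ hY
    obtain ⟨rfl, rfl⟩ := hM.op_inj.1 h
    exact ⟨j, hj, umk x hx, (hM.isOPair_uModel hA).2 hp⟩
  · obtain ⟨X, hX, hXS⟩ := H _ ⟨i, hi, rfl⟩
    obtain ⟨hXD, hXS⟩ := (hsub _ _).1 hXS
    have hXi : X.1 = uval '' {x : (uModel M A).Obj | uval x ∈ X.1} := by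
      rw [image_uval_preimage]
      ext x
      exact ⟨fun hx => ⟨hXD hx, hx⟩, And.right⟩
    refine ⟨⟨{x | uval x ∈ X.1}, hM.preimage_mem_uCls hA X.2⟩, ?_,
      (hS _ _ ((he.set_obj 0 i).set_cls 0 hXi)).1 hXS⟩
    ext x
    simp only [hX, hM.isOPair_iff, exists_eq_right, hM.isUModelPair_iff, hM.isOPair_uModel hA]
    constructor
    · intro hx
      exact ⟨umk _ (hM.uop_mem (uval_mem i) (uval_mem x)), ⟨_, _, hx, uval_mem x, rfl⟩, rfl⟩
    · rintro ⟨p, ⟨j, y, hY, -, hp⟩, hp'⟩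
      obtain ⟨rfl, rfl⟩ := hM.uop_inj.1 (hp.symm.trans hp')
      exact hY

end GBC

end SetModel

/-! ### Interpretations by single elements with at most one parameter -/

namespace ClassModel

variable {L L' : Type} {M : ClassModel.{u} L} {N : ClassModel.{u} L'}

/-- A relation definable from at most one class parameter, semantically. -/
def Definable₂ {m : ℕ} (P : Fin m → M.Cls) (σ τ : Srt) (D : M.Dom σ → M.Dom τ → Prop) : Prop :=
  ∃ R : M.Dom σ → M.Dom τ → M.Cls → Prop,
    Ex false false (((((Vars.nil M).ext .cls).ext σ).ext τ).ext .cls) (fun p => R p.1.1.2 p.1.2 p.2) ∧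
    ∀ X, (∀ j, X = P j) → ∀ a b, D a b ↔ R a b X

/-- Variables `0` and `1` carry the two entries and `2` the parameter; the first class slot of `R`
is a dummy, also sent to `2`. If `m = 0`, the class variable `2` is arbitrary, which is harmless
because the equivalence in `Definable₂` then holds for every class. -/
theorem Definable₂.definable {m : ℕ} {P : Fin m → M.Cls} {σ τ : Srt}
    {D : M.Dom σ → M.Dom τ → Prop} (h : Definable₂ P σ τ D) (hm : m ≤ 1) {ι : Type} {s : ι → Srt}
    (i j : ι) (hij : i ≠ j) (hι : ∀ k, k = i ∨ k = j) (hi : s i = σ) (hj : s j = τ)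
    {D' : ((k : ι) → M.Dom (s k)) → Prop} (hD : ∀ t, D' t ↔ D (hi ▸ t i) (hj ▸ t j)) :
    M.Definable P s D' := by
  classical
  subst hi hj
  obtain ⟨R, hR, H⟩ := h
  obtain ⟨φ, -, hφ⟩ := Ex.exists_formula_at (σ₁ := .cls) (σ₂ := s i) (σ₃ := s j) (σ₄ := .cls)
    (D := fun _ a b X => R a b X) hR 2 0 1 2
  refine ⟨φ, ⟨Sum.elim (fun k => if k = i then 0 else 1) (fun k => 2 + k), ?_⟩, fun e he => ?_⟩
  · rintro (k | k) (l | l) h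
    · rcases hι k with rfl | rfl <;> rcases hι l with rfl | rfl <;>
        simp_all [Ne.symm hij]
    · simp only [Sum.elim_inl, Sum.elim_inr] at h
      split_ifs at h <;> omega
    · simp only [Sum.elim_inl, Sum.elim_inr] at h
      split_ifs at h <;> omega
    · simp only [Sum.elim_inr] at h
      congr 1
      omega
  · rw [hφ, hD, H (e .cls 2) (fun k => ?_)]
    · change _ ↔ R (e _ (if i = i then 0 else 1)) (e _ (if j = i then 0 else 1)) _
      rw [if_pos rfl, if_neg hij.symm]
    · have hk : (k : ℕ) = 0 := by omega
      rw [← he k]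
      change e .cls 2 = e .cls (2 + k)
      rw [hk]

/-- A relation definable without parameters. -/
theorem Definable₂.of_ex {m : ℕ} {P : Fin m → M.Cls} {σ τ : Srt} {D : M.Dom σ → M.Dom τ → Prop}
    (h : Ex false false (((((Vars.nil M).ext .cls).ext σ).ext τ).ext .cls)
      fun p => D p.1.1.2 p.1.2) : Definable₂ P σ τ D :=
  ⟨fun a b _ => D a b, h, fun _ _ _ _ => Iff.rfl⟩

theorem Definable₂.congr {m : ℕ} {P : Fin m → M.Cls} {σ τ : Srt} {D D' : M.Dom σ → M.Dom τ → Prop}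
    (h : Definable₂ P σ τ D) (H : ∀ a b, D' a b ↔ D a b) : Definable₂ P σ τ D' := by
  rwa [show D' = D from funext fun a => funext fun b => propext (H a b)]

/-- An interpretation in which every element is represented by a single element of the same sort. -/
def Interpretation.ofRel {m : ℕ} {P : Fin m → M.Cls} (hm : m ≤ 1)
    (R : (σ : Srt) → M.Dom σ → N.Dom σ → Prop)
    (functional : ∀ σ t x y, R σ t x → R σ t y → x = y) (surjective : ∀ σ x, ∃ t, R σ t x)
    (heq : ∀ σ, Definable₂ P σ σ fun a b => ∃ x, R σ a x ∧ R σ b x)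
    (hrel : ∀ r : L', Definable₂ P .obj .obj fun a b =>
      ∃ x y : N.Obj, R .obj a x ∧ R .obj b y ∧ N.rel r x y)
    (hmem : Definable₂ P .obj .cls fun a b =>
      ∃ (x : N.Obj) (X : N.Cls), R .obj a x ∧ R .cls b X ∧ x ∈ X.1) : Interpretation M P N where
  dim _ := 1
  shape σ _ := σ
  rep σ t x := R σ (t 0) x
  functional σ _ _ _ := functional σ _ _ _
  surjective σ x := (surjective σ x).imp' (fun a _ => a) fun _ h => h
  definable_eq σ := (heq σ).definable hm (.inl 0) (.inr 0) (by simp)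
    (by rintro (k | k) <;> simp [Subsingleton.elim k 0]) rfl rfl fun _ => Iff.rfl
  definable_rel r := (hrel r).definable hm (.inl 0) (.inr 0) (by simp)
    (by rintro (k | k) <;> simp [Subsingleton.elim k 0]) rfl rfl fun _ => Iff.rfl
  definable_mem := hmem.definable hm (.inl 0) (.inr 0) (by simp)
    (by rintro (k | k) <;> simp [Subsingleton.elim k 0]) rfl rfl fun _ => Iff.rfl

/-- For tuples of length one, the return relation is the composition of `R` and `R'`. -/
theorem Interpretation.definableReturn_ofRel {m : ℕ} {P : Fin m → M.Cls} (hm : m ≤ 1)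
    {R : (σ : Srt) → M.Dom σ → N.Dom σ → Prop} {hf hs heq hrel hmem}
    {k : ℕ} {Q : Fin k → N.Cls} {hk : k ≤ 1}
    {R' : (σ : Srt) → N.Dom σ → M.Dom σ → Prop} {hf' hs' heq' hrel' hmem'}
    (h : ∀ σ, Definable₂ P σ σ fun a b => ∃ y, R σ a y ∧ R' σ y b) :
    (Interpretation.ofRel (P := P) hm R hf hs heq hrel hmem).DefinableReturn
      (Interpretation.ofRel (P := Q) hk R' hf' hs' heq' hrel' hmem') := by
  intro σ
  change M.Definable P (ι := ((_ : Fin 1) × Fin 1) ⊕ Unit) (Sum.elim (fun _ => σ) (fun _ => σ))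
    (fun t => ∃ y : Fin 1 → N.Dom σ, (∀ i : Fin 1, R σ (t (.inl ⟨i, 0⟩)) (y i)) ∧
      R' σ (y 0) (t (.inr ())))
  refine (h σ).definable hm (.inl ⟨0, 0⟩) (.inr ()) (by simp) ?_ rfl rfl fun t => ?_
  · rintro (⟨k, l⟩ | k)
    · exact .inl (by rw [Subsingleton.elim k 0, Subsingleton.elim l 0])
    · exact .inr rfl
  · constructor
    · rintro ⟨y, h1, h2⟩
      exact ⟨y 0, h1 0, h2⟩
    · rintro ⟨y, h1, h2⟩
      refine ⟨fun _ => y, fun i => ?_, h2⟩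
      obtain rfl : i = 0 := Subsingleton.elim _ _
      exact h1

end ClassModel

namespace SetModel

variable {M : SetModel.{u}} {A : Set M.Obj}

/-! ## The interpretation of the urelement model -/

/-- Interpretations may use class quantifiers but no hidden constants, so the definition of the
smallest class is expressed literally, with `A` as a variable. -/
theorem ex_uDomain {Γ : Type u} {W : Vars M Γ} {x : Γ → M.Obj} {X : Γ → M.Cls}
    (hx : Tm false W .obj x) (hX : Tm false W .cls X) :
    Ex false false W fun g => x g ∈ UDomain M (X g).1 := by
  refine Ex.congr (D := fun g => ∀ C : M.Cls, ((∀ a, a ∈ (X g).1 → ∀ x, IsTagZero M a x → x ∈ C.1) ∧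
    ∀ y, (∀ v, E M v y → v ∈ C.1) → ∀ x, IsTagOne M y x → x ∈ C.1) → x g ∈ C.1) ?_ fun g =>
    ⟨fun h C => h C.1 C.2, fun h C hC => h ⟨C, hC⟩⟩
  repeat' first | assumption | apply ex_isTagZero | apply ex_isTagOne | constructor

/-- The class `G` of pairs is a partial solution of the recursion that defines the check map. -/
def IsCheckAttempt (M : SetModel.{u}) (G : Set M.Obj) : Prop :=
  ∀ p, p ∈ G → ∃ u x, IsOPair (E M) (NoAtom M) u x p ∧ ∃ y, IsTagOne M y x ∧
    (∀ v, E M v u → ∃ w, E M w y ∧ ∃ q, q ∈ G ∧ IsOPair (E M) (NoAtom M) v w q) ∧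
    ∀ w, E M w y → ∃ v, E M v u ∧ ∃ q, q ∈ G ∧ IsOPair (E M) (NoAtom M) v w q

/-- An attempt with a value at `u` has values at all elements of `u`, so induction on `u` pins its
values down; being single-valued need not be assumed. -/
theorem GBC.eq_check_of_isCheckAttempt (hM : GBC M) {G : Set M.Obj} (hGc : G ∈ M.Cls)
    (hG : IsCheckAttempt M G) {u x : M.Obj} (h : hM.op u x ∈ G) : x = hM.check u := by
  have hc := hM.ex_check
  refine hM.induction (X := {u | ∀ x p, IsOPair (E M) (NoAtom M) u x p → p ∈ G → x = hM.check u})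
    (hM.comp ?_) ?_ u x _ (hM.isOPair_iff.2 rfl) h
  · intro Γ W x hx
    repeat' first | assumption | apply ex_isOPair | apply hc | constructor
  · simp only [IsCheckAttempt, hM.isOPair_iff, exists_eq_right, hM.isTagOne_iff] at hG ⊢
    rintro u ih x _ rfl hp
    obtain ⟨u', x', hp', y, rfl, h1, h2⟩ := hG _ hp
    obtain ⟨rfl, rfl⟩ := hM.op_inj.1 hp'
    obtain ⟨y', hy', e⟩ := hM.exists_check_eq u
    rw [e, hM.tag1_inj]
    refine hM.ext fun w => ?_
    rw [hy']
    constructor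
    · intro hw
      obtain ⟨v, hv, hvw⟩ := h2 w hw
      exact ⟨v, hv, ih v hv w _ rfl hvw⟩
    · rintro ⟨v, hv, rfl⟩
      obtain ⟨w, hw, hvw⟩ := h1 v hv
      rwa [← ih v hv w _ rfl hvw]

theorem GBC.isCheckAttempt_checkGraph (hM : GBC M) : IsCheckAttempt M hM.checkGraph := by
  rintro _ ⟨u, rfl⟩
  obtain ⟨y, hy, e⟩ := hM.exists_check_eq u
  refine ⟨u, _, hM.isOPair_iff.2 rfl, y, hM.isTagOne_iff.2 e, fun v hv => ?_, fun w hw => ?_⟩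
  · exact ⟨_, (hy _).2 ⟨v, hv, rfl⟩, _, ⟨v, rfl⟩, hM.isOPair_iff.2 rfl⟩
  · obtain ⟨v, hv, rfl⟩ := (hy w).1 hw
    exact ⟨v, hv, _, ⟨v, rfl⟩, hM.isOPair_iff.2 rfl⟩

/-- A class quantifier over attempts replaces the graph used as a parameter in `ex_check`; the graph
itself is the witness. -/
theorem GBC.ex_isCheck (hM : GBC M) {Γ : Type u} {W : Vars M Γ} {u x : Γ → M.Obj}
    (hu : Tm false W .obj u) (hx : Tm false W .obj x) :
    Ex false false W fun g => x g = hM.check (u g) := by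
  refine Ex.congr (D := fun g => ∃ G : M.Cls, IsCheckAttempt M G.1 ∧
    ∃ p, p ∈ G.1 ∧ IsOPair (E M) (NoAtom M) (u g) (x g) p) ?_ fun g => ?_
  · unfold IsCheckAttempt
    repeat' first | assumption | apply ex_isOPair | apply ex_isTagOne | constructor
  · simp only [hM.isOPair_iff, exists_eq_right]
    constructor
    · intro h
      exact ⟨⟨_, hM.checkGraph_mem⟩, hM.isCheckAttempt_checkGraph, hM.op_mem_checkGraph.2 h⟩
    · rintro ⟨G, hG, h⟩
      exact hM.eq_check_of_isCheckAttempt G.2 hG h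

/-- An element of the urelement model is represented by itself. -/
def URep (M : SetModel.{u}) (A : Set M.Obj) : (σ : Srt) → M.Dom σ → (uModel M A).Dom σ → Prop
  | .obj => fun (a : M.Obj) x => a = uval x
  | .cls => fun (C : M.Cls) X => C.1 = uval '' X.1

theorem uRep_obj {a : M.Obj} {x : (uModel M A).Obj} : URep M A .obj a x ↔ a = uval x := Iff.rfl

theorem uRep_cls {C : M.Cls} {X : (uModel M A).Cls} : URep M A .cls C X ↔ C.1 = uval '' X.1 :=
  Iff.rfl

theorem exists_uRep_cls {C : M.Cls} (h : C.1 ⊆ UDomain M A) :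
    ∃ X : (uModel M A).Cls, URep M A .cls C X := by
  have hC : C.1 = uval '' {x : (uModel M A).Obj | uval x ∈ C.1} := by
    rw [image_uval_preimage]
    ext x
    exact ⟨fun hx => ⟨h hx, hx⟩, And.right⟩
  exact ⟨⟨_, uCls_iff.2 (hC ▸ C.2)⟩, hC⟩

theorem subset_of_uRep {C : M.Cls} {X : (uModel M A).Cls} (h : URep M A .cls C X) :
    C.1 ⊆ UDomain M A := by
  rw [uRep_cls.1 h]
  rintro _ ⟨x, -, rfl⟩
  exact uval_mem x

/-- The interpretation of the urelement model in `M`. -/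
def GBC.interpretation (hM : GBC M) (hA : A ∈ M.Cls) :
    Interpretation M ![⟨A, hA⟩] (uModel M A) :=
  .ofRel le_rfl (URep M A)
    (by
      rintro (_ | _) t x y h h'
      · exact uval_inj.1 ((uRep_obj.1 h).symm.trans (uRep_obj.1 h'))
      · exact Subtype.ext (Set.image_injective.2 (fun _ _ => uval_inj.1)
          ((uRep_cls.1 h).symm.trans (uRep_cls.1 h'))))
    (by
      rintro (_ | _) x
      · exact ⟨uval x, rfl⟩
      · exact ⟨⟨_, uCls_iff.1 x.2⟩, rfl⟩)
    (by
      rintro (_ | _)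
      · refine ⟨fun a b X => (a : M.Obj) = b ∧ (a : M.Obj) ∈ UDomain M X.1,
          .and (.eq .v2 .v1) (ex_uDomain .v2 .v0), fun X hX a b => ?_⟩
        obtain rfl : X = ⟨A, hA⟩ := hX 0
        constructor
        · rintro ⟨x, hx, hx'⟩
          rw [uRep_obj.1 hx, uRep_obj.1 hx']
          exact ⟨rfl, uval_mem x⟩
        · rintro ⟨rfl, ha⟩
          exact ⟨umk a ha, rfl, rfl⟩
      · refine ⟨fun a b X => ∀ x, (x ∈ (a : M.Cls).1 ↔ x ∈ (b : M.Cls).1) ∧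
          (x ∈ (a : M.Cls).1 → x ∈ UDomain M X.1),
          .allO (.and (.iff (.memC .v0 .v3) (.memC .v0 .v2)) (.imp (.memC .v0 .v3)
            (ex_uDomain .v0 .v1))), fun X hX a b => ?_⟩
        obtain rfl : X = ⟨A, hA⟩ := hX 0
        constructor
        · rintro ⟨x, hx, hx'⟩ z
          refine ⟨?_, fun h => subset_of_uRep hx h⟩
          rw [uRep_cls.1 hx, uRep_cls.1 hx']
        · intro h
          obtain rfl : a = b := Subtype.ext (Set.ext fun x => (h x).1)
          obtain ⟨X, hX⟩ := exists_uRep_cls (C := a) fun x hx => (h x).2 hx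
          exact ⟨X, hX, hX⟩)
    (by
      rintro (_ | _)
      · refine ⟨fun a b X => ((a : M.Obj) ∈ UDomain M X.1 ∧ (b : M.Obj) ∈ UDomain M X.1) ∧
          ∃ y, IsTagOne M y b ∧ E M a y,
          .and (.and (ex_uDomain .v2 .v0) (ex_uDomain .v1 .v0)) (ex_uMem .v2 .v1),
          fun X hX a b => ?_⟩
        obtain rfl : X = ⟨A, hA⟩ := hX 0
        constructor
        · rintro ⟨x, y, rfl, rfl, h⟩
          exact ⟨⟨uval_mem x, uval_mem y⟩, h⟩
        · rintro ⟨⟨ha, hb⟩, h⟩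
          exact ⟨umk a ha, umk b hb, rfl, rfl, h⟩
      · refine ⟨fun i x X => ((i : M.Obj) ∈ UDomain M X.1 ∧ (x : M.Obj) ∈ UDomain M X.1) ∧
          ∃ a, a ∈ X.1 ∧ (i : M.Obj) = hM.check a ∧ IsTagZero M a x,
          .and (.and (ex_uDomain .v2 .v0) (ex_uDomain .v1 .v0))
            (.exO (.and (.memC .v0 .v1) (.and (hM.ex_isCheck .v0 .v3) (ex_isTagZero .v0 .v2)))),
          fun X hX a b => ?_⟩
        obtain rfl : X = ⟨A, hA⟩ := hX 0
        have key : ∀ i x : (uModel M A).Obj, UModel.Enum (uModel M A) i x ↔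
            ∃ a, a ∈ A ∧ uval i = hM.check a ∧ IsTagZero M a (uval x) := fun i x => by
          simp only [hM.isTagZero_iff]
          exact hM.enum_iff
        constructor
        · rintro ⟨x, y, rfl, rfl, h⟩
          exact ⟨⟨uval_mem x, uval_mem y⟩, (key x y).1 h⟩
        · rintro ⟨⟨ha, hb⟩, h⟩
          exact ⟨umk a ha, umk b hb, rfl, rfl, (key (umk a ha) (umk b hb)).2 h⟩)
    (by
      refine ⟨fun a b X => (a : M.Obj) ∈ (b : M.Cls).1 ∧
          ∀ x, x ∈ (b : M.Cls).1 → x ∈ UDomain M X.1,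
          .and (.memC .v2 .v1) (.allO (.imp (.memC .v0 .v2) (ex_uDomain .v0 .v1))),
          fun X hX a b => ?_⟩
      obtain rfl : X = ⟨A, hA⟩ := hX 0
      constructor
      · rintro ⟨x, Y, rfl, hY, hx⟩
        exact ⟨by rw [uRep_cls.1 hY]; exact mem_image_uval.2 hx, fun z hz => subset_of_uRep hY hz⟩
      · rintro ⟨ha, hb⟩
        obtain ⟨Y, hY⟩ := exists_uRep_cls (C := b) hb
        refine ⟨umk a (hb a ha), Y, rfl, hY, ?_⟩
        rw [← mem_image_uval, ← uRep_cls.1 hY]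
        exact ha)

end SetModel

namespace SetModel

variable {M : SetModel.{u}} {A : Set M.Obj}

/-! ## The interpretation of `M` in the urelement model -/

theorem exAt_atom {N : UModel.{u}} {fo par : Bool} : ExAt fo par (UModel.Atom N) :=
  fun _ _ _ hx => .exO (.rel .v0 (.l1 hx))

section

variable {N : UModel.{u}} {fo par : Bool} {Γ : Type u} {W : Vars N Γ}

theorem ex_isOPair_atom {a b c : Γ → N.Obj} (ha : Tm par W .obj a)
    (hb : Tm par W .obj b) (hc : Tm par W .obj c) :
    Ex fo par W fun g => IsOPair (UModel.E N) (UModel.Atom N) (a g) (b g) (c g) :=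
  .isOPair exAt_atom ha hb hc

theorem ex_isUPair_atom {a b c : Γ → N.Obj} (ha : Tm par W .obj a)
    (hb : Tm par W .obj b) (hc : Tm par W .obj c) :
    Ex fo par W fun g => IsUPair (UModel.E N) (UModel.Atom N) (a g) (b g) (c g) :=
  .isUPair exAt_atom ha hb hc

theorem ex_isEmptySet_atom {a : Γ → N.Obj} (ha : Tm par W .obj a) :
    Ex fo par W fun g => IsEmptySet (UModel.E N) (UModel.Atom N) (a g) :=
  .isEmptySet exAt_atom ha

theorem ex_isPure_atom {a : Γ → N.Obj} (ha : Tm par W .obj a) :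
    Ex fo par W fun g => IsPure (UModel.E N) (UModel.Atom N) (a g) :=
  .isPure exAt_atom ha

end

/-- In an urelement model, `c` is `⟨0, i⟩` for the index `i` of the atom `x`. -/
def IsAtomCode (N : UModel.{u}) (x c : N.Obj) : Prop :=
  ∃ i, UModel.Enum N i x ∧ ∃ z, IsEmptySet (UModel.E N) (UModel.Atom N) z ∧
    IsOPair (UModel.E N) (UModel.Atom N) z i c

/-- In an urelement model, `c` is `⟨1, y⟩` where `y` is the image of the set `x` under `G`. -/
def IsSetCode (N : UModel.{u}) (G : Set N.Obj) (x c : N.Obj) : Prop :=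
  ¬ UModel.Atom N x ∧ ∃ y, ¬ UModel.Atom N y ∧
    (∃ z, IsEmptySet (UModel.E N) (UModel.Atom N) z ∧
      ∃ o, IsUPair (UModel.E N) (UModel.Atom N) z z o ∧
        IsOPair (UModel.E N) (UModel.Atom N) o y c) ∧
    (∀ v, UModel.E N v x → ∃ w, UModel.E N w y ∧ ∃ q, q ∈ G ∧
      IsOPair (UModel.E N) (UModel.Atom N) v w q) ∧
    ∀ w, UModel.E N w y → ∃ v, UModel.E N v x ∧ ∃ q, q ∈ G ∧
      IsOPair (UModel.E N) (UModel.Atom N) v w q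

/-- The class `G` of pairs is a partial solution of the recursion that codes the objects of an
urelement model by pure sets. -/
def IsCodeAttempt (N : UModel.{u}) (G : Set N.Obj) : Prop :=
  ∀ p, p ∈ G → ∃ x c, IsOPair (UModel.E N) (UModel.Atom N) x c p ∧
    (IsAtomCode N x c ∨ IsSetCode N G x c)

namespace GBC

theorem isEmptySet_uModel (hM : GBC M) (hA : A ∈ M.Cls) {z : (uModel M A).Obj} :
    IsEmptySet (UModel.E (uModel M A)) (UModel.Atom (uModel M A)) z ↔
      z = hM.ucheck hA hM.emp := by
  have h : ∀ w, ¬ UModel.E (uModel M A) w (hM.ucheck hA hM.emp) := fun w hw => by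
    obtain ⟨v, hv, -⟩ := (hM.uE_ucheck_iff hA).1 hw
    exact hM.not_mem_emp v hv
  constructor
  · rintro ⟨hz, hz'⟩
    exact hM.uModel_ext hA hz (hM.not_atom_ucheck hA _) fun w => iff_of_false (hz' w) (h w)
  · rintro rfl
    exact ⟨hM.not_atom_ucheck hA _, h⟩

theorem check_pair (hM : GBC M) (a b : M.Obj) :
    hM.check (hM.pair a b) = hM.tag1 (hM.pair (hM.check a) (hM.check b)) := by
  obtain ⟨y, hy, e⟩ := hM.exists_check_eq (hM.pair a b)
  rw [e, hM.tag1_inj]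
  refine hM.ext fun w => ?_
  simp only [hy, hM.mem_pair]
  grind

/-- This is what lets the urelement model compute the copies of tagged pairs, and so of its own
objects. -/
theorem check_op (hM : GBC M) (a b : M.Obj) :
    hM.check (hM.op a b) = hM.uop (hM.check a) (hM.check b) := by
  simp only [op, uop, hM.check_pair]

/-- The copy of ⟨0, a⟩ is the model's pair of the copies of 0 and of a, and the latter is the index
of the atom. -/
theorem isAtomCode_iff (hM : GBC M) (hA : A ∈ M.Cls) {x c : (uModel M A).Obj} :
    IsAtomCode (uModel M A) x c ↔
      UModel.Atom (uModel M A) x ∧ uval c = hM.check (uval x) := by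
  simp only [IsAtomCode, hM.isEmptySet_uModel hA, exists_eq_left, hM.isOPair_uModel hA]
  constructor
  · rintro ⟨i, hi, hc⟩
    obtain ⟨a, ha, hi', hx⟩ := hM.enum_iff.1 hi
    refine ⟨⟨i, hi⟩, ?_⟩
    rw [hc, hx, hi', tag0, hM.check_op]
    rfl
  · rintro ⟨⟨i, hi⟩, hc⟩
    obtain ⟨a, ha, hi', hx⟩ := hM.enum_iff.1 hi
    refine ⟨i, hi, ?_⟩
    rw [hc, hx, hi', tag0, hM.check_op]
    rfl

/-- The clauses that say that `c` is `⟨1, y⟩`. -/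
theorem isTagOne_uModel (hM : GBC M) (hA : A ∈ M.Cls) {y c : (uModel M A).Obj} :
    (∃ z, IsEmptySet (UModel.E (uModel M A)) (UModel.Atom (uModel M A)) z ∧
      ∃ o, IsUPair (UModel.E (uModel M A)) (UModel.Atom (uModel M A)) z z o ∧
        IsOPair (UModel.E (uModel M A)) (UModel.Atom (uModel M A)) o y c) ↔
      uval c = hM.uop (hM.check (hM.pair hM.emp hM.emp)) (uval y) := by
  simp only [hM.isEmptySet_uModel hA, exists_eq_left, hM.isOPair_uModel hA, hM.isUPair_uModel hA]
  constructor
  · rintro ⟨o, ho, hc⟩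
    rw [hc, ho, hM.check_pair]
    rfl
  · intro hc
    refine ⟨hM.ucheck hA (hM.pair hM.emp hM.emp), hM.check_pair _ _, hc⟩

/-- Codes are computed inside the urelement model, yet they agree with the check map of `M` applied
to the objects of the model. The proof is by induction in the model. -/
theorem eq_check_of_isCodeAttempt (hM : GBC M) (hA : A ∈ M.Cls) {G : Set (uModel M A).Obj}
    (hGc : G ∈ (uModel M A).Cls) (hG : IsCodeAttempt (uModel M A) G) {x c p : (uModel M A).Obj}
    (hp : p ∈ G) (hxc : IsOPair (UModel.E (uModel M A)) (UModel.Atom (uModel M A)) x c p) :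
    uval c = hM.check (uval x) := by
  have hGc := uCls_iff.1 hGc
  have hc := hM.ex_check
  refine hM.uModel_induction hA (X := {x | ∀ c p, IsUModelPair M x c p → p ∈ uval '' G →
    c = hM.check x}) (hM.comp ?_) ?_ x _ (uval p)
    (hM.isUModelPair_iff.2 ((hM.isOPair_uModel hA).1 hxc)) (mem_image_uval.2 hp)
  · intro Γ W x hx
    repeat' first | assumption | apply ex_isUModelPair | apply hc | constructor
  · rintro x ih c' _ hxc ⟨p, hp, rfl⟩
    obtain ⟨x', c, hxc', h⟩ := hG p hp
    obtain ⟨hx', rfl⟩ := hM.uop_inj.1 (((hM.isOPair_uModel hA).1 hxc').symm.trans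
      (hM.isUModelPair_iff.1 hxc))
    obtain rfl := uval_inj.1 hx'
    have ih' : ∀ v w q, UModel.E (uModel M A) v x' → q ∈ G →
        IsOPair (UModel.E (uModel M A)) (UModel.Atom (uModel M A)) v w q →
        uval w = hM.check (uval v) := fun v w q hv hq hvw =>
      ih v hv _ (uval q) (hM.isUModelPair_iff.2 ((hM.isOPair_uModel hA).1 hvw))
        (mem_image_uval.2 hq)
    rcases h with h | ⟨hx, y, hy, hcy, h1, h2⟩
    · exact ((hM.isAtomCode_iff hA).1 h).2
    · obtain ⟨z, ez, hz, Hz⟩ := hM.uModel_set hA hx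
      -- The object is ⟨1, z⟩, whose copy is the model's pair of the copies of 1 and of `z`. It
      -- remains to identify `y` with the copy of `z`, by extensionality.
      rw [(hM.isTagOne_uModel hA).1 hcy, ez, tag1, hM.check_op]
      congr 1
      refine (uval_inj (y := hM.ucheck hA z)).2 (hM.uModel_ext hA hy (hM.not_atom_ucheck hA _)
        fun w => ?_)
      rw [hM.uE_ucheck_iff hA]
      constructor
      · intro hw
        obtain ⟨v, hv, q, hq, hvw⟩ := h2 w hw
        exact ⟨uval v, (Hz v).1 hv, uval_inj.1 (ih' v w q hv hq hvw)⟩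
      · rintro ⟨v, hv, rfl⟩
        have hv' := (Hz (umk v (hz v hv))).2 hv
        obtain ⟨w, hw, q, hq, hvw⟩ := h1 _ hv'
        obtain rfl : w = hM.ucheck hA v := uval_inj.1 (ih' _ w q hv' hq hvw)
        exact hw

/-- The class of pairs of objects of the urelement model and their codes. -/
theorem exists_codeAttempt (hM : GBC M) (hA : A ∈ M.Cls) :
    ∃ G ∈ (uModel M A).Cls, IsCodeAttempt (uModel M A) G ∧
      ∀ x : (uModel M A).Obj, ∃ p, p ∈ G ∧ IsOPair (UModel.E (uModel M A))
        (UModel.Atom (uModel M A)) x (hM.ucheck hA (uval x)) p := by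
  have hc := hM.ex_check
  have hD := hM.uDomain_mem_cls hA
  have hG : {p | ∃ x, x ∈ UDomain M A ∧ ∃ c, c = hM.check x ∧ IsUModelPair M x c p} ∈ M.Cls := by
    refine hM.comp ?_
    intro Γ W x hx
    repeat' first | assumption | apply ex_isUModelPair | apply hc | constructor
  have key : ∀ x : (uModel M A).Obj, ∃ p : (uModel M A).Obj,
      (∃ x, x ∈ UDomain M A ∧ ∃ c, c = hM.check x ∧ IsUModelPair M x c (uval p)) ∧
      IsOPair (UModel.E (uModel M A)) (UModel.Atom (uModel M A)) x (hM.ucheck hA (uval x)) p :=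
    fun x => ⟨umk _ (hM.uop_mem (uval_mem x) (hM.check_mem_uDomain hA (uval x))),
      ⟨_, uval_mem x, _, rfl, hM.isUModelPair_iff.2 rfl⟩, (hM.isOPair_uModel hA).2 rfl⟩
  refine ⟨_, hM.preimage_mem_uCls hA hG, ?_, key⟩
  rintro p ⟨x, hx, _, rfl, hp⟩
  refine ⟨umk x hx, hM.ucheck hA x, (hM.isOPair_uModel hA).2 (hM.isUModelPair_iff.1 hp), ?_⟩
  by_cases hat : UModel.Atom (uModel M A) (umk x hx)
  · exact .inl ((hM.isAtomCode_iff hA).2 ⟨hat, rfl⟩)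
  · obtain ⟨z, ez, hz, Hz⟩ := hM.uModel_set hA hat
    refine .inr ⟨hat, hM.ucheck hA z, hM.not_atom_ucheck hA z, (hM.isTagOne_uModel hA).2 ?_,
      fun v hv => ?_, fun w hw => ?_⟩
    · rw [uval_umk] at ez
      subst ez
      exact hM.check_op _ _
    · obtain ⟨p, hp, hvp⟩ := key v
      exact ⟨_, (hM.ucheck_uE_ucheck_iff hA).2 ((Hz v).1 hv), p, hp, hvp⟩
    · obtain ⟨v, hv, rfl⟩ := (hM.uE_ucheck_iff hA).1 hw
      obtain ⟨p, hp, hvp⟩ := key (umk v (hz v hv))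
      exact ⟨_, (Hz (umk v (hz v hv))).2 hv, p, hp, hvp⟩

/-- The predicate mentions `M`, but a quantifier over code attempts expresses it inside the
urelement model without parameters. -/
theorem ex_code (hM : GBC M) (hA : A ∈ M.Cls) {Γ : Type u} {W : Vars (uModel M A) Γ}
    {x c : Γ → (uModel M A).Obj} (hx : Tm false W .obj x) (hc : Tm false W .obj c) :
    Ex false false W fun g => uval (c g) = hM.check (uval (x g)) := by
  refine Ex.congr (D := fun g => ∃ G : (uModel M A).Cls, IsCodeAttempt (uModel M A) G.1 ∧
    ∃ p, p ∈ G.1 ∧ IsOPair (UModel.E (uModel M A)) (UModel.Atom (uModel M A)) (x g) (c g) p)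
    ?_ fun g => ?_
  · have hat := exAt_atom (N := uModel M A) (fo := false) (par := false)
    unfold IsCodeAttempt IsAtomCode IsSetCode
    repeat'
      first
      | assumption
      | apply ex_isOPair_atom
      | apply ex_isUPair_atom
      | apply ex_isEmptySet_atom
      | apply hat
      | constructor
  · constructor
    · intro h
      obtain ⟨G, hGc, hG, H⟩ := hM.exists_codeAttempt hA
      obtain ⟨p, hp, hxp⟩ := H (x g)
      refine ⟨⟨G, hGc⟩, hG, p, hp, ?_⟩
      rwa [(uval_inj (y := hM.ucheck hA (uval (x g)))).1 h]
    · rintro ⟨G, hG, p, hp, hxp⟩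
      exact hM.eq_check_of_isCodeAttempt hA G.2 hG hp hxp

end GBC

/-- An element of `M` is represented by its copy in the urelement model. -/
def GBC.CheckRep (hM : GBC M) (A : Set M.Obj) :
    (σ : Srt) → (uModel M A).Dom σ → M.Dom σ → Prop
  | .obj => fun (a : (uModel M A).Obj) u => uval a = hM.check u
  | .cls => fun (C : (uModel M A).Cls) X => ∀ z, z ∈ C.1 ↔ ∃ u, u ∈ X.1 ∧ uval z = hM.check u

namespace GBC

theorem checkRep_obj (hM : GBC M) {a : (uModel M A).Obj} {u : M.Obj} :
    hM.CheckRep A .obj a u ↔ uval a = hM.check u := Iff.rfl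

theorem checkRep_cls (hM : GBC M) {C : (uModel M A).Cls} {X : M.Cls} :
    hM.CheckRep A .cls C X ↔ ∀ z, z ∈ C.1 ↔ ∃ u, u ∈ X.1 ∧ uval z = hM.check u := Iff.rfl

theorem exists_checkRep_cls (hM : GBC M) (hA : A ∈ M.Cls) {C : (uModel M A).Cls}
    (h : ∀ x, x ∈ C.1 → IsPure (UModel.E (uModel M A)) (UModel.Atom (uModel M A)) x) :
    ∃ X : M.Cls, hM.CheckRep A .cls C X := by
  have hc := hM.ex_check
  have hC := uCls_iff.1 C.2
  refine ⟨⟨{u | ∃ x, x ∈ uval '' C.1 ∧ x = hM.check u}, hM.comp ?_⟩, fun z => ?_⟩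
  · intro Γ W x hx
    repeat' first | assumption | apply hc | constructor
  · constructor
    · intro hz
      obtain ⟨u, rfl⟩ := (hM.isPure_iff hA).1 (h z hz)
      exact ⟨u, ⟨_, mem_image_uval.2 hz, rfl⟩, rfl⟩
    · rintro ⟨u, ⟨x, hx, rfl⟩, hz⟩
      rw [← hz] at hx
      exact mem_image_uval.1 hx

theorem isPure_of_checkRep (hM : GBC M) (hA : A ∈ M.Cls) {C : (uModel M A).Cls} {X : M.Cls}
    (h : hM.CheckRep A .cls C X) {x : (uModel M A).Obj} (hx : x ∈ C.1) :
    IsPure (UModel.E (uModel M A)) (UModel.Atom (uModel M A)) x := by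
  obtain ⟨u, -, hu⟩ := (hM.checkRep_cls.1 h x).1 hx
  exact (hM.isPure_iff hA).2 ⟨u, uval_inj.1 hu⟩

theorem checkRep_cls_mem (hM : GBC M) (hA : A ∈ M.Cls) {C : (uModel M A).Cls} {X : M.Cls}
    (h : hM.CheckRep A .cls C X) {u : M.Obj} : u ∈ X.1 ↔ hM.ucheck hA u ∈ C.1 := by
  rw [hM.checkRep_cls.1 h]
  constructor
  · exact fun hu => ⟨u, hu, rfl⟩
  · rintro ⟨v, hv, e⟩
    rwa [hM.check_inj.1 e]

/-- The interpretation of `M` in the urelement model. -/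
def pureInterpretation (hM : GBC M) (hA : A ∈ M.Cls) :
    Interpretation (uModel M A) (m := 0) ![] M :=
  .ofRel zero_le_one (hM.CheckRep A)
    (by
      rintro (_ | _) t x y h h'
      · exact hM.check_inj.1 ((hM.checkRep_obj.1 h).symm.trans (hM.checkRep_obj.1 h'))
      · exact Subtype.ext (Set.ext fun u =>
          (hM.checkRep_cls_mem hA h).trans (hM.checkRep_cls_mem hA h').symm))
    (by
      rintro (_ | _) x
      · exact ⟨hM.ucheck hA x, rfl⟩
      · have hc := hM.ex_check
        have hx := x.2
        exact ⟨⟨_, hM.preimage_mem_uCls hA (C := {z | ∃ u, u ∈ (x : M.Cls).1 ∧ z = hM.check u})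
          (hM.comp fun Γ W y hy => .exO (.and (.memS hx .v0 rfl) (hc .v0 (.l1 hy))))⟩,
          fun z => Iff.rfl⟩)
    (by
      rintro (_ | _)
      · refine .congr (D := fun (a b : (uModel M A).Dom .obj) => (a : (uModel M A).Obj) = b ∧
          IsPure (UModel.E (uModel M A)) (UModel.Atom (uModel M A)) a)
          (.of_ex (.and (.eq .v2 .v1) (ex_isPure_atom .v2))) fun a b => ?_
        refine Iff.trans ?_ (and_congr_right' (hM.isPure_iff hA).symm)
        constructor
        · rintro ⟨u, hu, hu'⟩
          exact ⟨uval_inj.1 ((hM.checkRep_obj.1 hu).trans (hM.checkRep_obj.1 hu').symm),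
            u, uval_inj.1 hu⟩
        · rintro ⟨rfl, u, rfl⟩
          exact ⟨u, rfl, rfl⟩
      · refine .congr (D := fun (a b : (uModel M A).Dom .cls) => ∀ x, (x ∈ (a : (uModel M A).Cls).1 ↔
            x ∈ (b : (uModel M A).Cls).1) ∧ (x ∈ (a : (uModel M A).Cls).1 →
            IsPure (UModel.E (uModel M A)) (UModel.Atom (uModel M A)) x))
          (.of_ex (.allO (.and (.iff (.memC .v0 .v3) (.memC .v0 .v2)) (.imp (.memC .v0 .v3)
            (ex_isPure_atom .v0))))) fun a b => ?_
        constructor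
        · rintro ⟨X, hX, hX'⟩ z
          exact ⟨(hM.checkRep_cls.1 hX z).trans (hM.checkRep_cls.1 hX' z).symm,
            hM.isPure_of_checkRep hA hX⟩
        · intro h
          obtain rfl : a = b := Subtype.ext (Set.ext fun x => (h x).1)
          obtain ⟨X, hX⟩ := hM.exists_checkRep_cls hA (C := a) fun x => (h x).2
          exact ⟨X, hX, hX⟩)
    (by
      rintro ⟨⟩
      refine .congr (D := fun (a b : (uModel M A).Dom .obj) =>
        (IsPure (UModel.E (uModel M A)) (UModel.Atom (uModel M A)) a ∧
          IsPure (UModel.E (uModel M A)) (UModel.Atom (uModel M A)) b) ∧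
        UModel.E (uModel M A) a b)
        (.of_ex (.and (.and (ex_isPure_atom .v2) (ex_isPure_atom .v1)) (.rel .v2 .v1)))
        fun a b => ?_
      refine Iff.trans ?_ (and_congr_left' (and_congr (hM.isPure_iff hA).symm
        (hM.isPure_iff hA).symm))
      constructor
      · rintro ⟨u, v, hu, hv, h⟩
        obtain rfl : a = hM.ucheck hA u := uval_inj.1 hu
        obtain rfl : b = hM.ucheck hA v := uval_inj.1 hv
        exact ⟨⟨⟨u, rfl⟩, ⟨v, rfl⟩⟩, (hM.ucheck_uE_ucheck_iff hA).2 h⟩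
      · rintro ⟨⟨⟨u, rfl⟩, ⟨v, rfl⟩⟩, h⟩
        exact ⟨u, v, rfl, rfl, (hM.ucheck_uE_ucheck_iff hA).1 h⟩)
    (by
      refine .congr (D := fun (a : (uModel M A).Dom .obj) (b : (uModel M A).Dom .cls) => (a : (uModel M A).Obj) ∈ (b : (uModel M A).Cls).1 ∧
        ∀ x, x ∈ (b : (uModel M A).Cls).1 →
          IsPure (UModel.E (uModel M A)) (UModel.Atom (uModel M A)) x)
        (.of_ex (.and (.memC .v2 .v1) (.allO (.imp (.memC .v0 .v2) (ex_isPure_atom .v0)))))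
        fun a b => ?_
      constructor
      · rintro ⟨u, X, hu, hX, hx⟩
        exact ⟨(hM.checkRep_cls.1 hX a).2 ⟨u, hx, hu⟩, fun x => hM.isPure_of_checkRep hA hX⟩
      · rintro ⟨ha, hb⟩
        obtain ⟨X, hX⟩ := hM.exists_checkRep_cls hA (C := b) hb
        obtain ⟨u, hu, hau⟩ := (hM.checkRep_cls.1 hX a).1 ha
        exact ⟨u, X, hau, hX, hu⟩)

/-- On objects the two return relations are those of `GBC.ex_isCheck` and `ex_code`; on classes they
are the corresponding images, taken elementwise. -/
theorem biInterpretable_uModel (hM : GBC M) (hA : A ∈ M.Cls) :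
    BiInterpretable M ![⟨A, hA⟩] (uModel M A) (k := 0) ![] := by
  refine ⟨hM.interpretation hA, hM.pureInterpretation hA,
    Interpretation.definableReturn_ofRel _ ?_, Interpretation.definableReturn_ofRel _ ?_⟩
  · rintro (_ | _)
    · refine .congr (D := fun (a b : M.Dom .obj) => (a : M.Obj) = hM.check b)
        (.of_ex (hM.ex_isCheck .v1 .v2)) fun a b => ?_
      constructor
      · rintro ⟨y, h, h'⟩
        exact (uRep_obj.1 h).trans (hM.checkRep_obj.1 h')
      · rintro rfl
        exact ⟨hM.ucheck hA b, rfl, rfl⟩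
    · refine .congr (D := fun (a b : M.Dom .cls) => ∀ z, z ∈ (a : M.Cls).1 ↔ ∃ u, u ∈ (b : M.Cls).1 ∧
          z = hM.check u)
        (.of_ex (.allO (.iff (.memC .v0 .v3) (.exO (.and (.memC .v0 .v3)
          (hM.ex_isCheck .v0 .v1)))))) fun a b => ?_
      constructor
      · rintro ⟨y, h, h'⟩ z
        rw [uRep_cls.1 h]
        constructor
        · rintro ⟨z, hz, rfl⟩
          exact (hM.checkRep_cls.1 h' z).1 hz
        · rintro ⟨u, hu, rfl⟩
          exact ⟨hM.ucheck hA u, (hM.checkRep_cls.1 h' _).2 ⟨u, hu, rfl⟩, rfl⟩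
      · intro h
        obtain ⟨X, hX⟩ := exists_uRep_cls (A := A) (C := a) fun z hz => by
          obtain ⟨u, -, rfl⟩ := (h z).1 hz
          exact hM.check_mem_uDomain hA u
        refine ⟨X, hX, fun z => ?_⟩
        rw [← h, uRep_cls.1 hX]
        exact mem_image_uval.symm
  · rintro (_ | _)
    · refine .congr (D := fun (a b : (uModel M A).Dom .obj) => uval (a : (uModel M A).Obj) = hM.check (uval b))
        (.of_ex (hM.ex_code hA .v1 .v2)) fun a b => ?_
      constructor
      · rintro ⟨y, h, rfl⟩
        exact h
      · intro h
        exact ⟨_, h, rfl⟩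
    · refine .congr (D := fun (a b : (uModel M A).Dom .cls) => ∀ z, z ∈ (a : (uModel M A).Cls).1 ↔
          ∃ x, x ∈ (b : (uModel M A).Cls).1 ∧ uval z = hM.check (uval x))
        (.of_ex (.allO (.iff (.memC .v0 .v3) (.exO (.and (.memC .v0 .v3)
          (hM.ex_code hA .v0 .v1)))))) fun a b => ?_
      constructor
      · rintro ⟨y, h, h'⟩ z
        rw [hM.checkRep_cls.1 h, uRep_cls.1 h']
        constructor
        · rintro ⟨_, ⟨x, hx, rfl⟩, hz⟩
          exact ⟨x, hx, hz⟩
        · rintro ⟨x, hx, hz⟩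
          exact ⟨_, ⟨x, hx, rfl⟩, hz⟩
      · intro h
        refine ⟨⟨_, uCls_iff.1 b.2⟩, fun z => (h z).trans ?_, rfl⟩
        constructor
        · rintro ⟨x, hx, hz⟩
          exact ⟨_, ⟨x, hx, rfl⟩, hz⟩
        · rintro ⟨_, ⟨x, hx, rfl⟩, hz⟩
          exact ⟨x, hx, hz⟩

end GBC

end SetModel

theorem mainTheorem11 (M : SetModel.{u}) (hM : SetModel.GBC M) (A : Set M.Obj) (hA : A ∈ M.Cls) :
    ClassModel.BiInterpretable M ![⟨A, hA⟩] (SetModel.uModel M A) ![] ∧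
    UModel.GBCU (SetModel.uModel M A) ∧
    UModel.ManyAtoms (SetModel.uModel M A) (SetModel.hat M A) ∧
    (SetModel.KM M → UModel.KMU (SetModel.uModel M A)) ∧
    (SetModel.CC M → UModel.CC (SetModel.uModel M A)) :=
  ⟨hM.biInterpretable_uModel hA, hM.gbcu_uModel hA, hM.manyAtoms_uModel hA,
    fun h => ⟨hM.gbcu_uModel hA, hM.secondOrderComprehension_uModel hA h.2⟩, hM.cc_uModel hA⟩
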